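/- Let $(M,\pi)$ be a smooth (finite-dimensional, Hausdorff, second countable) Poisson manifold, $(S,\omega)$ a symplectic manifold, and $I\subset\mathbb R$ a non-degenerate interval containing $0$ (for instance $[0,\epsilon_1)$). *Realization data* $(S,\omega,\alpha,\beta,\sigma)$ for a Poisson manifold $(M,\pi')$ consists of a Poisson map $\alpha:(S,\omega)\to(M,\pi')$ and an anti-Poisson map $\beta:(S,\omega)\to(M,\pi')$ with symplectically orthogonal fibres, $(\ker D_z\beta)^{\omega}=\ker D_z\alpha$ for all $z\in S$, and a smooth map $\sigma:M\to S$ with $\alpha\circ\sigma=\beta\circ\sigma=\mathrm{id}_M$ whose image is a Lagrangian submanifold. Two jointly smooth families $f_\epsilon,\hat f_\epsilon:S\to M$ $(\epsilon\in I)$ are *approximations of order $n$* of each other if $g\circ f_\epsilon-g\circ\hat f_\epsilon=O(\epsilon^{n+1})$ as $\epsilon\to0$ in $I$, uniformly on compact subsets of $S$, for every $g\in C^\infty(M)$ (for $M=\mathbb R^m$: $\|f_\epsilon-\hat f_\epsilon\|=O(\epsilon^{n+1})$ uniformly on compacts). *Approximate realization data of order $n$* for $(M,\epsilon\pi)$ is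 $\hat R_\epsilon=(S,\omega,\hat\alpha_\epsilon,\hat\beta_\epsilon,\sigma)$, $\epsilon\in I$, where $\hat\alpha_\epsilon,\hat\beta_\epsilon:S\to M$ are jointly smooth families with $\hat\alpha_\epsilon\circ\sigma=\hat\beta_\epsilon\circ\sigma=\mathrm{id}_M$ for all $\epsilon\in I$, which are approximations of order $n$ of jointly smooth families $\alpha_\epsilon,\beta_\epsilon$ such that $(S,\omega,\alpha_\epsilon,\beta_\epsilon,\sigma)$ is realization data for $(M,\epsilon\pi)$ for every $\epsilon\in I$. A submanifold $L\subset S$ is a *bisection* for $\alpha,\beta:S\to M$ if $\alpha|_L,\beta|_L:L\to M$ are diffeomorphisms. **Theorem.** Let $\hat R_\epsilon$, $\epsilon\in I$, be approximate realization data of order $n$ for $(M,\epsilon\pi)$, and let $J\subset I$ be a compact neighbourhood of $0$ in $I$. Then there is a neighbourhood $\mathcal U$ of $\sigma$ in the strong (Whitney) $C^1$ topology on maps $M\to S$ such that for every Lagrangian submanifold $L=\iota(M)$ of $(S,\omega)$ that is the image of a smooth embedding $\iota:M\to S$ with $\iota\in\mathcal U$: 1. $L$ is a bisection for $\hat\alpha_\epsilon$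 and $\hat\beta_\epsilon$, for every $\epsilon\in J$; 2. the induced map $\hat\varphi_{\epsilon,L}=\hat\alpha_\epsilon\circ(\hat\beta_\epsilon|_L)^{-1}:M\to M$ satisfies $\hat\varphi_{\epsilon,L}^*\pi-\pi=O(\epsilon^{n+1})$ as $\epsilon\to0$ in $I$, uniformly on compact subsets of $M$ (that is, $(\hat\varphi_{\epsilon,L}^*\pi)(df,dg)-\pi(df,dg)=O(\epsilon^{n+1})$ uniformly on compacts for all $f,g\in C^\infty(M)$); 3. for every Casimir $C\in C^\infty(M)$ of $\pi$, $\hat\varphi_{\epsilon,L}^*C-C=O(\epsilon^{n+1})$ as $\epsilon\to0$ in $I$, uniformly on compact subsets of $M$. -/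

import Mathlib

open scoped Manifold ContDiff Topology Bundle
open Set Bundle

noncomputable section PoissonGeometry

namespace PoissonRealization

section Bivectors

variable {E : Type*} [NormedAddCommGroup E] [NormedSpace ℝ E]
  {M : Type*} [TopologicalSpace M] [ChartedSpace E M]
  {F : Type*} [NormedAddCommGroup F] [NormedSpace ℝ F]
  {S : Type*} [TopologicalSpace S] [ChartedSpace F S]

/-- The differential `d_x f ∈ T*_x M` of a real function. -/
def differential (f : M → ℝ) (x : M) : TangentSpace 𝓘(ℝ, E) x →L[ℝ] ℝ :=
  mfderiv 𝓘(ℝ, E) 𝓘(ℝ, ℝ) f x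

/-- Smooth real functions on `M`. -/
def IsSmoothFun (E : Type*) [NormedAddCommGroup E] [NormedSpace ℝ E]
    {M : Type*} [TopologicalSpace M] [ChartedSpace E M] (f : M → ℝ) : Prop :=
  ContMDiff 𝓘(ℝ, E) 𝓘(ℝ, ℝ) ∞ f

/-- A (not necessarily continuous) field of bilinear forms on the cotangent spaces,
i.e. of contravariant 2-tensors. -/
abbrev TwoTensorField (E : Type*) [NormedAddCommGroup E] [NormedSpace ℝ E]
    (M : Type*) [TopologicalSpace M] [ChartedSpace E M] : Type _ :=
  ∀ x : M, (TangentSpace 𝓘(ℝ, E) x →L[ℝ] ℝ) →ₗ[ℝ] (TangentSpace 𝓘(ℝ, E) x →L[ℝ] ℝ) →ₗ[ℝ] ℝ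

/-- The bracket `{f, g} = P(df, dg)`. -/
def bracket (P : TwoTensorField E M) (f g : M → ℝ) (x : M) : ℝ :=
  P x (differential f x) (differential g x)

/-- `P` is a Poisson tensor: skew, smooth (smooth functions have smooth brackets), and its bracket
satisfies the Jacobi identity. -/
structure IsPoissonTensor (P : TwoTensorField E M) : Prop where
  skew : ∀ x ξ η, P x η ξ = -P x ξ η
  smooth : ∀ f g : M → ℝ, IsSmoothFun E f → IsSmoothFun E g → IsSmoothFun E (bracket P f g)
  jacobi : ∀ f g h : M → ℝ, IsSmoothFun E f → IsSmoothFun E g → IsSmoothFun E h → ∀ x,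
    bracket P (bracket P f g) h x + bracket P (bracket P h f) g x
      + bracket P (bracket P g h) f x = 0

/-- `C` is a Casimir function: smooth, with vanishing bracket with all smooth functions. -/
structure IsCasimir (P : TwoTensorField E M) (C : M → ℝ) : Prop where
  smooth : IsSmoothFun E C
  bracket_eq_zero : ∀ g : M → ℝ, IsSmoothFun E g → ∀ x, bracket P C g x = 0

/-- `φ : (S, P_S) → (M, P_M)` is a Poisson map: smooth, with
`{φ^*f, φ^*g}_S = φ^*{f, g}_M`. It is anti-Poisson if it is Poisson into `(M, -P_M)`. -/
structure IsPoissonMap (PS : TwoTensorField F S) (PM : TwoTensorField E M) (φ : S → M) : Prop where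
  smooth : ContMDiff 𝓘(ℝ, F) 𝓘(ℝ, E) ∞ φ
  map_bracket : ∀ f g : M → ℝ, IsSmoothFun E f → IsSmoothFun E g → ∀ z,
    bracket PS (f ∘ φ) (g ∘ φ) z = bracket PM f g (φ z)

/-- The pullback `φ^*P` by a diffeomorphism `φ`:
`(φ^*P)_x(ξ, η) = P_{φ(x)}(ξ ∘ (D_xφ)⁻¹, η ∘ (D_xφ)⁻¹)`. -/
def pullbackTensor (φ : M → M) (P : TwoTensorField E M) : TwoTensorField E M := fun x =>
  let A : TangentSpace 𝓘(ℝ, E) (φ x) →L[ℝ] TangentSpace 𝓘(ℝ, E) x :=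
    (mfderiv 𝓘(ℝ, E) 𝓘(ℝ, E) φ x).inverse
  LinearMap.mk₂ ℝ (fun ξ η => P (φ x) (ξ.comp A) (η.comp A))
    (fun ξ ξ' η => by simp [ContinuousLinearMap.add_comp])
    (fun c ξ η => by simp [ContinuousLinearMap.smul_comp])
    (fun ξ η η' => by simp [ContinuousLinearMap.add_comp])
    (fun c ξ η => by simp [ContinuousLinearMap.smul_comp])

end Bivectors

section Symplectic

/-- A symplectic form: a smooth, alternating, nondegenerate, closed 2-form. Closedness is expressed
by the invariant formula for `dΩ(X, Y, Z)` on smooth vector fields. -/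
structure SymplecticForm (F : Type*) [NormedAddCommGroup F] [NormedSpace ℝ F]
    (S : Type*) [TopologicalSpace S] [ChartedSpace F S] [IsManifold 𝓘(ℝ, F) ∞ S] where
  form : ∀ z : S, TangentSpace 𝓘(ℝ, F) z →L[ℝ] TangentSpace 𝓘(ℝ, F) z →L[ℝ] ℝ
  smooth : ContMDiff 𝓘(ℝ, F) (𝓘(ℝ, F).prod 𝓘(ℝ, F →L[ℝ] F →L[ℝ] ℝ)) ∞
    (fun z => TotalSpace.mk' (F →L[ℝ] F →L[ℝ] ℝ)
      (E := fun z : S => TangentSpace 𝓘(ℝ, F) z →L[ℝ] TangentSpace 𝓘(ℝ, F) z →L[ℝ] ℝ) z (form z))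
  alternating : ∀ z v, form z v v = 0
  nondegenerate : ∀ z v, (∀ w, form z v w = 0) → v = 0
  closed : ∀ X Y Z : ∀ z : S, TangentSpace 𝓘(ℝ, F) z,
    ContMDiff 𝓘(ℝ, F) 𝓘(ℝ, F).tangent ∞ (fun z => (⟨z, X z⟩ : TangentBundle 𝓘(ℝ, F) S)) →
    ContMDiff 𝓘(ℝ, F) 𝓘(ℝ, F).tangent ∞ (fun z => (⟨z, Y z⟩ : TangentBundle 𝓘(ℝ, F) S)) →
    ContMDiff 𝓘(ℝ, F) 𝓘(ℝ, F).tangent ∞ (fun z => (⟨z, Z z⟩ : TangentBundle 𝓘(ℝ, F) S)) →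
    ∀ z, differential (E := F) (fun y => form y (Y y) (Z y)) z (X z)
      + differential (E := F) (fun y => form y (Z y) (X y)) z (Y z)
      + differential (E := F) (fun y => form y (X y) (Y y)) z (Z z)
      - form z (VectorField.mlieBracket 𝓘(ℝ, F) X Y z) (Z z)
      - form z (VectorField.mlieBracket 𝓘(ℝ, F) Y Z z) (X z)
      - form z (VectorField.mlieBracket 𝓘(ℝ, F) Z X z) (Y z) = 0

variable {F : Type*} [NormedAddCommGroup F] [NormedSpace ℝ F] [FiniteDimensional ℝ F]
  {S : Type*} [TopologicalSpace S] [ChartedSpace F S] [IsManifold 𝓘(ℝ, F) ∞ S]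

namespace SymplecticForm

/-- A linear isomorphism `T_z S ≃ T*_z S`, `v ↦ Ω_z(v, ·)`. -/
def flat (Ω : SymplecticForm F S) (z : S) :
    TangentSpace 𝓘(ℝ, F) z ≃ₗ[ℝ] (TangentSpace 𝓘(ℝ, F) z →L[ℝ] ℝ) :=
  LinearEquiv.ofBijective (Ω.form z).toLinearMap (by
    have hinj : Function.Injective (Ω.form z).toLinearMap := by
      refine (injective_iff_map_eq_zero _).2 fun v hv => Ω.nondegenerate z v fun w => ?_
      exact congrArg (fun l : TangentSpace 𝓘(ℝ, F) z →L[ℝ] ℝ => l w) hv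
    have key : ∀ B : F →ₗ[ℝ] (F →L[ℝ] ℝ), Function.Injective B → Function.Surjective B := by
      intro B hB
      have hdim : Module.finrank ℝ F = Module.finrank ℝ (F →L[ℝ] ℝ) := by
        rw [← (LinearMap.toContinuousLinearMap (𝕜 := ℝ) (E := F) (F' := ℝ)).finrank_eq]
        exact (Subspace.dual_finrank_eq (K := ℝ) (V := F)).symm
      exact (LinearMap.injective_iff_surjective_of_finrank_eq_finrank hdim).1 hB
    exact ⟨hinj, key _ hinj⟩)

/-- The Poisson tensor of `Ω`: `P_Ω(ξ, η) = η(v)` with `Ω(v, ·) = ξ`. Thus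
`{f, g}_Ω = X_f(g)` with the Hamiltonian vector field `X_f` given by `Ω(X_f, ·) = df`;
for `Ω = dp ∧ dx` this gives `{x, p} = 1`. -/
def poissonTensor (Ω : SymplecticForm F S) : TwoTensorField F S := fun z =>
  LinearMap.mk₂ ℝ (fun ξ η => η ((Ω.flat z).symm ξ))
    (fun ξ ξ' η => by simp) (fun c ξ η => by simp) (fun ξ η η' => by simp) (fun c ξ η => by simp)

end SymplecticForm

variable {E : Type*} [NormedAddCommGroup E] [NormedSpace ℝ E]
  {M : Type*} [TopologicalSpace M] [ChartedSpace E M]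

/-- `ι : M → S` is a Lagrangian embedding, i.e. it parametrizes the embedded Lagrangian submanifold
`range ι` of `(S, Ω)`: isotropic and of half the dimension of `S`. -/
structure IsLagrangianEmbedding (Ω : SymplecticForm F S) (ι : M → S) : Prop where
  embedding : Manifold.IsSmoothEmbedding 𝓘(ℝ, E) 𝓘(ℝ, F) ∞ ι
  isotropic : ∀ (x : M) (v w : TangentSpace 𝓘(ℝ, E) x),
    Ω.form (ι x) (mfderiv 𝓘(ℝ, E) 𝓘(ℝ, F) ι x v) (mfderiv 𝓘(ℝ, E) 𝓘(ℝ, F) ι x w) = 0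
  half_dim : 2 * Module.finrank ℝ E = Module.finrank ℝ F

/-- `(S, Ω, α, β, σ)` is realization data for `(M, P)`. -/
structure IsRealizationData (Ω : SymplecticForm F S) (P : TwoTensorField E M)
    (α β : S → M) (σ : M → S) : Prop where
  poisson : IsPoissonMap Ω.poissonTensor P α
  antiPoisson : IsPoissonMap Ω.poissonTensor (-P) β
  /-- `ker D_zα` is the symplectic orthogonal of `ker D_zβ`. -/
  orthogonal : ∀ (z : S) (v : TangentSpace 𝓘(ℝ, F) z),
    mfderiv 𝓘(ℝ, F) 𝓘(ℝ, E) α z v = 0 ↔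
      ∀ w : TangentSpace 𝓘(ℝ, F) z, mfderiv 𝓘(ℝ, F) 𝓘(ℝ, E) β z w = 0 → Ω.form z w v = 0
  section_left : ∀ x, α (σ x) = x
  section_right : ∀ x, β (σ x) = x
  lagrangian : IsLagrangianEmbedding (E := E) Ω σ

end Symplectic

section Approximation

/-- `r_ε = O(ε^k)` as `ε → 0` in `I`, uniformly on compact sets. -/
def IsUniformO {X : Type*} [TopologicalSpace X] (I : Set ℝ) (k : ℕ) (r : ℝ → X → ℝ) : Prop :=
  ∀ K : Set X, IsCompact K → ∃ C : ℝ, ∃ δ > 0, ∀ ε ∈ I, |ε| < δ → ∀ x ∈ K,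
    |r ε x| ≤ C * |ε| ^ k

variable {E : Type*} [NormedAddCommGroup E] [NormedSpace ℝ E]
  {M : Type*} [TopologicalSpace M] [ChartedSpace E M]
  {F : Type*} [NormedAddCommGroup F] [NormedSpace ℝ F]
  {S : Type*} [TopologicalSpace S] [ChartedSpace F S]

/-- A family of maps `f_ε : S → M`, `ε ∈ I`, that is jointly smooth on `S × I`. -/
def IsSmoothFamily (F : Type*) [NormedAddCommGroup F] [NormedSpace ℝ F]
    (E : Type*) [NormedAddCommGroup E] [NormedSpace ℝ E]
    {S : Type*} [TopologicalSpace S] [ChartedSpace F S]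
    {M : Type*} [TopologicalSpace M] [ChartedSpace E M]
    (I : Set ℝ) (f : ℝ → S → M) : Prop :=
  ContMDiffOn (𝓘(ℝ, F).prod 𝓘(ℝ, ℝ)) 𝓘(ℝ, E) ∞ (fun p : S × ℝ => f p.2 p.1) (univ ×ˢ I)

/-- `f_ε = f̂_ε mod O(ε^{n+1})` for two families of maps into a manifold: after composition with any
smooth function on `M`, the difference is `O(ε^{n+1})` uniformly on compacts. For jointly smooth
families into a vector space this says the same as `‖f_ε(z) - f̂_ε(z)‖ = O(ε^{n+1})`
uniformly on compacts. -/
def IsApproximation (E : Type*) [NormedAddCommGroup E] [NormedSpace ℝ E]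
    {M : Type*} [TopologicalSpace M] [ChartedSpace E M] {S : Type*} [TopologicalSpace S]
    (I : Set ℝ) (n : ℕ) (f fhat : ℝ → S → M) : Prop :=
  ∀ g : M → ℝ, IsSmoothFun E g →
    IsUniformO I (n + 1) (fun ε z => g (f ε z) - g (fhat ε z))

/-- `(S, Ω, α̂_ε, β̂_ε, σ)`, `ε ∈ I`, is approximate realization data of order `n` for
`(M, εP)`: the maps `α̂`, `β̂` approximate to order `n` those of a smooth family of realization
data `(S, Ω, α_ε, β_ε, σ)` for `(M, εP)`, and `σ` is a section of both. -/
structure IsApproxRealizationData [FiniteDimensional ℝ F] [IsManifold 𝓘(ℝ, F) ∞ S]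
    (Ω : SymplecticForm F S) (P : TwoTensorField E M) (I : Set ℝ) (n : ℕ)
    (αhat βhat : ℝ → S → M) (σ : M → S) : Prop where
  smooth_left : IsSmoothFamily F E I αhat
  smooth_right : IsSmoothFamily F E I βhat
  section_left : ∀ ε ∈ I, ∀ x, αhat ε (σ x) = x
  section_right : ∀ ε ∈ I, ∀ x, βhat ε (σ x) = x
  approximates : ∃ α β : ℝ → S → M,
    IsSmoothFamily F E I α ∧ IsSmoothFamily F E I β ∧
    (∀ ε ∈ I, IsRealizationData Ω (ε • P) (α ε) (β ε) σ) ∧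
    IsApproximation E I n α αhat ∧ IsApproximation E I n β βhat

end Approximation

section PullbackInstances

variable {B B' : Type*} (f : B' → B) (V : B → Type*)

instance instAddCommGroupPullback [∀ x, AddCommGroup (V x)] (x : B') :
    AddCommGroup ((f *ᵖ V) x) :=
  inferInstanceAs (AddCommGroup (V (f x)))

instance instIsTopologicalAddGroupPullback [∀ x, AddCommGroup (V x)]
    [∀ x, TopologicalSpace (V x)] [∀ x, IsTopologicalAddGroup (V x)] (x : B') :
    IsTopologicalAddGroup ((f *ᵖ V) x) :=
  inferInstanceAs (IsTopologicalAddGroup (V (f x)))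

instance instContinuousSMulPullback [∀ x, AddCommGroup (V x)] [∀ x, Module ℝ (V x)]
    [∀ x, TopologicalSpace (V x)] [∀ x, ContinuousSMul ℝ (V x)] (x : B') :
    ContinuousSMul ℝ ((f *ᵖ V) x) :=
  inferInstanceAs (ContinuousSMul ℝ (V (f x)))

end PullbackInstances

section Bisections

variable {E : Type*} [NormedAddCommGroup E] [NormedSpace ℝ E]
  {M : Type*} [TopologicalSpace M] [ChartedSpace E M]
  {F : Type*} [NormedAddCommGroup F] [NormedSpace ℝ F]
  {S : Type*} [TopologicalSpace S] [ChartedSpace F S]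

/-- The smooth map `α : S → M` restricts to a diffeomorphism `L → M`, for a submanifold `L ⊆ S`:
it restricts to a bijection, and the inverse `s : M → L ⊆ S` is smooth. -/
def RestrictsToDiffeo (F : Type*) [NormedAddCommGroup F] [NormedSpace ℝ F]
    (E : Type*) [NormedAddCommGroup E] [NormedSpace ℝ E]
    {S : Type*} [TopologicalSpace S] [ChartedSpace F S]
    {M : Type*} [TopologicalSpace M] [ChartedSpace E M] (α : S → M) (L : Set S) : Prop :=
  BijOn α L univ ∧ ∃ s : M → S, ContMDiff 𝓘(ℝ, E) 𝓘(ℝ, F) ∞ s ∧ (∀ x, s x ∈ L) ∧ ∀ x, α (s x) = x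

/-- The submanifold `L ⊆ S` is a bisection for `α` and `β`. -/
def IsBisection (F : Type*) [NormedAddCommGroup F] [NormedSpace ℝ F]
    (E : Type*) [NormedAddCommGroup E] [NormedSpace ℝ E]
    {S : Type*} [TopologicalSpace S] [ChartedSpace F S]
    {M : Type*} [TopologicalSpace M] [ChartedSpace E M] (α β : S → M) (L : Set S) : Prop :=
  RestrictsToDiffeo F E α L ∧ RestrictsToDiffeo F E β L

open Classical in
/-- The induced map `φ_L = α ∘ (β|_L)⁻¹` (the value `x` is used only outside `β(L)`,
which is all of `M` for a bisection). -/
def inducedMap {S M : Type*} (α β : S → M) (L : Set S) (x : M) : M :=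
  if h : ∃ z ∈ L, β z = x then α h.choose else x

/-- The space `J¹(M, S)` of 1-jets of maps `M → S`: the bundle over `M × S` with fibre
`Hom(T_x M, T_y S)`, with the vector bundle topology. -/
abbrev OneJets (E : Type*) [NormedAddCommGroup E] [NormedSpace ℝ E]
    (M : Type*) [TopologicalSpace M] [ChartedSpace E M]
    (F : Type*) [NormedAddCommGroup F] [NormedSpace ℝ F]
    (S : Type*) [TopologicalSpace S] [ChartedSpace F S] : Type _ :=
  TotalSpace (E →L[ℝ] F) (fun p : M × S =>
    ((ContinuousMap.fst : C(M × S, M)) *ᵖ (TangentSpace 𝓘(ℝ, E) : M → Type _)) p →L[ℝ]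
      ((ContinuousMap.snd : C(M × S, S)) *ᵖ (TangentSpace 𝓘(ℝ, F) : S → Type _)) p)

/-- The 1-jet `(x, f(x), D_x f)` of `f` at `x`. -/
def oneJet (f : M → S) (x : M) : OneJets E M F S :=
  ⟨(x, f x), mfderiv 𝓘(ℝ, E) 𝓘(ℝ, F) f x⟩

/-- The basic open set of the strong (Whitney) `C¹` topology on maps `M → S` that is given by
a set `W` of 1-jets: all 1-jets of `f` lie in `W`. -/
def JetsIn (W : Set (OneJets E M F S)) (f : M → S) : Prop :=
  ∀ x, oneJet f x ∈ W

end Bisections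

end PoissonRealization

end PoissonGeometry

/-! For exact data, a Lagrangian `L = range ι` transverse to the fibres of `α_ε` and `β_ε` induces a
Poisson map. If `ξ` and `η` pull back to the same covector on `L` through `α_ε` and `β_ε`, their
Hamiltonian vectors differ by a vector orthogonal to `L`, hence tangent to `L`. Isotropy and the
orthogonality of the fibres then give `εP(ξ₁, ξ₂) = εP(η₁, η₂)` (`lagrangian_bisection_pairing`,
`lagrangian_bisection_poisson`). For `ε ≠ 0` the factor cancels; `ε = 0` follows by continuity.

If `C` is a Casimir, the Hamiltonian vector of `C ∘ α_ε` lies in `ker Dα_ε`, so `d(C ∘ α_ε)` kills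
`ker Dβ_ε` and `C ∘ α_ε` is constant on `β_ε`-fibres near `σ`. Comparing `z` with `σ (β_ε z)` gives
`C ∘ α_ε = C ∘ β_ε` near `σ` (`casimir_comp_differential_eq_zero`,
`eventually_eq_section_of_fibres`).

The approximation inherits both facts up to `O(ε^{n+1})`. The Casimir statement needs only values.
The bivector statement needs first derivatives in space as well: for jointly smooth families a
pointwise `O(ε^k)` bound is automatically locally uniform and passes to these derivatives
(`isBigO_and_fderivWithin_isBigO`). The failure to be Poisson is a smooth function `pairingDefect`
of a 1-jet that vanishes on exact data, hence is `O(ε^{n+1})` on approximate data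
(`isBigO_bracket_pullbackTensor`).

For the bisection property, `α̂_ε ∘ ι` and `β̂_ε ∘ ι` are close to the identity when `ι` is close to
`σ`, because `σ` is a section. A self-map close enough to the identity in the strong `C¹` sense is a
diffeomorphism (`bijective_of_isCloseJet`). The conditions are open in the pair (jet, `ε`), so
compactness of `J` gives one open set of jets. Estimates are made in the moving parametrization `x =
β̂_ε (ι y)` and transferred to compact sets of `x` by `isUniformO_of_isBigO_comp`. -/

open PoissonRealization

set_option linter.unusedSectionVars false

/-! ### Orders of vanishing in one variable, at a possibly one-sided endpoint -/

section Taylor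

open Asymptotics Filter

variable {G : Type*} [NormedAddCommGroup G] [NormedSpace ℝ G] {I : Set ℝ}

/-- A nontrivial interval has no isolated points. This is what lets limits along `ε ≠ 0` determine
values at `ε = 0`, even when `0` is an endpoint of `I`. -/
theorem neBot_nhdsWithin_diff_singleton_zero (hI : Convex ℝ I) (hI' : I.Nontrivial)
    (h0 : (0 : ℝ) ∈ I) : (𝓝[I \ {0}] (0 : ℝ)).NeBot := by
  have := (hI.isPreconnected.preperfect_of_nontrivial hI') 0 h0
  rw [accPt_principal_iff_nhdsWithin] at this
  exact this

theorem eq_zero_of_pow_smul_isLittleO (hI : Convex ℝ I) (hI' : I.Nontrivial) (h0 : (0 : ℝ) ∈ I)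
    {c : G} {k : ℕ}
    (h : (fun x : ℝ => x ^ k • c) =o[𝓝[I] 0] fun x : ℝ => x ^ k) : c = 0 := by
  have := neBot_nhdsWithin_diff_singleton_zero hI hI' h0
  have h' := h.mono (nhdsWithin_mono 0 (sdiff_subset : I \ {0} ⊆ I))
  have h2 : Tendsto (fun x : ℝ => (x ^ k)⁻¹ • (x ^ k • c)) (𝓝[I \ {0}] 0) (𝓝 0) :=
    h'.tendsto_inv_smul_nhds_zero
  refine tendsto_nhds_unique (tendsto_const_nhds.congr' ?_) h2
  filter_upwards [self_mem_nhdsWithin] with x hx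
  rw [inv_smul_smul₀ (pow_ne_zero _ hx.2)]

theorem pow_isBigO_pow_nhdsWithin_zero {j k : ℕ} (h : j ≤ k) :
    (fun x : ℝ => x ^ k) =O[𝓝[I] 0] fun x : ℝ => x ^ j := by
  refine IsBigO.of_bound 1 ?_
  have : ∀ᶠ x : ℝ in 𝓝 0, ‖x‖ < 1 := by
    simpa [Metric.ball, dist_eq_norm] using! Metric.ball_mem_nhds (0 : ℝ) one_pos
  filter_upwards [mem_nhdsWithin_of_mem_nhds this] with x hx
  simp only [norm_pow, one_mul]
  exact pow_le_pow_of_le_one (norm_nonneg _) hx.le h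

theorem pow_succ_isLittleO_pow_nhdsWithin_zero (k : ℕ) :
    (fun x : ℝ => x ^ (k + 1)) =o[𝓝[I] 0] fun x : ℝ => x ^ k :=
  (isLittleO_pow_pow (𝕜 := ℝ) k.lt_succ_self).mono nhdsWithin_le_nhds

/-- A smooth function on an interval that is `O(ε ^ k)` has vanishing derivatives up to
order `k - 1`. -/
theorem iteratedDerivWithin_eq_zero_of_isBigO (hI : Convex ℝ I) (hI' : I.Nontrivial)
    (h0 : (0 : ℝ) ∈ I) {h : ℝ → G} (hh : ContDiffOn ℝ ∞ h I) {k : ℕ}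
    (hO : h =O[𝓝[I] 0] fun x : ℝ => x ^ k) {j : ℕ} (hj : j < k) :
    iteratedDerivWithin j h I 0 = 0 := by
  induction j using Nat.strong_induction_on with
  | _ j ih =>
    have hT := taylor_isLittleO (n := j) hI h0 (hh.of_le (by exact_mod_cast le_top))
    have hT' : (fun x => h x - ((j.factorial : ℝ)⁻¹ * x ^ j) • iteratedDerivWithin j h I 0)
        =o[𝓝[I] 0] fun x : ℝ => x ^ j := by
      refine (hT.congr_left fun x => ?_).congr_right fun x => by rw [sub_zero]
      rw [taylor_within_apply, Finset.sum_range_succ, Finset.sum_eq_zero, zero_add, sub_zero]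
      intro i hi
      have hij := Finset.mem_range.1 hi
      rw [ih i hij (hij.trans hj), smul_zero]
    have hO' : h =o[𝓝[I] 0] fun x : ℝ => x ^ j :=
      (hO.trans (pow_isBigO_pow_nhdsWithin_zero (Nat.succ_le_of_lt hj))).trans_isLittleO
        (pow_succ_isLittleO_pow_nhdsWithin_zero j)
    -- Both `h` and `h` minus its leading Taylor term are `o(x ^ j)`, so the leading term is too and
    -- its coefficient vanishes.
    have h3 := hO'.sub hT'
    have h4 : (j.factorial : ℝ)⁻¹ • iteratedDerivWithin j h I 0 = 0 := by
      refine eq_zero_of_pow_smul_isLittleO hI hI' h0 (k := j) (h3.congr_left fun x => ?_)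
      rw [sub_sub_cancel, smul_smul, mul_comm]
    exact (smul_eq_zero.1 h4).resolve_left (by positivity)

/-- Bounds of order cannot be differentiated in general, but for smooth `h` they say that the Taylor
coefficients below order `k + 1` vanish. The derivative then has no coefficients below order `k`,
and its Taylor expansion gives the bound. -/
theorem derivWithin_isBigO_of_isBigO (hI : Convex ℝ I) (hI' : I.Nontrivial)
    (h0 : (0 : ℝ) ∈ I) {h : ℝ → G} (hh : ContDiffOn ℝ ∞ h I) {k : ℕ}
    (hO : h =O[𝓝[I] 0] fun x : ℝ => x ^ (k + 1)) :
    derivWithin h I =O[𝓝[I] 0] fun x : ℝ => x ^ k := by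
  have hu : UniqueDiffOn ℝ I := uniqueDiffOn_convex hI (hI.nontrivial_iff_nonempty_interior.1 hI')
  have hd : ContDiffOn ℝ k (derivWithin h I) I :=
    hh.derivWithin hu (by exact_mod_cast le_top)
  have hT := (taylor_isLittleO (n := k) hI h0 hd).isBigO
  have hT' : (fun x => derivWithin h I x -
      ((k.factorial : ℝ)⁻¹ * x ^ k) • iteratedDerivWithin k (derivWithin h I) I 0)
      =O[𝓝[I] 0] fun x : ℝ => x ^ k := by
    refine (hT.congr_left fun x => ?_).congr_right fun x => by rw [sub_zero]
    rw [taylor_within_apply, Finset.sum_range_succ, Finset.sum_eq_zero, zero_add, sub_zero]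
    intro i hi
    have hij := Finset.mem_range.1 hi
    rw [← iteratedDerivWithin_succ',
      iteratedDerivWithin_eq_zero_of_isBigO hI hI' h0 hh hO (by omega), smul_zero]
  have h5 : (fun x : ℝ => ((k.factorial : ℝ)⁻¹ * x ^ k) •
      iteratedDerivWithin k (derivWithin h I) I 0) =O[𝓝[I] 0] fun x : ℝ => x ^ k := by
    refine IsBigO.of_bound (‖(k.factorial : ℝ)⁻¹‖ * ‖iteratedDerivWithin k (derivWithin h I) I 0‖)
      (Eventually.of_forall fun x => le_of_eq ?_)
    rw [norm_smul, norm_mul]; ring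
  exact (hT'.add h5).congr_left fun x => by abel

/-- The mean value inequality on the segment from `0` to `ε` gains one factor `ε`, with a constant
as uniform in `u` as the one for `r'`. -/
theorem isBigO_pow_succ_of_hasDerivWithinAt {X : Type*} [TopologicalSpace X]
    {U : Set X} (hI : Convex ℝ I) (h0 : (0 : ℝ) ∈ I)
    (hU : IsOpen U) {r r' : X × ℝ → G}
    (hr : ∀ u ∈ U, ∀ ε ∈ I, HasDerivWithinAt (fun t => r (u, t)) (r' (u, ε)) I ε)
    (hr0 : ∀ u ∈ U, r (u, 0) = 0) {k : ℕ} {u₀ : X} (hu₀ : u₀ ∈ U)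
    (hr' : r' =O[𝓝 u₀ ×ˢ 𝓝[I] 0] fun p => p.2 ^ k) :
    r =O[𝓝 u₀ ×ˢ 𝓝[I] 0] fun p => p.2 ^ (k + 1) := by
  obtain ⟨C, hC0, hC⟩ := hr'.exists_nonneg
  rw [isBigOWith_iff] at hC
  obtain ⟨p, hp, q, hq, hpq⟩ := eventually_prod_iff.1 hC
  obtain ⟨δ, hδ, hq⟩ := Metric.mem_nhdsWithin_iff.1 hq
  refine IsBigO.of_bound C ?_
  have hT : Metric.ball (0 : ℝ) δ ∩ I ∈ 𝓝[I] (0 : ℝ) :=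
    inter_mem (mem_nhdsWithin_of_mem_nhds (Metric.ball_mem_nhds _ hδ)) self_mem_nhdsWithin
  filter_upwards [prod_mem_prod (inter_mem hp (hU.mem_nhds hu₀)) hT]
  rintro ⟨u, ε⟩ ⟨⟨hu, huU⟩, hεδ, hεI⟩
  change u ∈ U at huU
  change ε ∈ I at hεI
  have hsub : segment ℝ 0 ε ⊆ I := hI.segment_subset h0 hεI
  have hle : ∀ t ∈ segment ℝ 0 ε, ‖t‖ ≤ ‖ε‖ := by
    rintro t ⟨a, b, ha, hb, hab, rfl⟩
    rw [smul_zero, zero_add, norm_smul, Real.norm_of_nonneg hb]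
    exact mul_le_of_le_one_left (norm_nonneg _) (by linarith)
  have key := Convex.norm_image_sub_le_of_norm_hasDerivWithin_le (C := C * ‖ε‖ ^ k)
    (f := fun t => r (u, t)) (f' := fun t => r' (u, t)) (s := segment ℝ 0 ε)
    (fun t ht => (hr u huU t (hsub ht)).mono hsub)
    (fun t ht => by
      have htδ : t ∈ Metric.ball (0 : ℝ) δ := by
        rw [mem_ball_zero_iff] at hεδ ⊢
        exact (hle t ht).trans_lt hεδ
      refine (hpq hu (hq ⟨htδ, hsub ht⟩)).trans ?_
      rw [norm_pow]
      gcongr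
      exact hle t ht)
    (convex_segment _ _) (left_mem_segment ℝ 0 ε) (right_mem_segment ℝ 0 ε)
  simp only [hr0 u huU, sub_zero] at key
  rw [norm_pow, pow_succ, ← mul_assoc]
  exact key

end Taylor

/-! ### Orders of vanishing for jointly smooth families -/

section ParametricTaylor

open Asymptotics Filter

variable {E : Type*} [NormedAddCommGroup E] [NormedSpace ℝ E]
  {G : Type*} [NormedAddCommGroup G] [NormedSpace ℝ G] {I : Set ℝ} {U : Set E}

theorem hasDerivWithinAt_slice {r : E × ℝ → G} (hr : ContDiffOn ℝ ∞ r (U ×ˢ I))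
    {u : E} (hu : u ∈ U) {ε : ℝ} (hε : ε ∈ I) :
    HasDerivWithinAt (fun t => r (u, t)) (fderivWithin ℝ r (U ×ˢ I) (u, ε) (0, 1)) I ε := by
  have h1 := (hr.differentiableOn (by simp) (u, ε) ⟨hu, hε⟩).hasFDerivWithinAt
  have h2 : HasDerivWithinAt (fun t : ℝ => (u, t)) ((0 : E), (1 : ℝ)) I ε :=
    (hasDerivWithinAt_const ε I u).prodMk (hasDerivWithinAt_id ε I)
  exact h1.comp_hasDerivWithinAt ε h2 fun t ht => ⟨hu, ht⟩

/-- A jointly smooth family that is `O(ε ^ k)` pointwise is so locally uniformly, together with its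
first partial derivative. -/
theorem isBigO_and_fderivWithin_isBigO (hI : Convex ℝ I) (hI' : I.Nontrivial) (h0 : (0 : ℝ) ∈ I)
    (hU : IsOpen U) (k : ℕ) {r : E × ℝ → G} (hr : ContDiffOn ℝ ∞ r (U ×ˢ I))
    (hO : ∀ u ∈ U, (fun ε => r (u, ε)) =O[𝓝[I] 0] fun ε : ℝ => ε ^ k) {u₀ : E} (hu₀ : u₀ ∈ U) :
    r =O[𝓝 u₀ ×ˢ 𝓝[I] 0] (fun p => p.2 ^ k) ∧
    (fun p => (fderivWithin ℝ r (U ×ˢ I) p).comp (ContinuousLinearMap.inl ℝ E ℝ))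
      =O[𝓝 u₀ ×ˢ 𝓝[I] 0] (fun p => p.2 ^ k) := by
  have huI : UniqueDiffOn ℝ I := uniqueDiffOn_convex hI (hI.nontrivial_iff_nonempty_interior.1 hI')
  have hs : UniqueDiffOn ℝ (U ×ˢ I) := hU.uniqueDiffOn.prod huI
  have hfilter : 𝓝 u₀ ×ˢ 𝓝[I] (0 : ℝ) = 𝓝[U ×ˢ I] (u₀, 0) := by
    rw [nhdsWithin_prod_eq, hU.nhdsWithin_eq hu₀]
  have hclosure : ∀ p ∈ U ×ˢ I, p ∈ closure (interior (U ×ˢ I)) := by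
    rintro p ⟨hp1, hp2⟩
    rw [interior_prod_eq, closure_prod_eq, hU.interior_eq]
    refine ⟨subset_closure hp1, ?_⟩
    rw [hI.closure_interior_eq_closure_of_nonempty_interior
      (hI.nontrivial_iff_nonempty_interior.1 hI')]
    exact subset_closure hp2
  -- The family `∂_ε r` is again smooth and pointwise of one order less, so the induction hypothesis
  -- bounds both it and its space derivative. Integrating from `ε = 0`, where `r` and its space
  -- derivative vanish, recovers the lost power. For `k = 0` continuity suffices.
  induction k generalizing r with
  | zero =>
    simp only [pow_zero]
    rw [hfilter]
    refine ⟨Tendsto.isBigO_one ℝ (hr.continuousOn (u₀, 0) ⟨hu₀, h0⟩), ?_⟩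
    have hc := hr.continuousOn_fderivWithin hs (by simp) (u₀, 0) ⟨hu₀, h0⟩
    exact Tendsto.isBigO_one ℝ (ContinuousWithinAt.clm_comp hc continuousWithinAt_const)
  | succ k ih =>
    have hr1 : ContDiffOn ℝ ∞ (fderivWithin ℝ r (U ×ˢ I)) (U ×ˢ I) :=
      hr.fderivWithin hs (by simp)
    have hdr : ContDiffOn ℝ ∞ (fun p => fderivWithin ℝ r (U ×ˢ I) p (0, 1)) (U ×ˢ I) :=
      hr1.clm_apply contDiffOn_const
    have hvan : ∀ u ∈ U, r (u, 0) = 0 := by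
      intro u hu
      have := (hO u hu).eq_zero_imp
      have h3 := mem_of_mem_nhdsWithin h0 (show {x | x ^ (k + 1) = 0 → r (u, x) = 0} ∈ _ from this)
      exact h3 (by simp)
    obtain ⟨hA, hB⟩ := ih hdr (fun u hu => by
      have hd := derivWithin_isBigO_of_isBigO hI hI' h0
        (hr.comp (contDiff_prodMk_right u).contDiffOn fun t ht => ⟨hu, ht⟩) (hO u hu)
      refine hd.congr' ?_ EventuallyEq.rfl
      filter_upwards [self_mem_nhdsWithin] with ε hε
      exact (hasDerivWithinAt_slice hr hu hε).derivWithin (huI ε hε))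
    refine ⟨isBigO_pow_succ_of_hasDerivWithinAt hI h0 hU (fun u hu ε hε => hasDerivWithinAt_slice hr hu hε) hvan hu₀ hA, ?_⟩
    refine isBigO_pow_succ_of_hasDerivWithinAt hI h0 hU
      (r' := fun p => (fderivWithin ℝ (fun p => fderivWithin ℝ r (U ×ˢ I) p (0, 1)) (U ×ˢ I) p).comp
        (ContinuousLinearMap.inl ℝ E ℝ)) (fun u hu ε hε => ?_) (fun u hu => ?_) hu₀ hB
    · have h4 := (hasDerivWithinAt_slice hr1 hu hε)
      have h5 := ((ContinuousLinearMap.compL ℝ E (E × ℝ) G).flip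
        (ContinuousLinearMap.inl ℝ E ℝ)).hasFDerivAt.comp_hasDerivWithinAt ε h4
      refine h5.congr_deriv ?_
      ext v
      -- Exchanging `∂_ε` with the space derivative is legitimate also at an endpoint of `I`, since
      -- every point of `U ×ˢ I` is a limit of interior points.
      have hsymm := (hr (u, ε) ⟨hu, hε⟩).isSymmSndFDerivWithinAt
        (by rw [minSmoothness_of_isRCLikeNormedField]; exact WithTop.coe_le_coe.2 le_top) hs
        (hclosure _ ⟨hu, hε⟩) ⟨hu, hε⟩
      have h6 : fderivWithin ℝ (fun p => fderivWithin ℝ r (U ×ˢ I) p (0, 1)) (U ×ˢ I) (u, ε)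
          = (fderivWithin ℝ (fderivWithin ℝ r (U ×ˢ I)) (U ×ˢ I) (u, ε)).flip (0, 1) := by
        rw [fderivWithin_clm_apply (hs _ ⟨hu, hε⟩)
          (hr1.differentiableOn (by simp) _ ⟨hu, hε⟩) (differentiableWithinAt_const _)]
        simp
      simp only [h6]
      simpa using hsymm (0, 1) (v, 0)
    · have h7 := (hr.differentiableOn (by simp) (u, 0) ⟨hu, h0⟩).hasFDerivWithinAt
      have h8 : HasFDerivAt (fun v => r (v, 0))
          ((fderivWithin ℝ r (U ×ˢ I) (u, 0)).comp (ContinuousLinearMap.inl ℝ E ℝ)) u := by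
        have h9 := h7.comp (s := U) u (f := fun v : E => (v, (0 : ℝ)))
          ((hasFDerivAt_prodMk_left u (0 : ℝ)).hasFDerivWithinAt) fun v hv => ⟨hv, h0⟩
        exact h9.hasFDerivAt (hU.mem_nhds hu)
      have h10 : (fun v => r (v, 0)) =ᶠ[𝓝 u] fun _ => 0 := by
        filter_upwards [hU.mem_nhds hu] with v hv using hvan v hv
      exact h8.unique ((hasFDerivAt_const 0 u).congr_of_eventuallyEq h10)

theorem hasFDerivAt_slice (hU : IsOpen U) {r : E × ℝ → G} (hr : ContDiffOn ℝ ∞ r (U ×ˢ I))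
    {u : E} (hu : u ∈ U) {ε : ℝ} (hε : ε ∈ I) :
    HasFDerivAt (fun v => r (v, ε))
      ((fderivWithin ℝ r (U ×ˢ I) (u, ε)).comp (ContinuousLinearMap.inl ℝ E ℝ)) u := by
  have h7 := (hr.differentiableOn (by simp) (u, ε) ⟨hu, hε⟩).hasFDerivWithinAt
  have h9 := h7.comp (s := U) u (f := fun v : E => (v, ε))
    ((hasFDerivAt_prodMk_left u ε).hasFDerivWithinAt) fun v hv => ⟨hv, hε⟩
  exact h9.hasFDerivAt (hU.mem_nhds hu)

theorem fderiv_slice_isBigO (hI : Convex ℝ I) (hI' : I.Nontrivial) (h0 : (0 : ℝ) ∈ I)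
    (hU : IsOpen U) (k : ℕ) {r : E × ℝ → G} (hr : ContDiffOn ℝ ∞ r (U ×ˢ I))
    (hO : ∀ u ∈ U, (fun ε => r (u, ε)) =O[𝓝[I] 0] fun ε : ℝ => ε ^ k) {u₀ : E} (hu₀ : u₀ ∈ U) :
    (fun p : E × ℝ => fderiv ℝ (fun v => r (v, p.2)) p.1) =O[𝓝 u₀ ×ˢ 𝓝[I] 0] (fun p => p.2 ^ k) := by
  refine (isBigO_and_fderivWithin_isBigO hI hI' h0 hU k hr hO hu₀).2.congr' ?_ EventuallyEq.rfl
  filter_upwards [prod_mem_prod (hU.mem_nhds hu₀) self_mem_nhdsWithin] with p hp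
  exact (hasFDerivAt_slice hU hr hp.1 hp.2).fderiv.symm

theorem continuousOn_fderiv_slice (hI : UniqueDiffOn ℝ I)
    (hU : IsOpen U) {r : E × ℝ → G} (hr : ContDiffOn ℝ ∞ r (U ×ˢ I)) :
    ContinuousOn (fun p : E × ℝ => fderiv ℝ (fun v => r (v, p.2)) p.1) (U ×ˢ I) := by
  have hc := hr.continuousOn_fderivWithin (hU.uniqueDiffOn.prod hI) (by simp)
  refine (ContinuousOn.clm_comp hc (continuousOn_const (c := ContinuousLinearMap.inl ℝ E ℝ))).congr ?_
  intro p hp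
  exact (hasFDerivAt_slice hU hr hp.1 hp.2).fderiv

end ParametricTaylor

/-! ### Trivializations of pullback bundles -/

section PullbackTrivialization

variable {B B' F : Type*} {V : B → Type*} [TopologicalSpace B] [TopologicalSpace B']
  [NormedAddCommGroup F] [NormedSpace ℝ F] [TopologicalSpace (TotalSpace F V)]
  [∀ b, AddCommMonoid (V b)] [∀ b, Module ℝ (V b)] [∀ b, TopologicalSpace (V b)]
  [FiberBundle F V] [VectorBundle ℝ F V]
  (f : C(B', B)) (b₀ : B')

theorem continuousLinearMapAt_trivializationAt_pullback {b : B'}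
    (hb : f b ∈ (trivializationAt F V (f b₀)).baseSet) (w : V (f b)) :
    (trivializationAt F (f *ᵖ V) b₀).continuousLinearMapAt ℝ b w =
      (trivializationAt F V (f b₀)).continuousLinearMapAt ℝ (f b) w := by
  have h1 := congrFun ((trivializationAt F (f *ᵖ V) b₀).coe_linearMapAt_of_mem (R := ℝ)
    (b := b) hb) w
  have h2 := congrFun ((trivializationAt F V (f b₀)).coe_linearMapAt_of_mem (R := ℝ) hb) w
  exact h1.trans h2.symm

theorem symmL_trivializationAt_pullback {b : B'}
    (hb : f b ∈ (trivializationAt F V (f b₀)).baseSet) (v : F) :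
    (trivializationAt F (f *ᵖ V) b₀).symmL ℝ b v =
      (trivializationAt F V (f b₀)).symmL ℝ (f b) v := by
  have h1 := (trivializationAt F V (f b₀)).symmL_continuousLinearMapAt (R := ℝ) hb
    ((trivializationAt F (f *ᵖ V) b₀).symmL ℝ b v)
  have h2 := (trivializationAt F (f *ᵖ V) b₀).continuousLinearMapAt_symmL (R := ℝ) (b := b) hb v
  have h3 := continuousLinearMapAt_trivializationAt_pullback f b₀ hb
    ((trivializationAt F (f *ᵖ V) b₀).symmL ℝ b v)
  exact h1.symm.trans (congrArg _ (h3.symm.trans h2))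

end PullbackTrivialization

/-! ### The topology of the 1-jet bundle in coordinates -/

section JetsAndCharts

variable {E : Type*} [NormedAddCommGroup E] [NormedSpace ℝ E]
  {M : Type*} [TopologicalSpace M] [ChartedSpace E M] [IsManifold 𝓘(ℝ, E) ∞ M]
  {F : Type*} [NormedAddCommGroup F] [NormedSpace ℝ F]
  {S : Type*} [TopologicalSpace S] [ChartedSpace F S] [IsManifold 𝓘(ℝ, F) ∞ S]

/-- The linear map of a 1-jet. -/
def jetMap (j : OneJets E M F S) : E →L[ℝ] F := j.snd

/-- The trivialization of `TM` near `x₀`, on the tangent space at `x`. -/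
noncomputable def tangentCoord (x₀ x : M) : E →L[ℝ] E :=
  (trivializationAt E (TangentSpace 𝓘(ℝ, E)) x₀).continuousLinearMapAt ℝ x

/-- The inverse of `tangentCoord`. -/
noncomputable def tangentCoordSymm (x₀ x : M) : E →L[ℝ] E :=
  (trivializationAt E (TangentSpace 𝓘(ℝ, E)) x₀).symmL ℝ x

theorem tangentCoord_tangentCoordSymm {x₀ x : M} (hx : x ∈ (chartAt E x₀).source) (v : E) :
    tangentCoord (E := E) x₀ x (tangentCoordSymm x₀ x v) = v :=
  (trivializationAt E (TangentSpace 𝓘(ℝ, E)) x₀).continuousLinearMapAt_symmL (R := ℝ) (b := x) hx v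

theorem tangentCoordSymm_tangentCoord {x₀ x : M} (hx : x ∈ (chartAt E x₀).source) (v : E) :
    tangentCoordSymm (E := E) x₀ x (tangentCoord x₀ x v) = v :=
  (trivializationAt E (TangentSpace 𝓘(ℝ, E)) x₀).symmL_continuousLinearMapAt (R := ℝ) (b := x) hx v

theorem continuous_proj_oneJets : Continuous (fun j : OneJets E M F S => j.proj) :=
  FiberBundle.continuous_proj _ _

/-- This is continuity of the identity of the jet space, read in the trivialization of the Hom
bundle at `j₀`. It is the route by which the bundle topology yields convergence of the linear parts
of jets. -/
theorem continuousAt_jetMap_inCoordinates (j₀ : OneJets E M F S) :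
    ContinuousAt (fun j : OneJets E M F S =>
      (tangentCoord j₀.proj.2 j.proj.2).comp
        ((jetMap j).comp (tangentCoordSymm j₀.proj.1 j.proj.1))) j₀ := by
  have h := (continuousAt_hom_bundle (σ := RingHom.id ℝ) (F₁ := E) (F₂ := F)
    (E₁ := (ContinuousMap.fst : C(M × S, M)) *ᵖ (TangentSpace 𝓘(ℝ, E) : M → Type _))
    (E₂ := (ContinuousMap.snd : C(M × S, S)) *ᵖ (TangentSpace 𝓘(ℝ, F) : S → Type _))
    (f := id) (x₀ := j₀)).1 continuousAt_id
  refine h.2.congr ?_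
  have h1 := (continuous_proj_oneJets (E := E) (M := M) (F := F) (S := S)).tendsto j₀
  filter_upwards [h1.fst_nhds.eventually
      ((trivializationAt E (TangentSpace 𝓘(ℝ, E)) j₀.proj.1).open_baseSet.mem_nhds
        (mem_baseSet_trivializationAt _ _ _)),
    h1.snd_nhds.eventually
      ((trivializationAt F (TangentSpace 𝓘(ℝ, F)) j₀.proj.2).open_baseSet.mem_nhds
        (mem_baseSet_trivializationAt _ _ _))] with j hj1 hj2
  ext v
  exact (continuousLinearMapAt_trivializationAt_pullback ContinuousMap.snd j₀.proj hj2 _).trans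
    (congrArg _ (congrArg _ (symmL_trivializationAt_pullback ContinuousMap.fst j₀.proj hj1 v)))

/-! ### Differentials of families and their dependence on jet and parameter -/

section FamiliesInCharts

open Filter

variable {G : Type*} [NormedAddCommGroup G] [NormedSpace ℝ G]

/-- The derivative of a map from a manifold to a vector space. -/
noncomputable def vectorDifferential (h : S → G) (z : S) : F →L[ℝ] G := mfderiv 𝓘(ℝ, F) 𝓘(ℝ, G) h z

theorem vectorDifferential_congr {h h' : S → G} {z : S} (hh : h =ᶠ[𝓝 z] h') :
    vectorDifferential (F := F) h z = vectorDifferential (F := F) h' z := by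
  have := hh.mfderiv_eq (I := 𝓘(ℝ, F)) (I' := 𝓘(ℝ, G))
  exact this

theorem contDiffOn_family_inChart {X : Type*} [TopologicalSpace X] [ChartedSpace G X]
    {D : Set (X × ℝ)} {K : Type*} [NormedAddCommGroup K] [NormedSpace ℝ K]
    [IsManifold 𝓘(ℝ, G) ∞ X] {h : ℝ → X → K}
    (hh : ContMDiffOn (𝓘(ℝ, G).prod 𝓘(ℝ, ℝ)) 𝓘(ℝ, K) ∞ (fun p : X × ℝ => h p.2 p.1) D)
    (x₀ : X) {I : Set ℝ} (hD : univ ×ˢ I ⊆ D) :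
    ContDiffOn ℝ ∞ (fun p : G × ℝ => h p.2 ((extChartAt 𝓘(ℝ, G) x₀).symm p.1))
      ((extChartAt 𝓘(ℝ, G) x₀).target ×ˢ I) := by
  rw [← contMDiffOn_iff_contDiffOn, modelWithCornersSelf_prod, ← chartedSpaceSelf_prod]
  have h1 : ContMDiffOn (𝓘(ℝ, G).prod 𝓘(ℝ, ℝ)) (𝓘(ℝ, G).prod 𝓘(ℝ, ℝ)) ∞
      (fun p : G × ℝ => ((extChartAt 𝓘(ℝ, G) x₀).symm p.1, p.2))
      ((extChartAt 𝓘(ℝ, G) x₀).target ×ˢ I) :=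
    ((contMDiffOn_extChartAt_symm x₀).comp contMDiffOn_fst fun p hp => hp.1).prodMk contMDiffOn_snd
  exact hh.comp h1 fun p hp => hD ⟨mem_univ _, hp.2⟩

theorem tangentCoord_eq_vectorDifferential {z z₀ : S} (hz : z ∈ (chartAt F z₀).source) :
    tangentCoord z₀ z = vectorDifferential (F := F) (extChartAt 𝓘(ℝ, F) z₀) z :=
  TangentBundle.continuousLinearMapAt_trivializationAt (I := 𝓘(ℝ, F)) hz

theorem vectorDifferential_eq_fderiv_comp {h : S → G} {z z₀ : S}
    (hh : MDifferentiableAt 𝓘(ℝ, F) 𝓘(ℝ, G) h z) (hz : z ∈ (chartAt F z₀).source) :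
    vectorDifferential (F := F) h z =
      (fderiv ℝ (h ∘ (extChartAt 𝓘(ℝ, F) z₀).symm) (extChartAt 𝓘(ℝ, F) z₀ z)).comp
        (tangentCoord z₀ z) := by
  rw [tangentCoord_eq_vectorDifferential hz]
  set θ := extChartAt 𝓘(ℝ, F) z₀
  have hzs : z ∈ θ.source := by rwa [extChartAt_source]
  have hθ : MDifferentiableAt 𝓘(ℝ, F) 𝓘(ℝ, F) θ z := mdifferentiableAt_extChartAt hz
  have h1 : h =ᶠ[𝓝 z] (h ∘ θ.symm) ∘ θ := by
    filter_upwards [extChartAt_source_mem_nhds' hzs] with y hy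
    simp only [Function.comp_apply]
    rw [θ.left_inv hy]
  have hsymm : MDifferentiableAt 𝓘(ℝ, F) 𝓘(ℝ, F) θ.symm (θ z) := by
    have := (contMDiffOn_extChartAt_symm (n := ∞) (I := 𝓘(ℝ, F)) z₀).contMDiffAt
      ((isOpen_extChartAt_target z₀).mem_nhds (θ.map_source hzs))
    exact this.mdifferentiableAt (by simp)
  have hhs : MDifferentiableAt 𝓘(ℝ, F) 𝓘(ℝ, G) (h ∘ θ.symm) (θ z) := by
    refine MDifferentiableAt.comp (I' := 𝓘(ℝ, F)) _ ?_ hsymm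
    rwa [θ.left_inv hzs]
  rw [vectorDifferential_congr h1]
  unfold vectorDifferential
  rw [mfderiv_comp z hhs hθ, mfderiv_eq_fderiv]
  rfl

theorem tendsto_jet_fst (j₀ : OneJets E M F S) (ε₀ : ℝ) :
    Tendsto (fun q : OneJets E M F S × ℝ => q.1.proj.1) (𝓝 (j₀, ε₀)) (𝓝 j₀.proj.1) :=
  ((continuous_proj_oneJets.comp continuous_fst).tendsto (j₀, ε₀)).fst_nhds

theorem tendsto_jet_snd (j₀ : OneJets E M F S) (ε₀ : ℝ) :
    Tendsto (fun q : OneJets E M F S × ℝ => q.1.proj.2) (𝓝 (j₀, ε₀)) (𝓝 j₀.proj.2) :=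
  ((continuous_proj_oneJets.comp continuous_fst).tendsto (j₀, ε₀)).snd_nhds

theorem tendsto_family {X : Type*} [TopologicalSpace X] {γ : ℝ → S → X} {I : Set ℝ}
    (hγ : ContinuousOn (fun p : S × ℝ => γ p.2 p.1) (univ ×ˢ I)) {ε₀ : ℝ} (hε₀ : ε₀ ∈ I)
    (j₀ : OneJets E M F S) :
    Tendsto (fun q : OneJets E M F S × ℝ => γ q.2 q.1.proj.2) (𝓝 (j₀, ε₀) ⊓ 𝓟 (univ ×ˢ I))
      (𝓝 (γ ε₀ j₀.proj.2)) := by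
  have h1 : Tendsto (fun q : OneJets E M F S × ℝ => (q.1.proj.2, q.2))
      (𝓝 (j₀, ε₀) ⊓ 𝓟 (univ ×ˢ I)) (𝓝[univ ×ˢ I] (j₀.proj.2, ε₀)) := by
    refine tendsto_nhdsWithin_iff.2 ⟨?_, ?_⟩
    · exact ((tendsto_jet_snd j₀ ε₀).prodMk_nhds continuous_snd.continuousAt).mono_left inf_le_left
    · exact eventually_inf_principal.2 (Eventually.of_forall fun q hq => ⟨mem_univ _, hq.2⟩)
  exact (hγ (j₀.proj.2, ε₀) ⟨mem_univ _, hε₀⟩).tendsto.comp h1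

/-- Approximation, Poisson maps and smoothness of brackets are all tested on globally defined
functions. Cutting off a chart by a bump function supplies local coordinates that are global
functions. -/
theorem exists_smooth_eventuallyEq_extChartAt [FiniteDimensional ℝ E] [T2Space M] {c x₀ : M}
    (hx₀ : x₀ ∈ (chartAt E c).source) :
    ∃ Φ : M → E, ContMDiff 𝓘(ℝ, E) 𝓘(ℝ, E) ∞ Φ ∧ Φ =ᶠ[𝓝 x₀] extChartAt 𝓘(ℝ, E) c := by
  obtain ⟨f, -, hf⟩ := (SmoothBumpFunction.nhds_basis_tsupport (I := 𝓘(ℝ, E)) x₀).mem_iff.1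
    ((chartAt E c).open_source.mem_nhds hx₀)
  refine ⟨fun x => f x • extChartAt 𝓘(ℝ, E) c x, ?_, ?_⟩
  · refine contMDiff_of_tsupport fun x hx => ?_
    have hx' : x ∈ (chartAt E c).source := hf (closure_mono (Function.support_smul_subset_left _ _) hx)
    exact f.contMDiffAt.smul (contMDiffAt_extChartAt' hx')
  · filter_upwards [f.eventuallyEq_one] with x hx
    simp [hx]

theorem ContMDiff.comp_smoothFamily {γ : ℝ → S → M} {I : Set ℝ}
    (hγ : IsSmoothFamily F E I γ) {Φ : M → G} (hΦ : ContMDiff 𝓘(ℝ, E) 𝓘(ℝ, G) ∞ Φ) :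
    ContMDiffOn (𝓘(ℝ, F).prod 𝓘(ℝ, ℝ)) 𝓘(ℝ, G) ∞ (fun p : S × ℝ => Φ (γ p.2 p.1))
      (univ ×ˢ I) :=
  hΦ.comp_contMDiffOn hγ

theorem PoissonRealization.IsSmoothFamily.contMDiff {γ : ℝ → S → M} {I : Set ℝ}
    (hγ : IsSmoothFamily F E I γ) {ε : ℝ} (hε : ε ∈ I) : ContMDiff 𝓘(ℝ, F) 𝓘(ℝ, E) ∞ (γ ε) := by
  rw [← contMDiffOn_univ]
  have h1 : ContMDiffOn 𝓘(ℝ, F) (𝓘(ℝ, F).prod 𝓘(ℝ, ℝ)) ∞ (fun z : S => (z, ε)) univ :=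
    contMDiffOn_id.prodMk contMDiffOn_const
  exact ContMDiffOn.comp (g := fun p : S × ℝ => γ p.2 p.1) hγ h1 fun z _ => ⟨mem_univ _, hε⟩

/-- In a chart of `S` the expression factors as the space derivative of a jointly smooth family,
continuous in (point, `ε`), composed with the jet in coordinates. The source vector is read in the
trivialization of `TM` at the base point so that operators at different points can be compared. -/
theorem tendsto_vectorDifferential_comp_jetMap {γ : ℝ → S → M} {I : Set ℝ}
    (hI : UniqueDiffOn ℝ I) (hγ : IsSmoothFamily F E I γ) {Φ : M → G}
    (hΦ : ContMDiff 𝓘(ℝ, E) 𝓘(ℝ, G) ∞ Φ) (j₀ : OneJets E M F S) {ε₀ : ℝ} (hε₀ : ε₀ ∈ I) :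
    Tendsto (fun q : OneJets E M F S × ℝ =>
        (vectorDifferential (F := F) (Φ ∘ γ q.2) q.1.proj.2).comp
          ((jetMap q.1).comp (tangentCoordSymm j₀.proj.1 q.1.proj.1)))
      (𝓝 (j₀, ε₀) ⊓ 𝓟 (univ ×ˢ I))
      (𝓝 ((vectorDifferential (F := F) (Φ ∘ γ ε₀) j₀.proj.2).comp
        ((jetMap j₀).comp (tangentCoordSymm j₀.proj.1 j₀.proj.1)))) := by
  set θ := extChartAt 𝓘(ℝ, F) j₀.proj.2
  set H : F × ℝ → G := fun p => Φ (γ p.2 (θ.symm p.1))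
  set A : OneJets E M F S → E →L[ℝ] F := fun j =>
    (tangentCoord j₀.proj.2 j.proj.2).comp
        ((jetMap j).comp (tangentCoordSymm j₀.proj.1 j.proj.1))
  have hA : ContinuousAt A j₀ := continuousAt_jetMap_inCoordinates j₀
  have hH : ContDiffOn ℝ ∞ H (θ.target ×ˢ I) :=
    contDiffOn_family_inChart (h := fun ε z => Φ (γ ε z))
      (ContMDiff.comp_smoothFamily hγ hΦ) j₀.proj.2 Subset.rfl
  have key : ∀ q : OneJets E M F S × ℝ, q.1.proj.2 ∈ (chartAt F j₀.proj.2).source → q.2 ∈ I →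
      (fderiv ℝ (fun w => H (w, q.2)) (θ q.1.proj.2)).comp (A q.1) =
      (vectorDifferential (F := F) (Φ ∘ γ q.2) q.1.proj.2).comp
        ((jetMap q.1).comp (tangentCoordSymm j₀.proj.1 q.1.proj.1)) := by
    intro q hq hqI
    have hd : MDifferentiableAt 𝓘(ℝ, F) 𝓘(ℝ, G) (Φ ∘ γ q.2) q.1.proj.2 :=
      ((hΦ.comp (hγ.contMDiff hqI)).mdifferentiable (by simp)) _
    rw [vectorDifferential_eq_fderiv_comp hd hq]
    rfl
  have hsrc : j₀.proj.2 ∈ (chartAt F j₀.proj.2).source := mem_chart_source _ _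
  rw [← key (j₀, ε₀) hsrc hε₀]
  have hev : ∀ᶠ q in 𝓝 (j₀, ε₀) ⊓ 𝓟 (univ ×ˢ I), q.1.proj.2 ∈ (chartAt F j₀.proj.2).source ∧
      q.2 ∈ I := by
    refine eventually_inf_principal.2 ?_
    filter_upwards [(tendsto_jet_snd j₀ ε₀).eventually
      ((chartAt F j₀.proj.2).open_source.mem_nhds hsrc)] with q hq hqI using ⟨hq, hqI.2⟩
  refine Tendsto.congr' (hev.mono fun q hq => key q hq.1 hq.2) ?_
  have hT1 : Tendsto (fun q : OneJets E M F S × ℝ => (θ q.1.proj.2, q.2))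
      (𝓝 (j₀, ε₀) ⊓ 𝓟 (univ ×ˢ I)) (𝓝[θ.target ×ˢ I] (θ j₀.proj.2, ε₀)) := by
    refine tendsto_nhdsWithin_iff.2 ⟨?_, ?_⟩
    · refine Tendsto.mono_left ?_ inf_le_left
      refine Tendsto.prodMk_nhds ?_ continuous_snd.continuousAt
      exact (continuousAt_extChartAt (I := 𝓘(ℝ, F)) j₀.proj.2).tendsto.comp (tendsto_jet_snd j₀ ε₀)
    · refine hev.mono fun q hq => ⟨θ.map_source ?_, hq.2⟩
      rw [extChartAt_source]; exact hq.1
  have hT2 : Tendsto (fun q : OneJets E M F S × ℝ => A q.1)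
      (𝓝 (j₀, ε₀) ⊓ 𝓟 (univ ×ˢ I)) (𝓝 (A j₀)) :=
    (hA.tendsto.comp (continuous_fst.tendsto (j₀, ε₀))).mono_left inf_le_left
  have hc := continuousOn_fderiv_slice hI (isOpen_extChartAt_target (I := 𝓘(ℝ, F)) j₀.proj.2) hH
    (θ j₀.proj.2, ε₀) ⟨mem_extChartAt_target _, hε₀⟩
  have h3 := hc.tendsto.comp hT1
  exact ((isBoundedBilinearMap_comp (𝕜 := ℝ) (E := E) (F := F) (G := G)).continuous.tendsto _).comp
    (h3.prodMk_nhds hT2)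

end FamiliesInCharts

end JetsAndCharts

/-! ### The inverse function theorem for self-maps of a manifold -/

section InverseFunction

open Filter

variable {E : Type*} [NormedAddCommGroup E] [NormedSpace ℝ E] [FiniteDimensional ℝ E]
  {M : Type*} [TopologicalSpace M] [ChartedSpace E M] [IsManifold 𝓘(ℝ, E) ∞ M]

theorem exists_hasStrictFDerivAt_inCharts {b : M → M} {x : M}
    (hb : ContMDiffAt 𝓘(ℝ, E) 𝓘(ℝ, E) ∞ b x)
    (hinj : Function.Injective (mfderiv 𝓘(ℝ, E) 𝓘(ℝ, E) b x)) :
    ContDiffAt ℝ ∞ (extChartAt 𝓘(ℝ, E) (b x) ∘ b ∘ (extChartAt 𝓘(ℝ, E) x).symm)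
      (extChartAt 𝓘(ℝ, E) x x) ∧ ∃ L : E ≃L[ℝ] E,
      HasStrictFDerivAt (extChartAt 𝓘(ℝ, E) (b x) ∘ b ∘ (extChartAt 𝓘(ℝ, E) x).symm)
        (L : E →L[ℝ] E) (extChartAt 𝓘(ℝ, E) x x) := by
  have h1 := (contMDiffAt_iff.1 hb).2
  rw [modelWithCornersSelf_coe, range_id, contDiffWithinAt_univ] at h1
  refine ⟨h1, ?_⟩
  have hs := h1.hasStrictFDerivAt (by simp)
  have hd : mfderiv 𝓘(ℝ, E) 𝓘(ℝ, E) b x = fderiv ℝ (extChartAt 𝓘(ℝ, E) (b x) ∘ b ∘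
      (extChartAt 𝓘(ℝ, E) x).symm) (extChartAt 𝓘(ℝ, E) x x) := by
    refine (hb.mdifferentiableAt (by simp)).mfderiv.trans ?_
    simp only [modelWithCornersSelf_coe, range_id, fderivWithin_univ]
    rfl
  have hinj' : Function.Injective (fderiv ℝ (extChartAt 𝓘(ℝ, E) (b x) ∘ b ∘
      (extChartAt 𝓘(ℝ, E) x).symm) (extChartAt 𝓘(ℝ, E) x x)) := by
    rw [← hd]; exact hinj
  refine ⟨(LinearEquiv.ofInjectiveEndo _ hinj').toContinuousLinearEquiv, ?_⟩
  convert hs using 1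
  ext v
  rfl

theorem map_nhds_eq_of_injective_mfderiv {b : M → M} {x : M}
    (hb : ContMDiffAt 𝓘(ℝ, E) 𝓘(ℝ, E) ∞ b x)
    (hinj : Function.Injective (mfderiv 𝓘(ℝ, E) 𝓘(ℝ, E) b x)) : map b (𝓝 x) = 𝓝 (b x) := by
  obtain ⟨-, L, hL⟩ := exists_hasStrictFDerivAt_inCharts hb hinj
  set φ := extChartAt 𝓘(ℝ, E) x
  set φ' := extChartAt 𝓘(ℝ, E) (b x)
  have h1 := hL.map_nhds_eq_of_equiv
  have hb' : b =ᶠ[𝓝 x] φ'.symm ∘ (φ' ∘ b ∘ φ.symm) ∘ φ := by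
    filter_upwards [extChartAt_source_mem_nhds (I := 𝓘(ℝ, E)) x,
      hb.continuousAt.eventually (extChartAt_source_mem_nhds (I := 𝓘(ℝ, E)) (b x))] with y hy hy'
    simp only [Function.comp_apply]
    rw [φ.left_inv hy, φ'.left_inv hy']
  rw [map_congr hb', ← map_map, ← map_map, map_extChartAt_nhds_of_boundaryless, h1]
  simp only [Function.comp_apply]
  rw [extChartAt_to_inv]
  have h2 := map_extChartAt_symm_nhdsWithin_range (I := 𝓘(ℝ, E)) (b x)
  rwa [modelWithCornersSelf_coe, range_id, nhdsWithin_univ] at h2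

/-- Near `b x` every point is `b` of a point given by the local inverse in charts, so a left inverse
of `b` must agree there with that local inverse, which is smooth. -/
theorem contMDiffAt_leftInverse {b c : M → M} (hc : Function.LeftInverse c b) {x : M}
    (hb : ContMDiffAt 𝓘(ℝ, E) 𝓘(ℝ, E) ∞ b x)
    (hinj : Function.Injective (mfderiv 𝓘(ℝ, E) 𝓘(ℝ, E) b x)) :
    ContMDiffAt 𝓘(ℝ, E) 𝓘(ℝ, E) ∞ c (b x) := by
  obtain ⟨hg, L, hL⟩ := exists_hasStrictFDerivAt_inCharts hb hinj
  have hcont : ContinuousAt c (b x) := by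
    rw [ContinuousAt, ← map_nhds_eq_of_injective_mfderiv hb hinj, tendsto_map'_iff, hc x]
    refine tendsto_id.congr fun y => (hc y).symm
  set φ := extChartAt 𝓘(ℝ, E) x
  set φ' := extChartAt 𝓘(ℝ, E) (b x)
  rw [contMDiffAt_iff]
  refine ⟨hcont, ?_⟩
  rw [modelWithCornersSelf_coe, range_id, contDiffWithinAt_univ, hc x]
  have hga : (φ' ∘ b ∘ φ.symm) (φ x) = φ' (b x) := by
    simp only [Function.comp_apply, φ]
    rw [extChartAt_to_inv]
  have hinv := hg.to_localInverse hL.hasFDerivAt (by simp)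
  rw [hga] at hinv
  refine hinv.congr_of_eventuallyEq ?_
  have hri := hL.eventually_right_inverse
  have htend := hL.localInverse_tendsto
  have hli := hL.localInverse_continuousAt
  rw [hga] at hri htend
  have h2 : ContinuousAt (b ∘ φ.symm) (φ x) := by
    refine ContinuousAt.comp ?_ (continuousAt_extChartAt_symm x)
    rw [extChartAt_to_inv]
    exact hb.continuousAt
  have h3 : ∀ᶠ w in 𝓝 (φ' (b x)), (b ∘ φ.symm) (hL.localInverse _ _ _ w) ∈ φ'.source := by
    refine (h2.tendsto.comp htend).eventually ?_
    simp only [Function.comp_apply, φ]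
    rw [extChartAt_to_inv]
    exact extChartAt_source_mem_nhds (b x)
  have h4 : ∀ᶠ w in 𝓝 (φ' (b x)), hL.localInverse _ _ _ w ∈ φ.target :=
    htend.eventually (extChartAt_target_mem_nhds x)
  filter_upwards [hri, h3, h4] with w hw hw3 hw4
  have h5 : φ'.symm w = b (φ.symm (hL.localInverse _ _ _ w)) := by
    conv_lhs => rw [← hw]
    exact φ'.left_inv hw3
  simp only [Function.comp_apply]
  rw [h5, hc, φ.right_inv hw4]
  rfl

end InverseFunction

/-! ### A proper exhaustion function -/

section ProperFunction

/-- Gluing local constants by a partition of unity gives a continuous function above the index of a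
compact exhaustion. It measures escape to infinity: a map moving `ρ` by less than `1` is proper. -/
theorem exists_continuous_isCompact_le (M : Type*) [TopologicalSpace M] [T2Space M]
    [LocallyCompactSpace M] [SigmaCompactSpace M] :
    ∃ ρ : C(M, ℝ), ∀ r : ℝ, IsCompact {x | ρ x ≤ r} := by
  obtain ⟨K⟩ : Nonempty (CompactExhaustion M) := inferInstance
  obtain ⟨ρ, hρ⟩ := exists_continuous_forall_mem_convex_of_local_const
    (t := fun x : M => Ici (K.find x : ℝ)) (fun x => convex_Ici _) (fun x => by
      refine ⟨(K.find x + 1 : ℕ), ?_⟩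
      filter_upwards [mem_interior_iff_mem_nhds.1
        (K.subset_interior_succ _ (K.mem_find x))] with y hy
      exact Nat.cast_le (α := ℝ).2 (K.mem_iff_find_le.1 hy))
  refine ⟨ρ, fun r => ?_⟩
  refine (K.isCompact ⌈r⌉₊).of_isClosed_subset (isClosed_le ρ.continuous continuous_const) ?_
  intro x hx
  rw [K.mem_iff_find_le]
  have h1 : (K.find x : ℝ) ≤ ρ x := hρ x
  exact_mod_cast (h1.trans hx).trans (Nat.le_ceil r)

end ProperFunction

/-! ### Maps close to the identity are diffeomorphisms -/

section CloseToIdentity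

open Filter

variable {E : Type*} [NormedAddCommGroup E] [NormedSpace ℝ E] [FiniteDimensional ℝ E]
  {M : Type*} [TopologicalSpace M] [ChartedSpace E M] [IsManifold 𝓘(ℝ, E) ∞ M]
  {F : Type*} [NormedAddCommGroup F] [NormedSpace ℝ F]
  {S : Type*} [TopologicalSpace S] [ChartedSpace F S] [IsManifold 𝓘(ℝ, F) ∞ S]

theorem tendsto_vectorDifferential_comp_tangentCoordSymm {Φ : M → E}
    (hΦ : ContMDiff 𝓘(ℝ, E) 𝓘(ℝ, E) ∞ Φ) (x₀ : M) :
    Tendsto (fun x => (vectorDifferential (F := E) Φ x).comp (tangentCoordSymm x₀ x)) (𝓝 x₀)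
      (𝓝 ((vectorDifferential (F := E) Φ x₀).comp (tangentCoordSymm x₀ x₀))) := by
  have hH : ContDiffOn ℝ ∞ (Φ ∘ (extChartAt 𝓘(ℝ, E) x₀).symm) (extChartAt 𝓘(ℝ, E) x₀).target := by
    rw [← contMDiffOn_iff_contDiffOn]
    exact hΦ.comp_contMDiffOn (contMDiffOn_extChartAt_symm x₀)
  have key : ∀ x ∈ (chartAt E x₀).source,
      fderiv ℝ (Φ ∘ (extChartAt 𝓘(ℝ, E) x₀).symm) (extChartAt 𝓘(ℝ, E) x₀ x) =
        (vectorDifferential (F := E) Φ x).comp (tangentCoordSymm x₀ x) := by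
    intro x hx
    rw [vectorDifferential_eq_fderiv_comp (hΦ.mdifferentiable (by simp) x) hx]
    ext v
    simp only [ContinuousLinearMap.comp_apply]
    rw [tangentCoord_tangentCoordSymm hx]
  have hx₀ : x₀ ∈ (chartAt E x₀).source := mem_chart_source _ _
  rw [← key x₀ hx₀]
  refine Tendsto.congr' (eventually_of_mem ((chartAt E x₀).open_source.mem_nhds hx₀) key) ?_
  have hc := hH.continuousOn_fderiv_of_isOpen (isOpen_extChartAt_target x₀) (by simp)
  exact (hc.continuousAt (extChartAt_target_mem_nhds x₀)).tendsto.comp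
    (continuousAt_extChartAt x₀).tendsto

/-- At the jet of `σ` both operators equal `T₀`, because `γ ε₀ ∘ σ` is the identity. As `T₀` is
bounded below, small absolute errors nearby are small relative errors. -/
theorem eventually_norm_sub_le_half {γ : ℝ → S → M} {I : Set ℝ}
    (hI : UniqueDiffOn ℝ I) (hγ : IsSmoothFamily F E I γ) {σ : M → S}
    (hσ : ContMDiff 𝓘(ℝ, E) 𝓘(ℝ, F) ∞ σ) {ε₀ : ℝ} (hε₀ : ε₀ ∈ I) (hγσ : ∀ x, γ ε₀ (σ x) = x)
    {Φ : M → E} (hΦ : ContMDiff 𝓘(ℝ, E) 𝓘(ℝ, E) ∞ Φ) {x₀ : M}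
    (hinj : Function.Injective (vectorDifferential (F := E) Φ x₀)) :
    ∀ᶠ q : OneJets E M F S × ℝ in 𝓝 (oneJet σ x₀, ε₀) ⊓ 𝓟 (univ ×ˢ I), ∀ v,
      ‖vectorDifferential (F := F) (Φ ∘ γ q.2) q.1.proj.2 (jetMap q.1 v)
        - vectorDifferential (F := E) Φ q.1.proj.1 v‖
        ≤ 1 / 2 * ‖vectorDifferential (F := E) Φ q.1.proj.1 v‖ := by
  set j₀ : OneJets E M F S := oneJet σ x₀
  have hx₀ : x₀ ∈ (chartAt E x₀).source := mem_chart_source _ _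
  set T₀ : E →L[ℝ] E := (vectorDifferential (F := E) Φ x₀).comp (tangentCoordSymm x₀ x₀)
  have hT1 := tendsto_vectorDifferential_comp_jetMap hI hγ hΦ j₀ hε₀
  have hT10 : (vectorDifferential (F := F) (Φ ∘ γ ε₀) j₀.proj.2).comp
        ((jetMap j₀).comp (tangentCoordSymm j₀.proj.1 j₀.proj.1)) = T₀ := by
    have h1 : mfderiv 𝓘(ℝ, E) 𝓘(ℝ, E) ((Φ ∘ γ ε₀) ∘ σ) x₀ =
        (mfderiv 𝓘(ℝ, F) 𝓘(ℝ, E) (Φ ∘ γ ε₀) (σ x₀)).comp (mfderiv 𝓘(ℝ, E) 𝓘(ℝ, F) σ x₀) :=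
      mfderiv_comp x₀ ((hΦ.comp (hγ.contMDiff hε₀)).mdifferentiable (by simp) _)
        (hσ.mdifferentiable (by simp) _)
    have h2 : (Φ ∘ γ ε₀) ∘ σ = Φ := funext fun x => by simp [hγσ]
    rw [h2] at h1
    have h3 : vectorDifferential (F := E) Φ x₀ =
      (vectorDifferential (F := F) (Φ ∘ γ ε₀) j₀.proj.2).comp (jetMap j₀) := h1
    ext v
    simp only [T₀, h3]
    rfl
  rw [hT10] at hT1
  have hT2 := (tendsto_vectorDifferential_comp_tangentCoordSymm hΦ x₀).comp
    (tendsto_jet_fst j₀ ε₀)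
  have hT0inj : LinearMap.ker (T₀ : E →ₗ[ℝ] E) = ⊥ := by
    refine LinearMap.ker_eq_bot.2 fun v w hvw => ?_
    have h4 := congrArg (tangentCoord x₀ x₀) (hinj hvw)
    simpa [tangentCoord_tangentCoordSymm hx₀] using! h4
  obtain ⟨K, hK, hanti⟩ := LinearMap.exists_antilipschitzWith (T₀ : E →ₗ[ℝ] E) hT0inj
  -- An operator error of `(8 * K)⁻¹` is at most `‖T₀ w‖ / 8` on `w`. Two such errors, compared with
  -- `‖T2 w‖ ≥ 7/8 * ‖T₀ w‖`, give the ratio `2/7 ≤ 1/2`.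
  have hK' : (0 : ℝ) < (8 * K)⁻¹ := by positivity
  have hlow : ∀ w, ‖w‖ ≤ K * ‖T₀ w‖ := fun w => by
    simpa using ZeroHomClass.bound_of_antilipschitz T₀ hanti w
  filter_upwards [hT1.eventually (Metric.ball_mem_nhds _ hK'),
    (hT2.mono_left inf_le_left).eventually (Metric.ball_mem_nhds _ hK'),
    ((tendsto_jet_fst j₀ ε₀).mono_left inf_le_left).eventually
      ((chartAt E x₀).open_source.mem_nhds hx₀)] with q hq1 hq2 hq3 v
  set w := tangentCoord x₀ q.1.proj.1 v
  have hv : v = tangentCoordSymm x₀ q.1.proj.1 w := (tangentCoordSymm_tangentCoord hq3 v).symm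
  set T1 : E →L[ℝ] E := (vectorDifferential (F := F) (Φ ∘ γ q.2) q.1.proj.2).comp
          ((jetMap q.1).comp (tangentCoordSymm j₀.proj.1 q.1.proj.1))
  set T2 : E →L[ℝ] E := (vectorDifferential (F := E) Φ q.1.proj.1).comp
    (tangentCoordSymm x₀ q.1.proj.1)
  have e1 : vectorDifferential (F := F) (Φ ∘ γ q.2) q.1.proj.2 (jetMap q.1 v) = T1 w := by
    rw [hv]; rfl
  have e2 : vectorDifferential (F := E) Φ q.1.proj.1 v = T2 w := by
    rw [hv]; rfl
  rw [e1, e2]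
  have hq1' : ‖T1 - T₀‖ < (8 * K)⁻¹ := by simpa [dist_eq_norm] using! hq1
  have hq2' : ‖T2 - T₀‖ < (8 * K)⁻¹ := by simpa [dist_eq_norm] using! hq2
  have b1 : ‖(T1 - T₀) w‖ ≤ (8 * K)⁻¹ * ‖w‖ := (T1 - T₀).le_of_opNorm_le hq1'.le w
  have b2 : ‖(T2 - T₀) w‖ ≤ (8 * K)⁻¹ * ‖w‖ := (T2 - T₀).le_of_opNorm_le hq2'.le w
  have b3 : (8 * K : ℝ)⁻¹ * ‖w‖ ≤ 1 / 8 * ‖T₀ w‖ := by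
    have hK0 : (0 : ℝ) < K := by exact_mod_cast hK
    calc (8 * K : ℝ)⁻¹ * ‖w‖ ≤ (8 * K : ℝ)⁻¹ * (K * ‖T₀ w‖) := by gcongr; exact hlow w
      _ = 1 / 8 * ‖T₀ w‖ := by field_simp
  have b4 : ‖T₀ w‖ ≤ ‖T2 w‖ + ‖(T2 - T₀) w‖ := by
    have : T₀ w = T2 w - (T2 - T₀) w := by simp
    rw [this]; exact norm_sub_le _ _
  have b5 : ‖T1 w - T2 w‖ ≤ ‖(T1 - T₀) w‖ + ‖(T2 - T₀) w‖ := by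
    have : T1 w - T2 w = (T1 - T₀) w - (T2 - T₀) w := by simp
    rw [this]; exact norm_sub_le _ _
  simp only [NNReal.coe_inv, NNReal.coe_mul, NNReal.coe_ofNat] at b1 b2
  linarith [norm_nonneg (T2 w)]

/-- A 1-jet at `x` with target `z` whose composition with `γ` is close to the 1-jet of the identity
at `x`, as measured by the bump functions `fs` and by the function `ρ`. -/
structure IsCloseJet {κ : Type*} (fs : SmoothBumpCovering κ 𝓘(ℝ, E) M univ) (ρ : M → ℝ)
    (γ : S → M) (j : OneJets E M F S) : Prop where
  mem_support : ∀ i, fs i (γ j.proj.2) = 1 → j.proj.1 ∈ Function.support (fs i)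
  mem_source : ∀ i, j.proj.1 ∈ tsupport (fs i) → γ j.proj.2 ∈ (chartAt E (fs.c i)).source
  norm_sub_le : ∀ i, j.proj.1 ∈ tsupport (fs i) → ∀ v,
    ‖vectorDifferential (F := F) (extChartAt 𝓘(ℝ, E) (fs.c i) ∘ γ) j.proj.2 (jetMap j v)
        - vectorDifferential (F := E) (extChartAt 𝓘(ℝ, E) (fs.c i)) j.proj.1 v‖
        ≤ 1 / 2 * ‖vectorDifferential (F := E) (extChartAt 𝓘(ℝ, E) (fs.c i)) j.proj.1 v‖
  abs_sub_lt : |ρ (γ j.proj.2) - ρ j.proj.1| < 1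
  mem_connectedComponent : γ j.proj.2 ∈ connectedComponent j.proj.1

theorem injective_vectorDifferential_extChartAt {c x : M} (hx : x ∈ (chartAt E c).source) :
    Function.Injective (vectorDifferential (F := E) (extChartAt 𝓘(ℝ, E) c) x) := by
  rw [← tangentCoord_eq_vectorDifferential hx]
  intro v w hvw
  rw [← tangentCoordSymm_tangentCoord hx v, hvw, tangentCoordSymm_tangentCoord hx]

/-- At the jet of a section each condition holds with room to spare, and so persists nearby. The
infinitely many indices cause no trouble: in a locally finite family of closed sets, only the
finitely many members containing `x₀` meet a small neighbourhood of `x₀`. -/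
theorem eventually_isCloseJet [T2Space M] {κ : Type*} (fs : SmoothBumpCovering κ 𝓘(ℝ, E) M univ)
    {ρ : M → ℝ} (hρ : Continuous ρ) {γ : ℝ → S → M} {I : Set ℝ}
    (hI : UniqueDiffOn ℝ I) (hγ : IsSmoothFamily F E I γ) {σ : M → S}
    (hσ : ContMDiff 𝓘(ℝ, E) 𝓘(ℝ, F) ∞ σ) {ε₀ : ℝ} (hε₀ : ε₀ ∈ I) (hγσ : ∀ x, γ ε₀ (σ x) = x)
    (x₀ : M) :
    ∀ᶠ q : OneJets E M F S × ℝ in 𝓝 (oneJet σ x₀, ε₀) ⊓ 𝓟 (univ ×ˢ I),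
      IsCloseJet fs ρ (γ q.2) q.1 := by
  set j₀ : OneJets E M F S := oneJet σ x₀
  have hx : Tendsto (fun q : OneJets E M F S × ℝ => q.1.proj.1) (𝓝 (j₀, ε₀) ⊓ 𝓟 (univ ×ˢ I))
    (𝓝 x₀) := (tendsto_jet_fst j₀ ε₀).mono_left inf_le_left
  have hz : Tendsto (fun q : OneJets E M F S × ℝ => γ q.2 q.1.proj.2)
      (𝓝 (j₀, ε₀) ⊓ 𝓟 (univ ×ˢ I)) (𝓝 x₀) := by
    have := tendsto_family hγ.continuousOn hε₀ j₀
    have h2 : γ ε₀ j₀.proj.2 = x₀ := hγσ x₀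
    rwa [h2] at this
  have h1 : ∀ᶠ q : OneJets E M F S × ℝ in 𝓝 (j₀, ε₀) ⊓ 𝓟 (univ ×ˢ I),
      ∀ i, fs i (γ q.2 q.1.proj.2) = 1 → q.1.proj.1 ∈ Function.support (fs i) := by
    have hlf : LocallyFinite fun i => {x | fs i x = 1} :=
      fs.locallyFinite.subset fun i x hx => by
        rw [Function.mem_support, show fs i x = 1 from hx]; exact one_ne_zero
    have hev := hz.eventually (hlf.eventually_subset
      (fun i => isClosed_eq (fs i).continuous continuous_const) x₀)
    have hfin : ∀ᶠ q : OneJets E M F S × ℝ in 𝓝 (j₀, ε₀) ⊓ 𝓟 (univ ×ˢ I),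
        ∀ i ∈ {i | x₀ ∈ {x | fs i x = 1}}, q.1.proj.1 ∈ Function.support (fs i) := by
      refine (eventually_all_finite (hlf.point_finite x₀)).2 fun i hi => ?_
      refine hx.eventually ((fs i).isOpen_support.mem_nhds ?_)
      rw [Function.mem_support, show fs i x₀ = 1 from hi]; exact one_ne_zero
    filter_upwards [hev, hfin] with q hq1 hq2 i hi using hq2 i (hq1 hi)
  have h2 : ∀ᶠ q : OneJets E M F S × ℝ in 𝓝 (j₀, ε₀) ⊓ 𝓟 (univ ×ˢ I),
      ∀ i, q.1.proj.1 ∈ tsupport (fs i) → γ q.2 q.1.proj.2 ∈ (chartAt E (fs.c i)).source ∧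
      ∀ v, ‖vectorDifferential (F := F) (extChartAt 𝓘(ℝ, E) (fs.c i) ∘ γ q.2) q.1.proj.2
          (jetMap q.1 v) - vectorDifferential (F := E) (extChartAt 𝓘(ℝ, E) (fs.c i)) q.1.proj.1 v‖
        ≤ 1 / 2 * ‖vectorDifferential (F := E) (extChartAt 𝓘(ℝ, E) (fs.c i)) q.1.proj.1 v‖ := by
    have hlf : LocallyFinite fun i => tsupport (fs i) := fs.locallyFinite.closure
    have hev := hx.eventually (hlf.eventually_subset (fun i => isClosed_tsupport _) x₀)
    have hfin := (eventually_all_finite (l := 𝓝 (j₀, ε₀) ⊓ 𝓟 (univ ×ˢ I))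
      (p := fun i (q : OneJets E M F S × ℝ) =>
        γ q.2 q.1.proj.2 ∈ (chartAt E (fs.c i)).source ∧
      ∀ v, ‖vectorDifferential (F := F) (extChartAt 𝓘(ℝ, E) (fs.c i) ∘ γ q.2) q.1.proj.2
          (jetMap q.1 v) - vectorDifferential (F := E) (extChartAt 𝓘(ℝ, E) (fs.c i)) q.1.proj.1 v‖
        ≤ 1 / 2 * ‖vectorDifferential (F := E) (extChartAt 𝓘(ℝ, E) (fs.c i)) q.1.proj.1 v‖)
      (hlf.point_finite x₀)).2 fun i hi => ?_
    · filter_upwards [hev, hfin] with q hq1 hq2 i hi using hq2 i (hq1 hi)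
    · have hsrc : x₀ ∈ (chartAt E (fs.c i)).source := (fs i).tsupport_subset_chartAt_source hi
      obtain ⟨Φ, hΦ, hΦe⟩ := exists_smooth_eventuallyEq_extChartAt hsrc
      have hinj : Function.Injective (vectorDifferential (F := E) Φ x₀) := by
        rw [vectorDifferential_congr hΦe]
        exact injective_vectorDifferential_extChartAt hsrc
      filter_upwards [hz.eventually ((chartAt E (fs.c i)).open_source.mem_nhds hsrc),
        hx.eventually hΦe.eventually_nhds, hz.eventually hΦe.eventually_nhds,
        eventually_norm_sub_le_half hI hγ hσ hε₀ hγσ hΦ hinj,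
        mem_inf_of_right (mem_principal_self _)] with q hq1 hq2 hq3 hq4 hq5
      refine ⟨hq1, fun v => ?_⟩
      have e1 := vectorDifferential_congr (F := E) hq2
      have e2 : Φ ∘ γ q.2 =ᶠ[𝓝 q.1.proj.2] extChartAt 𝓘(ℝ, E) (fs.c i) ∘ γ q.2 :=
        (hγ.contMDiff hq5.2).continuous.continuousAt.tendsto.eventually hq3
      rw [← e1, ← vectorDifferential_congr (F := F) e2]
      exact hq4 v
  have h3 : ∀ᶠ q : OneJets E M F S × ℝ in 𝓝 (j₀, ε₀) ⊓ 𝓟 (univ ×ˢ I),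
      |ρ (γ q.2 q.1.proj.2) - ρ q.1.proj.1| < 1 := by
    have := (((hρ.tendsto x₀).comp hz).sub ((hρ.tendsto x₀).comp hx)).abs
    rw [sub_self, abs_zero] at this
    exact this.eventually (gt_mem_nhds one_pos)
  have h4 : ∀ᶠ q : OneJets E M F S × ℝ in 𝓝 (j₀, ε₀) ⊓ 𝓟 (univ ×ˢ I),
      γ q.2 q.1.proj.2 ∈ connectedComponent q.1.proj.1 := by
    have : LocallyConnectedSpace M := ChartedSpace.locallyConnectedSpace E M
    have ho : connectedComponent x₀ ∈ 𝓝 x₀ := isOpen_connectedComponent.mem_nhds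
      mem_connectedComponent
    filter_upwards [hz.eventually ho, hx.eventually ho] with q hq1 hq2
    rwa [← connectedComponent_eq hq2]
  filter_upwards [h1, h2, h3, h4] with q hq1 hq2 hq3 hq4
  exact ⟨hq1, fun i hi => (hq2 i hi).1, fun i hi => (hq2 i hi).2, hq3, hq4⟩

/-- A smooth self-map that is close to the identity is a diffeomorphism. -/
theorem bijective_of_isCloseJet [T2Space M] {κ : Type*}
    (fs : SmoothBumpCovering κ 𝓘(ℝ, E) M univ)
    {ρ : M → ℝ} (hρ : Continuous ρ) (hρK : ∀ r : ℝ, IsCompact {x | ρ x ≤ r}) {b : M → M}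
    (hb : ContMDiff 𝓘(ℝ, E) 𝓘(ℝ, E) ∞ b)
    (hclose : ∀ x, IsCloseJet fs ρ b (oneJet id x : OneJets E M E M)) :
    Function.Bijective b ∧ ∀ x, Function.Injective (mfderiv 𝓘(ℝ, E) 𝓘(ℝ, E) b x) := by
  have hjet : ∀ x v, jetMap (oneJet (id : M → M) x : OneJets E M E M) v = v := by
    intro x v
    have : mfderiv 𝓘(ℝ, E) 𝓘(ℝ, E) (id : M → M) x = ContinuousLinearMap.id ℝ _ := mfderiv_id
    exact congrArg (fun L : E →L[ℝ] E => L v) this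
  have hcover : ∀ x, ∃ i, fs i x = 1 := fun x => by
    obtain ⟨i, hi⟩ := fs.eventuallyEq_one' x (mem_univ x)
    exact ⟨i, hi.self_of_nhds⟩
  have hsupp : ∀ {i x}, fs i x = 1 → x ∈ Function.support (fs i) := fun {i x} h => by
    rw [Function.mem_support, h]; exact one_ne_zero
  have hmd : ∀ i x, x ∈ tsupport (fs i) →
      MDifferentiableAt 𝓘(ℝ, E) 𝓘(ℝ, E) (extChartAt 𝓘(ℝ, E) (fs.c i) ∘ b) x := by
    intro i x hx
    exact (mdifferentiableAt_extChartAt ((hclose x).mem_source i hx)).comp x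
      (hb.mdifferentiable (by simp) x)
  have hbound : ∀ i x, x ∈ tsupport (fs i) → ∀ v,
      ‖vectorDifferential (F := E) (extChartAt 𝓘(ℝ, E) (fs.c i) ∘ b) x v
        - tangentCoord (fs.c i) x v‖ ≤ 1 / 2 * ‖tangentCoord (fs.c i) x v‖ := by
    intro i x hx v
    rw [tangentCoord_eq_vectorDifferential ((fs i).tsupport_subset_chartAt_source hx)]
    have := (hclose x).norm_sub_le i hx v
    rw [hjet] at this
    exact this
  -- In a chart the derivative of `b` differs from the identity by relative error at most `1/2`, so
  -- it has no kernel.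
  have hinjd : ∀ x, Function.Injective (mfderiv 𝓘(ℝ, E) 𝓘(ℝ, E) b x) := by
    intro x
    obtain ⟨i, hi⟩ := hcover x
    have hxt : x ∈ tsupport (fs i) := subset_tsupport _ (hsupp hi)
    refine (injective_iff_map_eq_zero _).2 ?_
    suffices ∀ v : E, mfderiv 𝓘(ℝ, E) 𝓘(ℝ, E) b x v = 0 → v = 0 from this
    intro v hv
    have h1 : vectorDifferential (F := E) (extChartAt 𝓘(ℝ, E) (fs.c i) ∘ b) x v = 0 := by
      have h2 := mfderiv_comp x (mdifferentiableAt_extChartAt (I := 𝓘(ℝ, E))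
        ((hclose x).mem_source i hxt)) (hb.mdifferentiable (by simp) x)
      have h3 := congrArg (fun L : E →L[ℝ] E => L v) h2
      refine h3.trans ?_
      exact (congrArg (mfderiv 𝓘(ℝ, E) 𝓘(ℝ, E) (extChartAt 𝓘(ℝ, E) (fs.c i)) (b x)) hv).trans
        (ContinuousLinearMap.map_zero _)
    have h4 := hbound i x hxt v
    rw [h1, zero_sub, norm_neg] at h4
    have h5 : tangentCoord (fs.c i) x v = 0 := by
      rw [← norm_eq_zero]
      linarith [norm_nonneg (tangentCoord (fs.c i) x v)]
    have h6 := tangentCoordSymm_tangentCoord ((fs i).tsupport_subset_chartAt_source hxt) v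
    rw [h5, map_zero] at h6
    exact h6.symm
  have hinj : Function.Injective b := by
    intro x y hxy
    -- The index is chosen at the common image: `mem_support` then puts both `x` and `y` in one bump
    -- support, a ball in the chart. On this convex set `b - id` is `1/2`-Lipschitz, which excludes
    -- `b x = b y` with `x ≠ y`.
    obtain ⟨i, hi⟩ := hcover (b x)
    have hx : x ∈ Function.support (fs i) := (hclose x).mem_support i hi
    have hy : y ∈ Function.support (fs i) := (hclose y).mem_support i (hxy ▸ hi)
    set φ := extChartAt 𝓘(ℝ, E) (fs.c i)
    have hball : Metric.ball (φ (fs.c i)) (fs i).rOut ⊆ φ.target := by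
      have := (fs i).ball_subset
      rwa [modelWithCornersSelf_coe, range_id, inter_univ] at this
    have hsup := (fs i).support_eq_inter_preimage
    rw [hsup] at hx hy
    have hlip : ∀ w ∈ Metric.ball (φ (fs.c i)) (fs i).rOut,
        HasFDerivWithinAt (fun w => (φ ∘ b) (φ.symm w) - w)
          (fderiv ℝ ((φ ∘ b) ∘ φ.symm) w - ContinuousLinearMap.id ℝ E)
          (Metric.ball (φ (fs.c i)) (fs i).rOut) w ∧
        ‖fderiv ℝ ((φ ∘ b) ∘ φ.symm) w - ContinuousLinearMap.id ℝ E‖ ≤ 1 / 2 := by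
      intro w hw
      have hwt := hball hw
      set p := φ.symm w
      have hps : p ∈ φ.source := φ.map_target hwt
      have hpw : φ p = w := φ.right_inv hwt
      have hps' : p ∈ (chartAt E (fs.c i)).source := by rwa [← extChartAt_source 𝓘(ℝ, E)]
      have hpsup : p ∈ tsupport (fs i) := by
        refine subset_tsupport _ ?_
        rw [hsup]
        refine ⟨hps', ?_⟩
        rw [mem_preimage]
        change φ p ∈ _
        rwa [hpw]
      have hd := vectorDifferential_eq_fderiv_comp (hmd i p hpsup) hps'
      change _ = (fderiv ℝ _ (φ p)).comp _ at hd
      rw [hpw] at hd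
      constructor
      · have hsm : ContMDiffAt 𝓘(ℝ, E) 𝓘(ℝ, E) ∞ φ.symm w :=
          (contMDiffOn_extChartAt_symm (fs.c i)).contMDiffAt
            ((isOpen_extChartAt_target _).mem_nhds hwt)
        have hdiff : DifferentiableAt ℝ ((φ ∘ b) ∘ φ.symm) w := by
          rw [← mdifferentiableAt_iff_differentiableAt]
          exact (hmd i p hpsup).comp w (hsm.mdifferentiableAt (by simp))
        exact (hdiff.hasFDerivAt.sub (hasFDerivAt_id w)).hasFDerivWithinAt
      · refine ContinuousLinearMap.opNorm_le_bound _ (by norm_num) fun u => ?_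
        have h7 := hbound i p hpsup (tangentCoordSymm (fs.c i) p u)
        rw [hd, ContinuousLinearMap.comp_apply, tangentCoord_tangentCoordSymm hps'] at h7
        exact h7
    have hmv := (convex_ball (φ (fs.c i)) (fs i).rOut).norm_image_sub_le_of_norm_hasFDerivWithin_le
      (fun w hw => (hlip w hw).1) (fun w hw => (hlip w hw).2) hx.2 hy.2
    have hxs : φ.symm (φ x) = x := φ.left_inv (by rw [extChartAt_source]; exact hx.1)
    have hys : φ.symm (φ y) = y := φ.left_inv (by rw [extChartAt_source]; exact hy.1)
    change ‖((φ ∘ b) (φ.symm (φ y)) - φ y) - ((φ ∘ b) (φ.symm (φ x)) - φ x)‖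
      ≤ 1 / 2 * ‖φ y - φ x‖ at hmv
    rw [hxs, hys, Function.comp_apply, Function.comp_apply, hxy, sub_sub_sub_cancel_left,
      norm_sub_rev] at hmv
    have h8 : φ y - φ x = 0 := by
      rw [← norm_eq_zero]
      linarith [norm_nonneg (φ y - φ x)]
    rw [← hxs, ← hys, sub_eq_zero.1 h8]
  refine ⟨⟨hinj, ?_⟩, hinjd⟩
  have hopen : IsOpenMap b := isOpenMap_iff_nhds_le.2 fun x =>
    (map_nhds_eq_of_injective_mfderiv hb.contMDiffAt (hinjd x)).ge
  have : LocallyCompactSpace M := ChartedSpace.locallyCompactSpace E M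
  -- Since `b` changes `ρ` by less than `1`, the preimage of `{ρ ≤ r}` lies in the compact set `{ρ ≤
  -- r + 1}`; hence `b` is proper.
  have hclosed : IsClosedMap b := by
    refine IsProperMap.isClosedMap ((isProperMap_iff_isCompact_preimage).2 ⟨hb.continuous, ?_⟩)
    intro K hK
    obtain ⟨r, hr⟩ := hK.bddAbove_image hρ.continuousOn
    refine (hρK (r + 1)).of_isClosed_subset (hK.isClosed.preimage hb.continuous) fun x hx => ?_
    have h9 : |ρ (b x) - ρ x| < 1 := (hclose x).abs_sub_lt
    have h10 : ρ (b x) ≤ r := hr (mem_image_of_mem _ hx)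
    have := (abs_lt.1 h9).1
    simp only [mem_ofPred_eq]
    linarith
  -- A clopen image contains every connected component it meets, and `b y` lies in the component of
  -- `y`.
  have hclopen : IsClopen (range b) := ⟨hclosed.isClosed_range, hopen.isOpen_range⟩
  intro y
  have h11 : b y ∈ connectedComponent y := (hclose y).mem_connectedComponent
  exact (isPreconnected_connectedComponent.subset_isClopen hclopen ⟨b y, h11, mem_range_self y⟩)
    mem_connectedComponent

end CloseToIdentity

/-! ### Functions constant along the fibres of a family of submersions -/

section Fibres

open Filter

variable {E : Type*} [NormedAddCommGroup E] [NormedSpace ℝ E] [FiniteDimensional ℝ E]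
  {F : Type*} [NormedAddCommGroup F] [NormedSpace ℝ F] [FiniteDimensional ℝ F]

theorem exists_continuousLinearEquiv_prod_ker {T : F →L[ℝ] E} (hT : Function.Surjective T) :
    ∃ (Q : F →L[ℝ] LinearMap.ker (T : F →ₗ[ℝ] E))
      (L : F ≃L[ℝ] E × LinearMap.ker (T : F →ₗ[ℝ] E)),
      (L : F →L[ℝ] E × LinearMap.ker (T : F →ₗ[ℝ] E)) = T.prod Q := by
  obtain ⟨Q, hQ⟩ := Submodule.ClosedComplemented.of_finiteDimensional (LinearMap.ker (T : F →ₗ[ℝ] E))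
  have hinj : Function.Injective (T.prod Q) := by
    refine (injective_iff_map_eq_zero _).2 fun v hv => ?_
    have h1 : T v = 0 := congrArg Prod.fst hv
    have h2 : Q v = 0 := congrArg Prod.snd hv
    have h3 := hQ ⟨v, h1⟩
    rw [h2] at h3
    exact (congrArg Subtype.val h3).symm
  have hdim : Module.finrank ℝ F = Module.finrank ℝ (E × LinearMap.ker (T : F →ₗ[ℝ] E)) := by
    rw [Module.finrank_prod, ← LinearMap.finrank_range_add_finrank_ker (T : F →ₗ[ℝ] E),
      LinearMap.range_eq_top.2 hT, finrank_top]
  refine ⟨Q, (LinearEquiv.ofInjectiveOfFinrankEq ((T.prod Q : F →L[ℝ] _) : F →ₗ[ℝ] _) hinj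
    hdim).toContinuousLinearEquiv, ?_⟩
  ext v <;> rfl

/-- A function whose derivative vanishes on the kernels of the derivatives of a family of
submersions is constant on their fibres, locally uniformly in the parameter. -/
theorem exists_nhds_eq_on_fibres {U : Set F} (hU : IsOpen U) {I : Set ℝ} (hI : UniqueDiffOn ℝ I)
    {B : F × ℝ → E} (hB : ContDiffOn ℝ ∞ B (U ×ˢ I)) {w₀ : F} (hw₀ : w₀ ∈ U) {ε₀ : ℝ}
    (hε₀ : ε₀ ∈ I) (hsurj : Function.Surjective (fderiv ℝ (fun w => B (w, ε₀)) w₀))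
    {e₀ : E} (he₀ : ∀ ε ∈ I, B (w₀, ε) = e₀) :
    ∃ V ∈ 𝓝 w₀, ∃ η > 0, ∀ ε ∈ I, |ε - ε₀| < η → ∀ w ∈ V, ∀ w' ∈ V, B (w, ε) = B (w', ε) →
      ∀ u : F → ℝ, DifferentiableOn ℝ u U →
        (∀ y ∈ U, ∀ τ, fderiv ℝ (fun w => B (w, ε)) y τ = 0 → fderiv ℝ u y τ = 0) →
        u w = u w' := by
  set T₀ := fderiv ℝ (fun w => B (w, ε₀)) w₀
  obtain ⟨Q, L, hL⟩ := exists_continuousLinearEquiv_prod_ker hsurj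
  rcases L.subsingleton_or_nnnorm_symm_pos with hs | hN
  -- The zero-dimensional case is separate because the constant `N` below must be positive.
  · refine ⟨univ, univ_mem, 1, one_pos, fun ε _ _ w _ w' _ _ u _ _ => ?_⟩
    rw [Subsingleton.elim w w']
  set N := ‖(L.symm : E × LinearMap.ker (T₀ : F →ₗ[ℝ] E) →L[ℝ] F)‖₊
  -- Half the threshold `N⁻¹` below which a map approximated by `L` up to error `c` is invertible.
  set c : NNReal := N⁻¹ / 2
  have hc0 : 0 < c := by positivity
  have hcN : c < N⁻¹ := NNReal.half_lt_self (inv_pos.2 hN).ne'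
  have hcont := continuousOn_fderiv_slice hI hU hB (w₀, ε₀) ⟨hw₀, hε₀⟩
  have hev : ∀ᶠ p in 𝓝[U ×ˢ I] (w₀, ε₀),
      ‖fderiv ℝ (fun w => B (w, p.2)) p.1 - T₀‖ < c := by
    have := hcont.tendsto.eventually (Metric.ball_mem_nhds _ (show (0 : ℝ) < c from hc0))
    simpa [dist_eq_norm] using! this
  rw [nhdsWithin_prod_eq, hU.nhdsWithin_eq hw₀] at hev
  obtain ⟨p, hp, q, hq, hpq⟩ := eventually_prod_iff.1 hev
  obtain ⟨δ, hδ, hδp⟩ := Metric.mem_nhds_iff.1 (inter_mem hp (hU.mem_nhds hw₀))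
  obtain ⟨η, hη, hηq⟩ := Metric.mem_nhdsWithin_iff.1 hq
  -- The image of the ball of radius `δ / 2` contains a ball of this radius. Neither `r` nor, thanks
  -- to `he₀`, its centre `g₀` depends on `ε`; this makes the neighbourhood uniform in the
  -- parameter.
  set r : ℝ := ((N : ℝ)⁻¹ - c) * (δ / 2)
  have hr : 0 < r := by
    have : (c : ℝ) < (N : ℝ)⁻¹ := by exact_mod_cast hcN
    exact mul_pos (sub_pos.2 this) (half_pos hδ)
  set g₀ : E × LinearMap.ker (T₀ : F →ₗ[ℝ] E) := (e₀, Q w₀)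
  have hBc : ContinuousWithinAt B (U ×ˢ I) (w₀, ε₀) := hB.continuousOn _ ⟨hw₀, hε₀⟩
  have hev2 : ∀ᶠ p in 𝓝[U ×ˢ I] (w₀, ε₀), (B p, Q p.1) ∈ Metric.ball g₀ r := by
    have h1 : ContinuousWithinAt (fun p : F × ℝ => (B p, Q p.1)) (U ×ˢ I) (w₀, ε₀) :=
      hBc.prodMk (Q.continuous.comp continuous_fst).continuousWithinAt
    refine h1.tendsto.eventually ?_
    rw [he₀ ε₀ hε₀]
    exact Metric.ball_mem_nhds _ hr
  rw [nhdsWithin_prod_eq, hU.nhdsWithin_eq hw₀] at hev2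
  obtain ⟨p', hp', q', hq', hpq'⟩ := eventually_prod_iff.1 hev2
  obtain ⟨η', hη', hηq'⟩ := Metric.mem_nhdsWithin_iff.1 hq'
  refine ⟨{w | p' w} ∩ Metric.ball w₀ δ, inter_mem hp' (Metric.ball_mem_nhds _ hδ),
    min η η', lt_min hη hη', ?_⟩
  rintro ε hε hεη w ⟨hw1, hw2⟩ w' ⟨hw1', hw2'⟩ hww u hu hker
  have hqε : q ε := hηq ⟨by rw [Metric.mem_ball, Real.dist_eq]; exact hεη.trans_le (min_le_left _ _), hε⟩
  have hqε' : q' ε :=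
    hηq' ⟨by rw [Metric.mem_ball, Real.dist_eq]; exact hεη.trans_le (min_le_right _ _), hε⟩
  -- Straightening coordinates: the fibres of `B (·, ε)` become the slices with fixed first
  -- component.
  set g : F → E × LinearMap.ker (T₀ : F →ₗ[ℝ] E) := fun y => (B (y, ε), Q y)
  have hδU : Metric.ball w₀ δ ⊆ U := fun y hy => (hδp hy).2
  have hgd : ∀ y ∈ Metric.ball w₀ δ,
      HasFDerivAt g ((fderiv ℝ (fun w => B (w, ε)) y).prod Q) y := by
    intro y hy
    exact (hasFDerivAt_slice hU hB (hδU hy) hε).differentiableAt.hasFDerivAt.prodMk Q.hasFDerivAt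
  have hclose : ∀ x ∈ Metric.ball w₀ δ,
      ‖(fderiv ℝ (fun w => B (w, ε)) x).prod Q - (L : F →L[ℝ] _)‖ ≤ c := by
    intro x hx
    have h2 : (fderiv ℝ (fun w => B (w, ε)) x).prod Q - (L : F →L[ℝ] _) =
        (ContinuousLinearMap.inl ℝ E (LinearMap.ker (T₀ : F →ₗ[ℝ] E))).comp
          (fderiv ℝ (fun w => B (w, ε)) x - T₀) := by
      rw [hL]
      ext v <;> simp
    rw [h2]
    refine ContinuousLinearMap.opNorm_le_bound _ c.2 fun v => ?_
    have h3 := (fderiv ℝ (fun w => B (w, ε)) x - T₀).le_of_opNorm_le (hpq (hδp hx).1 hqε).le v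
    simpa [Prod.norm_def] using h3
  have happ : ApproximatesLinearOn g (L : F →L[ℝ] _) (Metric.ball w₀ δ) c := by
    intro y hy y' hy'
    exact (convex_ball w₀ δ).norm_image_sub_le_of_norm_hasFDerivWithin_le'
      (fun x hx => (hgd x hx).hasFDerivWithinAt) hclose hy' hy
  set k := happ.toOpenPartialHomeomorph g _ (Or.inr hcN) Metric.isOpen_ball
  have htarget : Metric.closedBall g₀ r ⊆ k.target := by
    have h4 := happ.closedBall_subset_target (Or.inr hcN) Metric.isOpen_ball (b := w₀)
      (half_pos hδ).le (Metric.closedBall_subset_ball (half_lt_self hδ))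
    have h5 : g w₀ = g₀ := by simp only [g, g₀, he₀ ε hε]
    rwa [h5] at h4
  have hgw : g w ∈ Metric.ball g₀ r := hpq' hw1 hqε'
  have hgw' : g w' ∈ Metric.ball g₀ r := hpq' hw1' hqε'
  have hkw : k.symm (g w) = w := k.left_inv hw2
  have hkw' : k.symm (g w') = w' := k.left_inv hw2'
  have hderiv : ∀ y ∈ Metric.ball g₀ r, ∃ D : E × LinearMap.ker (T₀ : F →ₗ[ℝ] E) →L[ℝ] ℝ,
      HasFDerivAt (u ∘ k.symm) D y ∧ ∀ a, D (0, a) = 0 := by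
    intro y hy
    have hyt : y ∈ k.target := htarget (Metric.ball_subset_closedBall hy)
    have hx : k.symm y ∈ Metric.ball w₀ δ := k.map_target hyt
    set G' := (fderiv ℝ (fun w => B (w, ε)) (k.symm y)).prod Q
    have hinj : Function.Injective G' := by
      refine (injective_iff_map_eq_zero _).2 fun v hv => ?_
      have h6 := (G' - (L : F →L[ℝ] _)).le_of_opNorm_le (hclose _ hx) v
      rw [sub_apply, hv, zero_sub, norm_neg] at h6
      have h7 : ‖v‖ ≤ N * ‖L v‖ := by
        have := (L.symm : E × LinearMap.ker (T₀ : F →ₗ[ℝ] E) →L[ℝ] F).le_opNorm (L v)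
        simpa using! this
      have h8 : (N : ℝ) * c < 1 := by
        have : N * c < 1 := by
          calc N * c < N * N⁻¹ := by gcongr
            _ = 1 := mul_inv_cancel₀ hN.ne'
        exact_mod_cast this
      have h9 : ‖v‖ ≤ (N * c) * ‖v‖ := by
        calc ‖v‖ ≤ N * ‖L v‖ := h7
          _ ≤ N * (c * ‖v‖) := by gcongr; exact h6
          _ = _ := by ring
      rw [← norm_eq_zero]
      nlinarith [norm_nonneg v]
    set L' : F ≃L[ℝ] E × LinearMap.ker (T₀ : F →ₗ[ℝ] E) :=
      (LinearEquiv.ofInjectiveOfFinrankEq (G' : F →ₗ[ℝ] _) hinj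
        L.toLinearEquiv.finrank_eq).toContinuousLinearEquiv
    have hL' : ∀ v, L' v = G' v := fun v => rfl
    have hk' : HasFDerivAt k (L' : F →L[ℝ] _) (k.symm y) := hgd _ hx
    have hks := k.hasFDerivAt_symm hyt hk'
    have hux := ((hu _ (hδU hx)).differentiableAt (hU.mem_nhds (hδU hx))).hasFDerivAt
    refine ⟨_, hux.comp y hks, fun a => ?_⟩
    refine hker _ (hδU hx) _ ?_
    have h10 : G' (L'.symm (0, a)) = (0, a) := by rw [← hL', L'.apply_symm_apply]
    exact congrArg Prod.fst h10
  have hseg : ∀ t ∈ Icc (0 : ℝ) 1, g w + t • (g w' - g w) ∈ Metric.ball g₀ r := fun t ht =>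
    (convex_ball g₀ r).add_smul_sub_mem hgw hgw' ht
  -- Two points of one fibre are joined by a segment in the kernel direction that stays in the ball,
  -- and along it `u ∘ k.symm` has zero derivative.
  have hdir : g w' - g w = (0, Q w' - Q w) := by
    simp [g, hww]
  have hpath : ∀ t ∈ Icc (0 : ℝ) 1,
      HasDerivWithinAt (fun t : ℝ => (u ∘ k.symm) (g w + t • (g w' - g w))) 0 (Icc 0 1) t := by
    intro t ht
    obtain ⟨D, hD, hD0⟩ := hderiv _ (hseg t ht)
    have h11 : HasDerivAt (fun t : ℝ => g w + t • (g w' - g w)) (g w' - g w) t := by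
      simpa using ((hasDerivAt_id t).smul_const (g w' - g w)).const_add (g w)
    have h12 := hD.comp_hasDerivAt t h11
    rw [hdir, hD0] at h12
    rw [hdir]
    exact h12.hasDerivWithinAt
  have hfin := Convex.norm_image_sub_le_of_norm_hasDerivWithin_le (C := 0) hpath (by simp)
    (convex_Icc 0 1) (left_mem_Icc.2 zero_le_one) (right_mem_Icc.2 zero_le_one)
  simp only [one_smul, zero_smul, add_zero, add_sub_cancel, zero_mul, Function.comp_apply,
    hkw, hkw'] at hfin
  exact (sub_eq_zero.1 (norm_le_zero_iff.1 hfin)).symm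

end Fibres

/-! ### Comparison of a point with the section along its fibre -/

section CasimirFibres

open Filter

variable {E : Type*} [NormedAddCommGroup E] [NormedSpace ℝ E] [FiniteDimensional ℝ E]
  {M : Type*} [TopologicalSpace M] [ChartedSpace E M] [IsManifold 𝓘(ℝ, E) ∞ M] [T2Space M]
  {F : Type*} [NormedAddCommGroup F] [NormedSpace ℝ F] [FiniteDimensional ℝ F]
  {S : Type*} [TopologicalSpace S] [ChartedSpace F S] [IsManifold 𝓘(ℝ, F) ∞ S]

/-- The derivative of a map of manifolds, as a map between the model spaces. -/
noncomputable def modelDeriv {X : Type*} [TopologicalSpace X] [ChartedSpace E X] (f : S → X)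
    (z : S) : F →L[ℝ] E := mfderiv 𝓘(ℝ, F) 𝓘(ℝ, E) f z

theorem vectorDifferential_comp {X : Type*} [TopologicalSpace X] [ChartedSpace E X]
    {G : Type*} [NormedAddCommGroup G] [NormedSpace ℝ G]
    {Φ : X → G} {f : S → X} {z : S} (hΦ : MDifferentiableAt 𝓘(ℝ, E) 𝓘(ℝ, G) Φ (f z))
    (hf : MDifferentiableAt 𝓘(ℝ, F) 𝓘(ℝ, E) f z) (v : F) :
    vectorDifferential (F := F) (Φ ∘ f) z v =
      vectorDifferential (F := E) Φ (f z) (modelDeriv f z v) := by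
  have h := mfderiv_comp z hΦ hf
  exact congrArg (fun L : F →L[ℝ] G => L v) h

/-- The points `z` and `σ (β_ε z)` lie on the same `β_ε`-fibre, and both are close to `σ x₀` when
`z` is, so `exists_nhds_eq_on_fibres` applies in a chart. The quantifier over `u` is inside the
filter because one neighbourhood must serve all Casimirs. -/
theorem eventually_eq_section_of_fibres {β : ℝ → S → M} {I : Set ℝ} (hI : UniqueDiffOn ℝ I)
    (hβ : IsSmoothFamily F E I β) {σ : M → S} (hσ : ContMDiff 𝓘(ℝ, E) 𝓘(ℝ, F) ∞ σ)
    (hβσ : ∀ ε ∈ I, ∀ x, β ε (σ x) = x) (x₀ : M) {ε₀ : ℝ} (hε₀ : ε₀ ∈ I) :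
    ∀ᶠ q in 𝓝 (σ x₀, ε₀) ⊓ 𝓟 (univ ×ˢ I), ∀ u : S → ℝ, MDifferentiable 𝓘(ℝ, F) 𝓘(ℝ, ℝ) u →
      (∀ z v, mfderiv 𝓘(ℝ, F) 𝓘(ℝ, E) (β q.2) z v = 0 → differential (E := F) u z v = 0) →
      u q.1 = u (σ (β q.2 q.1)) := by
  have hx₀ : x₀ ∈ (chartAt E x₀).source := mem_chart_source _ _
  obtain ⟨Φ, hΦ, hΦe⟩ := exists_smooth_eventuallyEq_extChartAt hx₀
  have hNx : ∀ᶠ x in 𝓝 x₀, Function.Injective (vectorDifferential (F := E) Φ x) := by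
    filter_upwards [hΦe.eventually_nhds, (chartAt E x₀).open_source.mem_nhds hx₀] with x hx hxs
    rw [vectorDifferential_congr hx]
    exact injective_vectorDifferential_extChartAt hxs
  set z₀ := σ x₀
  set θ := extChartAt 𝓘(ℝ, F) z₀
  have hβc : Tendsto (fun p : S × ℝ => β p.2 p.1) (𝓝[univ ×ˢ I] (z₀, ε₀)) (𝓝 x₀) := by
    have := hβ.continuousOn (z₀, ε₀) ⟨mem_univ _, hε₀⟩
    have h2 : β ε₀ z₀ = x₀ := hβσ ε₀ hε₀ x₀
    rw [ContinuousWithinAt] at this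
    simpa [h2] using this
  have hβN := hβc.eventually hNx
  rw [nhdsWithin_prod_eq, nhdsWithin_univ] at hβN
  obtain ⟨p, hp, q, hq, hpq⟩ := eventually_prod_iff.1 hβN
  obtain ⟨η₁, hη₁, hηq⟩ := Metric.mem_nhdsWithin_iff.1 hq
  obtain ⟨O, hOp, hO, hz₀O⟩ := eventually_nhds_iff.1 hp
  -- Parameters and points are restricted so that `β` lands where `Φ` is immersive. There `D(Φ ∘
  -- β_ε)` and `Dβ_ε` have the same kernel.
  set I' := I ∩ Metric.ball ε₀ η₁
  have hI' : UniqueDiffOn ℝ I' := hI.inter Metric.isOpen_ball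
  have hε₀' : ε₀ ∈ I' := ⟨hε₀, Metric.mem_ball_self hη₁⟩
  set U := θ.target ∩ θ.symm ⁻¹' O
  have hU : IsOpen U := (continuousOn_extChartAt_symm z₀).isOpen_inter_preimage
    (isOpen_extChartAt_target z₀) hO
  have hw₀ : θ z₀ ∈ U := by
    refine ⟨mem_extChartAt_target _, ?_⟩
    rw [mem_preimage, extChartAt_to_inv]
    exact hz₀O
  set B : F × ℝ → E := fun p => Φ (β p.2 (θ.symm p.1))
  have hB : ContDiffOn ℝ ∞ B (U ×ˢ I') := by
    have h1 := contDiffOn_family_inChart (h := fun ε z => Φ (β ε z))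
      (ContMDiff.comp_smoothFamily hβ hΦ) z₀ (Subset.rfl)
    exact h1.mono (prod_mono inter_subset_left inter_subset_left)
  have hfd : ∀ ε ∈ I', ∀ y ∈ U, ∀ τ, fderiv ℝ (fun w => B (w, ε)) y τ =
      vectorDifferential (F := E) Φ (β ε (θ.symm y)) (modelDeriv (β ε) (θ.symm y)
        (tangentCoordSymm (E := F) z₀ (θ.symm y) τ)) := by
    intro ε hε y hy τ
    have hbd := (hβ.contMDiff hε.1).mdifferentiable (by simp) (θ.symm y)
    have hΦd := hΦ.mdifferentiable (by simp) (β ε (θ.symm y))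
    rw [← vectorDifferential_comp hΦd hbd]
    have hzs : θ.symm y ∈ (chartAt F z₀).source := by
      rw [← extChartAt_source 𝓘(ℝ, F)]; exact θ.map_target hy.1
    rw [vectorDifferential_eq_fderiv_comp (hΦd.comp _ hbd) hzs, ContinuousLinearMap.comp_apply,
      tangentCoord_tangentCoordSymm hzs]
    change _ = fderiv ℝ _ (θ (θ.symm y)) τ
    rw [θ.right_inv hy.1]
    rfl
  have hsurj : Function.Surjective (fderiv ℝ (fun w => B (w, ε₀)) (θ z₀)) := by
    have hz : θ.symm (θ z₀) = z₀ := extChartAt_to_inv _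
    have hzs : z₀ ∈ (chartAt F z₀).source := mem_chart_source _ _
    have hid : ∀ v : E, modelDeriv (F := F) (E := E) (β ε₀) z₀
        (modelDeriv (F := E) (E := F) σ x₀ v) = v := by
      intro v
      have h3 := mfderiv_comp x₀ ((hβ.contMDiff hε₀).mdifferentiable (by simp) (σ x₀))
        (hσ.mdifferentiable (by simp) x₀)
      have h4 : β ε₀ ∘ σ = id := funext fun x => hβσ ε₀ hε₀ x
      rw [h4, mfderiv_id] at h3
      exact (congrArg (fun L : E →L[ℝ] E => L v) h3).symm
    have hinjx : Function.Injective (vectorDifferential (F := E) Φ x₀) := hNx.self_of_nhds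
    have hsurjx : Function.Surjective (vectorDifferential (F := E) Φ x₀) :=
      (LinearMap.injective_iff_surjective (f := (vectorDifferential (F := E) Φ x₀ : E →ₗ[ℝ] E))).1
        hinjx
    intro e
    obtain ⟨v, rfl⟩ := hsurjx e
    refine ⟨tangentCoord (E := F) z₀ z₀ (modelDeriv (F := E) (E := F) σ x₀ v), ?_⟩
    rw [hfd ε₀ hε₀' _ hw₀, hz, tangentCoordSymm_tangentCoord hzs]
    have h5 : β ε₀ z₀ = x₀ := hβσ ε₀ hε₀ x₀
    rw [hid, h5]
  obtain ⟨V, hV, η, hη, hVη⟩ := exists_nhds_eq_on_fibres hU hI' hB hw₀ hε₀' hsurj (e₀ := Φ x₀)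
    (fun ε hε => by simp only [B]; rw [extChartAt_to_inv, hβσ ε hε.1])
  have hlim : Tendsto (fun p : S × ℝ => σ (β p.2 p.1)) (𝓝[univ ×ˢ I] (z₀, ε₀)) (𝓝 z₀) :=
    (hσ.continuous.tendsto x₀).comp hβc
  have hfst : Tendsto (fun p : S × ℝ => p.1) (𝓝[univ ×ˢ I] (z₀, ε₀)) (𝓝 z₀) :=
    (continuous_fst.tendsto (z₀, ε₀)).mono_left inf_le_left
  have hsnd : Tendsto (fun p : S × ℝ => p.2) (𝓝[univ ×ˢ I] (z₀, ε₀)) (𝓝 ε₀) :=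
    (continuous_snd.tendsto (z₀, ε₀)).mono_left inf_le_left
  have hθc : Tendsto θ (𝓝 z₀) (𝓝 (θ z₀)) := continuousAt_extChartAt z₀
  filter_upwards [(hθc.comp hfst).eventually hV, (hθc.comp hlim).eventually hV,
    hfst.eventually (extChartAt_source_mem_nhds (I := 𝓘(ℝ, F)) z₀),
    hlim.eventually (extChartAt_source_mem_nhds (I := 𝓘(ℝ, F)) z₀),
    hsnd.eventually (Metric.ball_mem_nhds ε₀ hη), hsnd.eventually (Metric.ball_mem_nhds ε₀ hη₁),
    mem_inf_of_right (mem_principal_self _)] with q hq1 hq2 hq3 hq4 hq5 hq6 hq7 u hu hker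
  have hqI' : q.2 ∈ I' := ⟨hq7.2, hq6⟩
  have hs1 : θ.symm (θ q.1) = q.1 := θ.left_inv hq3
  have hs2 : θ.symm (θ (σ (β q.2 q.1))) = σ (β q.2 q.1) := θ.left_inv hq4
  have hudiff : ∀ y ∈ U, DifferentiableAt ℝ (u ∘ θ.symm) y := by
    intro y hy
    have hsm : ContMDiffAt 𝓘(ℝ, F) 𝓘(ℝ, F) ∞ θ.symm y :=
      (contMDiffOn_extChartAt_symm z₀).contMDiffAt ((isOpen_extChartAt_target _).mem_nhds hy.1)
    rw [← mdifferentiableAt_iff_differentiableAt]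
    exact (hu _).comp y (hsm.mdifferentiableAt (by simp))
  have hres := hVη q.2 hqI' (by rw [← Real.dist_eq]; exact hq5) _ hq1 _ hq2
    (by
      simp only [B, Function.comp_apply]
      rw [hs1, hs2, hβσ q.2 hq7.2])
    (u ∘ θ.symm) (fun y hy => (hudiff y hy).differentiableWithinAt) (fun y hy τ hτ => by
      rw [hfd q.2 hqI' y hy τ] at hτ
      have hinj : Function.Injective (vectorDifferential (F := E) Φ (β q.2 (θ.symm y))) :=
        hpq (hOp _ hy.2) (hηq ⟨hqI'.2, hqI'.1⟩)
      have h6 := hker _ _ (hinj (hτ.trans (map_zero _).symm))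
      have hzs : θ.symm y ∈ (chartAt F z₀).source := by
        rw [← extChartAt_source 𝓘(ℝ, F)]; exact θ.map_target hy.1
      have h7 := vectorDifferential_eq_fderiv_comp (hu (θ.symm y)) hzs
      have h8 := congrArg (fun L : F →L[ℝ] ℝ => L (tangentCoordSymm (E := F) z₀ (θ.symm y) τ)) h7
      simp only [ContinuousLinearMap.comp_apply] at h8
      rw [tangentCoord_tangentCoordSymm hzs] at h8
      change _ = fderiv ℝ _ (θ (θ.symm y)) τ at h8
      rw [θ.right_inv hy.1] at h8
      exact h8.symm.trans h6)
  simp only [Function.comp_apply] at hres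
  rwa [hs1, hs2] at hres

end CasimirFibres

/-! ### Linear algebra of Lagrangian subspaces -/

section SymplecticLinearAlgebra

variable {E : Type*} [NormedAddCommGroup E] [NormedSpace ℝ E] [FiniteDimensional ℝ E]
  {F : Type*} [NormedAddCommGroup F] [NormedSpace ℝ F] [FiniteDimensional ℝ F]

/-- A Lagrangian subspace contains its symplectic orthogonal. -/
theorem exists_eq_of_forall_lagrangian {Ψ : F →L[ℝ] F →L[ℝ] ℝ}
    (hsurj : Function.Surjective Ψ) {Λ : E →L[ℝ] F} (hΛ : Function.Injective Λ)
    (hiso : ∀ v w, Ψ (Λ v) (Λ w) = 0) (hdim : 2 * Module.finrank ℝ E = Module.finrank ℝ F)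
    {x : F} (hx : ∀ u, Ψ x (Λ u) = 0) : ∃ u, Λ u = x := by
  obtain ⟨l, hl⟩ := LinearMap.exists_leftInverse_of_injective (Λ : E →ₗ[ℝ] F)
    (LinearMap.ker_eq_bot.2 hΛ)
  let κ : F →ₗ[ℝ] (E →L[ℝ] ℝ) :=
    { toFun := fun x => (Ψ x).comp Λ
      map_add' := fun a b => by ext; simp
      map_smul' := fun c a => by ext; simp }
  have hκ : Function.Surjective κ := by
    intro ξ
    obtain ⟨v, hv⟩ := hsurj (ξ.comp (LinearMap.toContinuousLinearMap l))
    refine ⟨v, ?_⟩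
    ext e
    have h1 : l (Λ e) = e := congrArg (fun L : E →ₗ[ℝ] E => L e) hl
    simp [κ, hv, h1]
  -- The kernel of `κ` is the orthogonal of `range Λ`. It has dimension `dim F - dim E = dim E` and
  -- contains `range Λ` by isotropy, so the two coincide.
  have h2 := LinearMap.finrank_range_add_finrank_ker κ
  have hdual : Module.finrank ℝ (E →L[ℝ] ℝ) = Module.finrank ℝ E := by
    rw [← (LinearMap.toContinuousLinearMap (𝕜 := ℝ) (E := E) (F' := ℝ)).finrank_eq]
    exact Subspace.dual_finrank_eq (K := ℝ) (V := E)
  rw [LinearMap.range_eq_top.2 hκ, finrank_top, hdual] at h2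
  have h3 : LinearMap.range (Λ : E →ₗ[ℝ] F) ≤ LinearMap.ker κ := by
    rintro _ ⟨v, rfl⟩
    rw [LinearMap.mem_ker]
    ext w
    exact hiso v w
  have h4 : Module.finrank ℝ (LinearMap.range (Λ : E →ₗ[ℝ] F)) = Module.finrank ℝ E :=
    LinearMap.finrank_range_of_inj hΛ
  have h5 := Submodule.eq_of_le_of_finrank_eq h3 (by omega)
  have h6 : x ∈ LinearMap.ker κ := by
    rw [LinearMap.mem_ker]
    ext u
    exact hx u
  rw [← h5] at h6
  exact h6

/-- The linear algebra behind the fact that a Lagrangian bisection of a pair of symplectically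
orthogonal maps induces a Poisson map. -/
theorem lagrangian_bisection_pairing {Ψ : F →L[ℝ] F →L[ℝ] ℝ} (halt : ∀ v, Ψ v v = 0)
    (hsurj : Function.Surjective Ψ) {Λ : E →L[ℝ] F} (hΛ : Function.Injective Λ)
    (hiso : ∀ v w, Ψ (Λ v) (Λ w) = 0) (hdim : 2 * Module.finrank ℝ E = Module.finrank ℝ F)
    {A B : F →L[ℝ] E} (horth : ∀ v, A v = 0 ↔ ∀ w, B w = 0 → Ψ w v = 0)
    {ξ₁ ξ₂ η₁ η₂ : E →L[ℝ] ℝ} (h₁ : ∀ v, ξ₁ (A (Λ v)) = η₁ (B (Λ v)))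
    (h₂ : ∀ v, ξ₂ (A (Λ v)) = η₂ (B (Λ v))) {X₁ X₂ Y₁ Y₂ : F}
    (hX₁ : ∀ v, Ψ X₁ v = ξ₁ (A v)) (hX₂ : ∀ v, Ψ X₂ v = ξ₂ (A v))
    (hY₁ : ∀ v, Ψ Y₁ v = η₁ (B v)) (hY₂ : ∀ v, Ψ Y₂ v = η₂ (B v)) :
    ξ₂ (A X₁) = -η₂ (B Y₁) := by
  have hskew : ∀ v w, Ψ v w = -Ψ w v := by
    intro v w
    have := halt (v + w)
    simp only [map_add, add_apply, halt, zero_add, add_zero] at this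
    linarith
  -- The Hamiltonian vector of a covector pulled back by `B` is orthogonal to `ker B`, hence lies in
  -- `ker A`. This kills the cross terms between the `X`s and the `Y`s below.
  have hAY : ∀ (Y : F) (η : E →L[ℝ] ℝ), (∀ v, Ψ Y v = η (B v)) → A Y = 0 := by
    intro Y η hY
    refine (horth Y).2 fun w hw => ?_
    rw [hskew, hY, hw, map_zero, neg_zero]
  -- The two covectors agree on the Lagrangian subspace, so `X₁ - Y₁` is orthogonal to it and
  -- therefore tangent to it; likewise `X₂ - Y₂`.
  obtain ⟨u₁, hu₁⟩ := exists_eq_of_forall_lagrangian hsurj hΛ hiso hdim (x := X₁ - Y₁) fun u => by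
    rw [map_sub, sub_apply, hX₁, hY₁, h₁, sub_self]
  obtain ⟨u₂, hu₂⟩ := exists_eq_of_forall_lagrangian hsurj hΛ hiso hdim (x := X₂ - Y₂) fun u => by
    rw [map_sub, sub_apply, hX₂, hY₂, h₂, sub_self]
  have h := hiso u₁ u₂
  rw [hu₁, hu₂] at h
  simp only [map_sub, sub_apply] at h
  have e1 : Ψ X₁ Y₂ = 0 := by rw [hX₁, hAY Y₂ η₂ hY₂, map_zero]
  have e2 : Ψ Y₁ X₂ = 0 := by rw [hskew, hX₂, hAY Y₁ η₁ hY₁, map_zero, neg_zero]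
  have e3 : Ψ X₁ X₂ = -ξ₂ (A X₁) := by rw [hskew, hX₂]
  have e4 : Ψ Y₁ Y₂ = -η₂ (B Y₁) := by rw [hskew, hY₂]
  linarith

end SymplecticLinearAlgebra

/-! ### Exact realizations: Poisson maps from Lagrangians, and Casimirs -/

section Realizations

variable {E : Type*} [NormedAddCommGroup E] [NormedSpace ℝ E] [FiniteDimensional ℝ E]
  {M : Type*} [TopologicalSpace M] [ChartedSpace E M] [IsManifold 𝓘(ℝ, E) ∞ M] [T2Space M]
  {F : Type*} [NormedAddCommGroup F] [NormedSpace ℝ F] [FiniteDimensional ℝ F]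
  {S : Type*} [TopologicalSpace S] [ChartedSpace F S] [IsManifold 𝓘(ℝ, F) ∞ S]

theorem exists_isSmoothFun_vectorDifferential_eq (p : M) (ξ : E →L[ℝ] ℝ) :
    ∃ f : M → ℝ, IsSmoothFun E f ∧ vectorDifferential (F := E) f p = ξ := by
  have hp : p ∈ (chartAt E p).source := mem_chart_source _ _
  obtain ⟨Φ, hΦ, hΦe⟩ := exists_smooth_eventuallyEq_extChartAt hp
  set ℓ : E →L[ℝ] ℝ := ξ.comp (tangentCoordSymm p p)
  refine ⟨ℓ ∘ Φ, ℓ.contDiff.contMDiff.comp hΦ, ?_⟩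
  have h1 : MDifferentiableAt 𝓘(ℝ, E) 𝓘(ℝ, ℝ) ℓ (Φ p) :=
    ℓ.differentiableAt.mdifferentiableAt
  have h2 : ∀ v, vectorDifferential (F := E) (ℓ ∘ Φ) p v = ξ v := by
    intro v
    rw [vectorDifferential_comp h1 (hΦ.mdifferentiable (by simp) p)]
    have h3 : vectorDifferential (F := E) ℓ (Φ p) = ℓ := by
      have : mfderiv 𝓘(ℝ, E) 𝓘(ℝ, ℝ) ℓ (Φ p) = fderiv ℝ ℓ (Φ p) := mfderiv_eq_fderiv
      exact this.trans ℓ.fderiv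
    have h4 : modelDeriv Φ p = tangentCoord (E := E) p p :=
      (vectorDifferential_congr hΦe).trans (tangentCoord_eq_vectorDifferential hp).symm
    rw [h3, h4]
    simp only [ℓ, ContinuousLinearMap.comp_apply]
    rw [tangentCoordSymm_tangentCoord hp]
  exact ContinuousLinearMap.ext h2

/-- The value of a symplectic form at a point, as a bilinear form on the model space. -/
def formAt (Ω : SymplecticForm F S) (z : S) : F →L[ℝ] F →L[ℝ] ℝ := Ω.form z

/-- The Hamiltonian vector of a covector. -/
noncomputable def hamVector (Ω : SymplecticForm F S) (z : S) (ξ : F →L[ℝ] ℝ) : F :=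
  (Ω.flat z).symm ξ

theorem form_hamVector (Ω : SymplecticForm F S) (z : S) (ξ : F →L[ℝ] ℝ) (v : F) :
    formAt Ω z (hamVector Ω z ξ) v = ξ v := by
  have : Ω.flat z ((Ω.flat z).symm ξ) = ξ := (Ω.flat z).apply_symm_apply ξ
  exact congrArg (fun L : F →L[ℝ] ℝ => L v) this

theorem bracket_poissonTensor_comp (Ω : SymplecticForm F S) {f g : M → ℝ} {α : S → M} {z : S}
    (hf : MDifferentiableAt 𝓘(ℝ, E) 𝓘(ℝ, ℝ) f (α z))
    (hg : MDifferentiableAt 𝓘(ℝ, E) 𝓘(ℝ, ℝ) g (α z))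
    (hα : MDifferentiableAt 𝓘(ℝ, F) 𝓘(ℝ, E) α z) :
    bracket Ω.poissonTensor (f ∘ α) (g ∘ α) z =
      (vectorDifferential (F := E) g (α z)) (modelDeriv α z (hamVector Ω z
        ((vectorDifferential (F := E) f (α z)).comp (modelDeriv α z)))) := by
  have h1 : (vectorDifferential (F := F) (f ∘ α) z) =
      (vectorDifferential (F := E) f (α z)).comp (modelDeriv α z) :=
    ContinuousLinearMap.ext fun v => vectorDifferential_comp hf hα v
  rw [← vectorDifferential_comp hg hα, ← h1]
  rfl

/-- Being Poisson is expressed by covectors with equal pullbacks to `L`, so neither map has to be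
inverted. The sign in `lagrangian_bisection_pairing` is absorbed by `β` being anti-Poisson, and the
factor `ε` is cancelled. -/
theorem lagrangian_bisection_poisson {Ω : SymplecticForm F S} {P : TwoTensorField E M} {ε : ℝ}
    (hε : ε ≠ 0) {α β : S → M} {σ : M → S} (hR : IsRealizationData Ω (ε • P) α β σ) {ι : M → S}
    (hι : IsLagrangianEmbedding (E := E) Ω ι) {y : M}
    (hinj : Function.Injective (mfderiv 𝓘(ℝ, E) 𝓘(ℝ, F) ι y))
    {ξ₁ ξ₂ η₁ η₂ : E →L[ℝ] ℝ}
    (h₁ : ∀ v, ξ₁ (modelDeriv (F := E) (α ∘ ι) y v) = η₁ (modelDeriv (F := E) (β ∘ ι) y v))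
    (h₂ : ∀ v, ξ₂ (modelDeriv (F := E) (α ∘ ι) y v) = η₂ (modelDeriv (F := E) (β ∘ ι) y v)) :
    P (α (ι y)) ξ₁ ξ₂ = P (β (ι y)) η₁ η₂ := by
  obtain ⟨f₁, hf₁, df₁⟩ := exists_isSmoothFun_vectorDifferential_eq (α (ι y)) ξ₁
  obtain ⟨f₂, hf₂, df₂⟩ := exists_isSmoothFun_vectorDifferential_eq (α (ι y)) ξ₂
  obtain ⟨g₁, hg₁, dg₁⟩ := exists_isSmoothFun_vectorDifferential_eq (β (ι y)) η₁
  obtain ⟨g₂, hg₂, dg₂⟩ := exists_isSmoothFun_vectorDifferential_eq (β (ι y)) η₂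
  have hα := hR.poisson.smooth.mdifferentiable (by simp)
  have hβ := hR.antiPoisson.smooth.mdifferentiable (by simp)
  have hιd := hι.embedding.contMDiff.mdifferentiable (by simp)
  have hA := hR.poisson.map_bracket f₁ f₂ hf₁ hf₂ (ι y)
  have hB := hR.antiPoisson.map_bracket g₁ g₂ hg₁ hg₂ (ι y)
  rw [bracket_poissonTensor_comp Ω (hf₁.mdifferentiable (by simp) _)
    (hf₂.mdifferentiable (by simp) _) (hα _), df₁, df₂] at hA
  rw [bracket_poissonTensor_comp Ω (hg₁.mdifferentiable (by simp) _)
    (hg₂.mdifferentiable (by simp) _) (hβ _), dg₁, dg₂] at hB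
  have hcompα : ∀ v, modelDeriv (F := E) (α ∘ ι) y v =
      modelDeriv (F := F) (E := E) α (ι y) (modelDeriv (F := E) (E := F) ι y v) := fun v =>
    congrArg (fun L : E →L[ℝ] E => L v) (mfderiv_comp y (hα (ι y)) (hιd y))
  have hcompβ : ∀ v, modelDeriv (F := E) (β ∘ ι) y v =
      modelDeriv (F := F) (E := E) β (ι y) (modelDeriv (F := E) (E := F) ι y v) := fun v =>
    congrArg (fun L : E →L[ℝ] E => L v) (mfderiv_comp y (hβ (ι y)) (hιd y))
  have key := lagrangian_bisection_pairing (Ψ := formAt Ω (ι y)) (Ω.alternating (ι y))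
    (fun ξ => ⟨hamVector Ω (ι y) ξ, ContinuousLinearMap.ext (form_hamVector Ω (ι y) ξ)⟩)
    (Λ := modelDeriv (F := E) (E := F) ι y) hinj (hι.isotropic y) hι.half_dim
    (A := modelDeriv α (ι y)) (B := modelDeriv β (ι y)) (hR.orthogonal (ι y))
    (ξ₁ := ξ₁) (ξ₂ := ξ₂) (η₁ := η₁) (η₂ := η₂)
    (fun v => by rw [← hcompα, ← hcompβ]; exact h₁ v)
    (fun v => by rw [← hcompα, ← hcompβ]; exact h₂ v)
    (form_hamVector Ω (ι y) (ξ₁.comp (modelDeriv α (ι y))))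
    (form_hamVector Ω (ι y) (ξ₂.comp (modelDeriv α (ι y))))
    (form_hamVector Ω (ι y) (η₁.comp (modelDeriv β (ι y))))
    (form_hamVector Ω (ι y) (η₂.comp (modelDeriv β (ι y))))
  have hA' : bracket (ε • P) f₁ f₂ (α (ι y)) = ε * P (α (ι y)) ξ₁ ξ₂ := by
    rw [← df₁, ← df₂]; rfl
  have hB' : bracket (-(ε • P)) g₁ g₂ (β (ι y)) = -(ε * P (β (ι y)) η₁ η₂) := by
    rw [← dg₁, ← dg₂]; rfl
  rw [hA'] at hA
  rw [hB'] at hB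
  rw [hA, hB, neg_neg] at key
  exact mul_left_cancel₀ hε key

/-- The Hamiltonian vector `X` of `C ∘ α` is annihilated by `Dα`, because `C` commutes with every
function. Thus `X` is orthogonal to `ker Dβ`, which says that `d(C ∘ α) = Ω(X, ·)` vanishes there.
-/
theorem casimir_comp_differential_eq_zero {Ω : SymplecticForm F S} {P : TwoTensorField E M} {ε : ℝ}
    {α β : S → M} {σ : M → S} (hR : IsRealizationData Ω (ε • P) α β σ) {C : M → ℝ}
    (hC : IsCasimir P C) (z : S) (v : TangentSpace 𝓘(ℝ, F) z)
    (hv : mfderiv 𝓘(ℝ, F) 𝓘(ℝ, E) β z v = 0) : differential (E := F) (C ∘ α) z v = 0 := by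
  have hα := hR.poisson.smooth.mdifferentiable (by simp)
  have hCd := hC.smooth.mdifferentiable (by simp)
  set X : F := hamVector Ω z
    ((vectorDifferential (F := E) C (α z)).comp (modelDeriv α z))
  have h1 : ∀ ξ : E →L[ℝ] ℝ, ξ (modelDeriv α z X) = 0 := by
    intro ξ
    obtain ⟨g, hg, dg⟩ := exists_isSmoothFun_vectorDifferential_eq (α z) ξ
    have h2 := hR.poisson.map_bracket C g hC.smooth hg z
    rw [bracket_poissonTensor_comp Ω (hCd _) (hg.mdifferentiable (by simp) _) (hα _), dg] at h2
    refine h2.trans ?_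
    have h3 : bracket (ε • P) C g (α z) = ε * bracket P C g (α z) := rfl
    rw [h3, hC.bracket_eq_zero g hg, mul_zero]
  have h4 : modelDeriv α z X = (0 : E) := by
    by_contra hne
    obtain ⟨ξ, -, hξ⟩ := exists_dual_vector ℝ (modelDeriv α z X) (norm_ne_zero_iff.2 hne)
    have := h1 ξ
    rw [hξ] at this
    exact hne (norm_eq_zero.1 (by simpa using this))
  have h5 := (hR.orthogonal z X).1 h4 v hv
  have hskew : ∀ a b : F, formAt Ω z a b =
      -formAt Ω z b a := by
    intro a b
    have h6 : formAt Ω z (a + b) (a + b) = 0 := Ω.alternating z _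
    have h7 : formAt Ω z a a = 0 := Ω.alternating z _
    have h8 : formAt Ω z b b = 0 := Ω.alternating z _
    simp only [map_add, add_apply, h7, h8, zero_add, add_zero] at h6
    linarith
  have h9 := form_hamVector Ω z
    ((vectorDifferential (F := E) C (α z)).comp (modelDeriv α z)) v
  refine (vectorDifferential_comp (hCd _) (hα _) v).trans (h9.symm.trans ?_)
  exact (hskew X v).trans (neg_eq_zero.2 h5)

end Realizations

/-! ### Uniform estimates on compact sets -/

section UniformEstimates

open Filter Asymptotics

theorem PoissonRealization.IsUniformO.isBigO_apply {X : Type*} [TopologicalSpace X] {I : Set ℝ}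
    {k : ℕ} {r : ℝ → X → ℝ} (h : IsUniformO I k r) (x : X) :
    (fun ε => r ε x) =O[𝓝[I] 0] fun ε => ε ^ k := by
  obtain ⟨C, δ, hδ, hC⟩ := h {x} isCompact_singleton
  refine IsBigO.of_bound C ?_
  filter_upwards [self_mem_nhdsWithin, mem_nhdsWithin_of_mem_nhds (Metric.ball_mem_nhds 0 hδ)]
    with ε hε hεδ
  have := hC ε hε (by simpa using hεδ) x rfl
  simpa using this

theorem PoissonRealization.IsUniformO.isBigO {X : Type*} [TopologicalSpace X]
    [WeaklyLocallyCompactSpace X] {I : Set ℝ}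
    {k : ℕ} {r : ℝ → X → ℝ} (h : IsUniformO I k r) (x₀ : X) :
    (fun p : X × ℝ => r p.2 p.1) =O[𝓝 x₀ ×ˢ 𝓝[I] 0] fun p => p.2 ^ k := by
  obtain ⟨K, hK, hx₀⟩ := exists_compact_mem_nhds x₀
  obtain ⟨C, δ, hδ, hC⟩ := h K hK
  refine IsBigO.of_bound C ?_
  have h1 : ∀ᶠ ε in 𝓝[I] (0 : ℝ), ε ∈ I ∧ ε ∈ Metric.ball 0 δ :=
    inter_mem self_mem_nhdsWithin (mem_nhdsWithin_of_mem_nhds (Metric.ball_mem_nhds 0 hδ))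
  filter_upwards [prod_mem_prod hx₀ h1] with p hp
  have := hC p.2 hp.2.1 (by simpa using hp.2.2) p.1 hp.1
  simpa using this

theorem PoissonRealization.IsUniformO.comp_continuous {X Y : Type*} [TopologicalSpace X]
    [TopologicalSpace Y] {I : Set ℝ} {k : ℕ} {r : ℝ → X → ℝ} (h : IsUniformO I k r) {ι : Y → X}
    (hι : Continuous ι) : IsUniformO I k fun ε y => r ε (ι y) := by
  intro K hK
  obtain ⟨C, δ, hδ, hC⟩ := h (ι '' K) (hK.image hι)
  exact ⟨C, δ, hδ, fun ε hε hεδ x hx => hC ε hε hεδ _ (mem_image_of_mem _ hx)⟩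

/-- Local estimates in a moving parametrization of `X` that is close to the identity are uniform
on compact sets. -/
theorem isUniformO_of_isBigO_comp {X : Type*} [TopologicalSpace X] {I J : Set ℝ} (hJ : J ∈ 𝓝[I] 0)
    {k : ℕ} {ρ : X → ℝ} (hρ : Continuous ρ) (hρK : ∀ r : ℝ, IsCompact {x | ρ x ≤ r})
    {b : ℝ → X → X} (hb : ∀ ε ∈ J, Function.Surjective (b ε))
    (hbρ : ∀ ε ∈ J, ∀ y, |ρ (b ε y) - ρ y| < 1) {r : ℝ → X → ℝ}
    (h : ∀ y₀, (fun p : X × ℝ => r p.2 (b p.2 p.1)) =O[𝓝 y₀ ×ˢ 𝓝[I] 0] fun p => p.2 ^ k) :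
    IsUniformO I k r := by
  intro K hK
  obtain ⟨R, hR⟩ := hK.bddAbove_image hρ.continuousOn
  -- The set `{ρ ≤ R + 1}` contains the preimage of `K` under every `b ε` with `ε ∈ J`, since `b ε`
  -- moves `ρ` by less than `1`.
  have key : ∃ C : ℝ, ∀ᶠ ε in 𝓝[I] (0 : ℝ), ∀ y ∈ {x | ρ x ≤ R + 1},
      |r ε (b ε y)| ≤ C * |ε| ^ k := by
    refine (hρK (R + 1)).induction_on
      (p := fun s => ∃ C : ℝ, ∀ᶠ ε in 𝓝[I] (0 : ℝ), ∀ y ∈ s, |r ε (b ε y)| ≤ C * |ε| ^ k)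
      ⟨0, by simp⟩ ?_ ?_ ?_
    · rintro s t hst ⟨C, hC⟩
      exact ⟨C, hC.mono fun ε hε y hy => hε y (hst hy)⟩
    · rintro s t ⟨C, hC⟩ ⟨D, hD⟩
      refine ⟨max C D, ?_⟩
      filter_upwards [hC, hD] with ε h1 h2 y hy
      rcases hy with hy | hy
      · exact (h1 y hy).trans (by gcongr; exact le_max_left _ _)
      · exact (h2 y hy).trans (by gcongr; exact le_max_right _ _)
    · intro y₀ _
      obtain ⟨C, hC⟩ := (h y₀).bound
      obtain ⟨p, hp, q, hq, hpq⟩ := eventually_prod_iff.1 hC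
      refine ⟨{y | p y}, mem_nhdsWithin_of_mem_nhds hp, C, ?_⟩
      filter_upwards [hq] with ε hε y hy
      simpa using hpq hy hε
  obtain ⟨C, hC⟩ := key
  obtain ⟨δ, hδ, hδC⟩ := Metric.mem_nhdsWithin_iff.1 (inter_mem hC hJ)
  refine ⟨C, δ, hδ, fun ε hε hεδ x hx => ?_⟩
  obtain ⟨h1, h2⟩ := hδC ⟨by simpa using hεδ, hε⟩
  obtain ⟨y, rfl⟩ := hb ε h2 x
  refine h1 y ?_
  have h3 := (abs_lt.1 (hbρ ε h2 y)).1
  have h4 : ρ (b ε y) ≤ R := hR (mem_image_of_mem _ hx)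
  simp only [mem_ofPred_eq]
  linarith

end UniformEstimates

/-! ### The defect of being Poisson as a smooth function of 1-jets -/

section PairingDefect

variable {E : Type*} [NormedAddCommGroup E] [NormedSpace ℝ E] [FiniteDimensional ℝ E]
  {κ : Type*} [Fintype κ]

/-- In coordinates, the difference of a bivector `G` evaluated on `c ∘ A⁻¹` and `d ∘ A⁻¹`, and the
number `h`, where `(A, c, d)` are the first components of the linear map `q.1`, and `(G, h)` the
last components of the vector `q.2`. -/
noncomputable def pairingDefect (e : κ → E)
    (q : (E →L[ℝ] E × ℝ × ℝ × (κ → κ → ℝ) × ℝ) × (E × ℝ × ℝ × (κ → κ → ℝ) × ℝ)) : ℝ :=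
  ∑ i, ∑ j, (q.1 (Ring.inverse ((ContinuousLinearMap.fst ℝ E _).comp q.1) (e i))).2.1
    * (q.1 (Ring.inverse ((ContinuousLinearMap.fst ℝ E _).comp q.1) (e j))).2.2.1
    * q.2.2.2.2.1 i j - q.2.2.2.2.2

/-- Inversion is smooth at units, and the rest is polynomial. Local Lipschitz bounds for the defect
come from here. -/
theorem contDiffAt_pairingDefect (e : κ → E)
    {q : (E →L[ℝ] E × ℝ × ℝ × (κ → κ → ℝ) × ℝ) × (E × ℝ × ℝ × (κ → κ → ℝ) × ℝ)}
    (hq : IsUnit ((ContinuousLinearMap.fst ℝ E _).comp q.1)) :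
    ContDiffAt ℝ ∞ (pairingDefect e) q := by
  have : CompleteSpace E := FiniteDimensional.complete ℝ E
  obtain ⟨u, hu⟩ := hq
  have h1 : ContDiffAt ℝ ∞ (fun q : (E →L[ℝ] E × ℝ × ℝ × (κ → κ → ℝ) × ℝ) ×
      (E × ℝ × ℝ × (κ → κ → ℝ) × ℝ) =>
      Ring.inverse ((ContinuousLinearMap.fst ℝ E (ℝ × ℝ × (κ → κ → ℝ) × ℝ)).comp q.1)) q := by
    refine ContDiffAt.comp q (g := Ring.inverse) ?_
      (contDiff_const.clm_comp contDiff_fst).contDiffAt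
    rw [← hu]
    exact contDiffAt_ringInverse ℝ u
  have h2 : ∀ i, ContDiffAt ℝ ∞ (fun q : (E →L[ℝ] E × ℝ × ℝ × (κ → κ → ℝ) × ℝ) ×
      (E × ℝ × ℝ × (κ → κ → ℝ) × ℝ) => q.1 (Ring.inverse ((ContinuousLinearMap.fst ℝ E
        (ℝ × ℝ × (κ → κ → ℝ) × ℝ)).comp q.1) (e i))) q :=
    fun i => contDiffAt_fst.clm_apply (h1.clm_apply contDiffAt_const)
  have h3 : ContDiff ℝ ∞ (fun q : (E →L[ℝ] E × ℝ × ℝ × (κ → κ → ℝ) × ℝ) ×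
      (E × ℝ × ℝ × (κ → κ → ℝ) × ℝ) => q.2.2.2.2.1) := by fun_prop
  have h4 : ContDiff ℝ ∞ (fun q : (E →L[ℝ] E × ℝ × ℝ × (κ → κ → ℝ) × ℝ) ×
      (E × ℝ × ℝ × (κ → κ → ℝ) × ℝ) => q.2.2.2.2.2) := by fun_prop
  refine ContDiffAt.sub ?_ h4.contDiffAt
  refine ContDiffAt.sum fun i _ => ContDiffAt.sum fun j _ => ?_
  exact ((h2 i).snd.fst.mul (h2 j).snd.snd.fst).mul
    ((contDiff_apply_apply ℝ ℝ i j).comp h3).contDiffAt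

theorem isUnit_of_injective {A : E →L[ℝ] E} (hA : Function.Injective A) : IsUnit A := by
  set e := (LinearEquiv.ofInjectiveEndo (A : E →ₗ[ℝ] E) hA).toContinuousLinearEquiv
  exact ⟨e.toUnit, ContinuousLinearMap.ext fun v => rfl⟩

end PairingDefect

/-! ### Coordinate formulas for bivectors and pullbacks -/

section TensorFormula

variable {E : Type*} [NormedAddCommGroup E] [NormedSpace ℝ E] [FiniteDimensional ℝ E]
  {M : Type*} [TopologicalSpace M] [ChartedSpace E M] [IsManifold 𝓘(ℝ, E) ∞ M]
  {G G' : Type*} [NormedAddCommGroup G] [NormedSpace ℝ G]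
  [NormedAddCommGroup G'] [NormedSpace ℝ G']

theorem vectorDifferential_clm_comp (L : G →L[ℝ] G') {h : M → G} {x : M}
    (hh : MDifferentiableAt 𝓘(ℝ, E) 𝓘(ℝ, G) h x) :
    vectorDifferential (F := E) (fun y => L (h y)) x = L.comp (vectorDifferential (F := E) h x) := by
  have h1 : MDifferentiableAt 𝓘(ℝ, G) 𝓘(ℝ, G') L (h x) := L.differentiableAt.mdifferentiableAt
  have h2 := mfderiv_comp x h1 hh
  rw [mfderiv_eq_fderiv, L.fderiv] at h2
  exact h2

/-- The value of a 2-tensor field at a point, as a bilinear form on the dual of the model space. -/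
def tensorAt (P : TwoTensorField E M) (x : M) : (E →L[ℝ] ℝ) →ₗ[ℝ] (E →L[ℝ] ℝ) →ₗ[ℝ] ℝ := P x

theorem bracket_eq_tensorAt (P : TwoTensorField E M) (f g : M → ℝ) (x : M) :
    bracket P f g x =
      tensorAt P x (vectorDifferential (F := E) f x) (vectorDifferential (F := E) g x) := rfl

theorem bracket_pullbackTensor_eq (P : TwoTensorField E M) {φ : M → M} {f g : M → ℝ} {x : M}
    (hφ : Function.Injective (modelDeriv (F := E) (E := E) φ x)) {ξ₁ ξ₂ : E →L[ℝ] ℝ}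
    (h₁ : ∀ v, ξ₁ (modelDeriv (F := E) (E := E) φ x v) = vectorDifferential (F := E) f x v)
    (h₂ : ∀ v, ξ₂ (modelDeriv (F := E) (E := E) φ x v) = vectorDifferential (F := E) g x v) :
    bracket (pullbackTensor φ P) f g x = tensorAt P (φ x) ξ₁ ξ₂ := by
  set D : E →L[ℝ] E := modelDeriv (F := E) (E := E) φ x
  have hD : ∀ v, D (D.inverse v) = v := by
    set e := (LinearEquiv.ofInjectiveEndo (D : E →ₗ[ℝ] E) hφ).toContinuousLinearEquiv
    have he : D = (e : E →L[ℝ] E) := ContinuousLinearMap.ext fun v => rfl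
    intro v
    rw [he, ContinuousLinearMap.inverse_equiv]
    exact e.apply_symm_apply v
  have e₁ : (vectorDifferential (F := E) f x).comp D.inverse = ξ₁ := by
    ext v
    rw [ContinuousLinearMap.comp_apply, ← h₁, hD]
  have e₂ : (vectorDifferential (F := E) g x).comp D.inverse = ξ₂ := by
    ext v
    rw [ContinuousLinearMap.comp_apply, ← h₂, hD]
  rw [← e₁, ← e₂]
  rfl

/-- The functions in terms of which a bivector on `a(M)` and its counterpart on `b(M)` are
compared. -/
noncomputable def pairingData {κ : Type*} [Fintype κ] (P : TwoTensorField E M)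
    (bas : Module.Basis κ ℝ E) (Φ : M → E) (f g : M → ℝ) (a b : M → M) (y : M) :
    E × ℝ × ℝ × (κ → κ → ℝ) × ℝ :=
  (Φ (a y), f (b y), g (b y), fun i j => bracket P (fun x => bas.equivFun (Φ x) i)
    (fun x => bas.equivFun (Φ x) j) (a y), bracket P f g (b y))

/-- With `A = D(Φ ∘ a)` in the chart, take `ξ₁ = d(f ∘ b) ∘ A⁻¹ ∘ DΦ`, and `ξ₂` likewise from `g`.
Expanding them in the differentials of the components of `Φ` expresses `P` through brackets of
global functions, which are smooth; no continuity of the tensor field itself is needed. -/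
theorem exists_pairingDefect_eq {κ : Type*} [Fintype κ] (P : TwoTensorField E M)
    (bas : Module.Basis κ ℝ E) {Φ : M → E} {f g : M → ℝ} {a b : M → M} {y y₀ : M}
    (hy : y ∈ (chartAt E y₀).source)
    (ha : MDifferentiableAt 𝓘(ℝ, E) 𝓘(ℝ, E) a y) (hb : MDifferentiableAt 𝓘(ℝ, E) 𝓘(ℝ, E) b y)
    (hΦ : MDifferentiableAt 𝓘(ℝ, E) 𝓘(ℝ, E) Φ (a y))
    (hf : MDifferentiableAt 𝓘(ℝ, E) 𝓘(ℝ, ℝ) f (b y))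
    (hg : MDifferentiableAt 𝓘(ℝ, E) 𝓘(ℝ, ℝ) g (b y))
    (hD : MDifferentiableAt 𝓘(ℝ, E) 𝓘(ℝ, E × ℝ × ℝ × (κ → κ → ℝ) × ℝ)
      (pairingData P bas Φ f g a b) y)
    (hΦi : Function.Injective (vectorDifferential (F := E) Φ (a y)))
    (hai : Function.Injective (modelDeriv (F := E) (E := E) a y)) :
    IsUnit ((ContinuousLinearMap.fst ℝ E _).comp (fderiv ℝ (fun w => pairingData P bas Φ f g a b
      ((extChartAt 𝓘(ℝ, E) y₀).symm w)) (extChartAt 𝓘(ℝ, E) y₀ y))) ∧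
    ∃ ξ₁ ξ₂ : E →L[ℝ] ℝ,
      (∀ v, ξ₁ (modelDeriv (F := E) (E := E) a y v) =
        vectorDifferential (F := E) f (b y) (modelDeriv (F := E) (E := E) b y v)) ∧
      (∀ v, ξ₂ (modelDeriv (F := E) (E := E) a y v) =
        vectorDifferential (F := E) g (b y) (modelDeriv (F := E) (E := E) b y v)) ∧
      pairingDefect bas (fderiv ℝ (fun w => pairingData P bas Φ f g a b
          ((extChartAt 𝓘(ℝ, E) y₀).symm w)) (extChartAt 𝓘(ℝ, E) y₀ y),
        pairingData P bas Φ f g a b y) =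
      tensorAt P (a y) ξ₁ ξ₂ - tensorAt P (b y) (vectorDifferential (F := E) f (b y))
        (vectorDifferential (F := E) g (b y)) := by
  have hvd := vectorDifferential_eq_fderiv_comp hD hy
  set D : E →L[ℝ] E × ℝ × ℝ × (κ → κ → ℝ) × ℝ := fderiv ℝ (fun w => pairingData P bas Φ f g a b
          ((extChartAt 𝓘(ℝ, E) y₀).symm w)) (extChartAt 𝓘(ℝ, E) y₀ y) with hDdef
  change _ = D.comp _ at hvd
  have hDv : ∀ v, D (tangentCoord y₀ y v) =
      vectorDifferential (F := E) (pairingData P bas Φ f g a b) y v := fun v => by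
    rw [hvd]; rfl
  have hD1 : ∀ v, (D (tangentCoord y₀ y v)).1 =
      vectorDifferential (F := E) Φ (a y) (modelDeriv (F := E) (E := E) a y v) := fun v => by
    rw [hDv, ← vectorDifferential_comp hΦ ha]
    exact congrArg (fun L : E →L[ℝ] E => L v)
      (vectorDifferential_clm_comp (ContinuousLinearMap.fst ℝ E _) hD).symm
  have hD2 : ∀ v, (D (tangentCoord y₀ y v)).2.1 =
      vectorDifferential (F := E) f (b y) (modelDeriv (F := E) (E := E) b y v) := fun v => by
    rw [hDv, ← vectorDifferential_comp hf hb]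
    exact congrArg (fun L : E →L[ℝ] ℝ => L v)
      (vectorDifferential_clm_comp ((ContinuousLinearMap.fst ℝ ℝ _).comp
        (ContinuousLinearMap.snd ℝ E _)) hD).symm
  have hD3 : ∀ v, (D (tangentCoord y₀ y v)).2.2.1 =
      vectorDifferential (F := E) g (b y) (modelDeriv (F := E) (E := E) b y v) := fun v => by
    rw [hDv, ← vectorDifferential_comp hg hb]
    exact congrArg (fun L : E →L[ℝ] ℝ => L v)
      (vectorDifferential_clm_comp ((ContinuousLinearMap.fst ℝ ℝ _).comp
        ((ContinuousLinearMap.snd ℝ ℝ _).comp (ContinuousLinearMap.snd ℝ E _))) hD).symm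
  set A : E →L[ℝ] E := (ContinuousLinearMap.fst ℝ E _).comp D with hA
  have hAv : ∀ v, A (tangentCoord y₀ y v) =
      vectorDifferential (F := E) Φ (a y) (modelDeriv (F := E) (E := E) a y v) := hD1
  have hAi : Function.Injective A := by
    intro v w hvw
    rw [← tangentCoord_tangentCoordSymm hy v, ← tangentCoord_tangentCoordSymm hy w, hAv, hAv] at hvw
    rw [← tangentCoord_tangentCoordSymm hy v, ← tangentCoord_tangentCoordSymm hy w,
      hai (hΦi hvw)]
  have hAu := isUnit_of_injective hAi
  have hinv : ∀ w, Ring.inverse A (A w) = w := fun w =>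
    congrArg (fun L : E →L[ℝ] E => L w) (Ring.inverse_mul_cancel A hAu)
  refine ⟨hAu, ?_⟩
  set c : E →L[ℝ] ℝ := ((ContinuousLinearMap.fst ℝ ℝ _).comp
        (ContinuousLinearMap.snd ℝ E _)).comp (D.comp (Ring.inverse A))
  set d : E →L[ℝ] ℝ := ((ContinuousLinearMap.fst ℝ ℝ _).comp
        ((ContinuousLinearMap.snd ℝ ℝ _).comp (ContinuousLinearMap.snd ℝ E _))).comp
          (D.comp (Ring.inverse A))
  set Θ := vectorDifferential (F := E) Φ (a y) with hΘ
  have hexp : ∀ l : E →L[ℝ] ℝ, l.comp Θ = ∑ i, l (bas i) •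
      vectorDifferential (F := E) (fun x => bas.equivFun (Φ x) i) (a y) := by
    intro l
    ext v
    have h1 : ∀ i, vectorDifferential (F := E) (fun x => bas.equivFun (Φ x) i) (a y) v =
        bas.equivFun (Θ v) i := by
      intro i
      exact congrArg (fun L : E →L[ℝ] ℝ => L v) (vectorDifferential_clm_comp
        ((ContinuousLinearMap.proj i).comp (bas.equivFunL : E →L[ℝ] κ → ℝ)) hΦ)
    simp only [sum_apply, smul_apply, h1, smul_eq_mul, ContinuousLinearMap.comp_apply]
    conv_lhs => rw [← bas.sum_equivFun (Θ v)]
    rw [map_sum]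
    exact Finset.sum_congr rfl fun i _ => by rw [map_smul, smul_eq_mul, mul_comm]
  refine ⟨c.comp Θ, d.comp Θ, fun v => ?_, fun v => ?_, ?_⟩
  · rw [ContinuousLinearMap.comp_apply, ← hAv, ← hD2]
    simp only [c, ContinuousLinearMap.comp_apply, hinv]
    rfl
  · rw [ContinuousLinearMap.comp_apply, ← hAv, ← hD3]
    simp only [d, ContinuousLinearMap.comp_apply, hinv]
    rfl
  · rw [hexp c, hexp d]
    simp only [map_sum, LinearMap.sum_apply, map_smul, LinearMap.smul_apply, smul_eq_mul]
    simp only [pairingDefect, pairingData, bracket_eq_tensorAt]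
    congr 1
    rw [Finset.sum_comm]
    refine Finset.sum_congr rfl fun j _ => ?_
    rw [Finset.mul_sum]
    refine Finset.sum_congr rfl fun i _ => ?_
    rw [← mul_assoc, mul_comm (d (bas j))]
    rfl

end TensorFormula

/-! ### The bivector estimate for approximating families -/

section Families

open Filter Asymptotics

variable {E : Type*} [NormedAddCommGroup E] [NormedSpace ℝ E] [FiniteDimensional ℝ E]
  {M : Type*} [TopologicalSpace M] [ChartedSpace E M] [IsManifold 𝓘(ℝ, E) ∞ M] [T2Space M]
  {F : Type*} [NormedAddCommGroup F] [NormedSpace ℝ F] [FiniteDimensional ℝ F]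
  {S : Type*} [TopologicalSpace S] [ChartedSpace F S] [IsManifold 𝓘(ℝ, F) ∞ S]

theorem PoissonRealization.IsSmoothFamily.comp_contMDiff {γ : ℝ → S → M} {I : Set ℝ}
    (hγ : IsSmoothFamily F E I γ) {ι : M → S} (hι : ContMDiff 𝓘(ℝ, E) 𝓘(ℝ, F) ∞ ι) :
    IsSmoothFamily E E I fun ε y => γ ε (ι y) := by
  have h1 : ContMDiffOn (𝓘(ℝ, E).prod 𝓘(ℝ, ℝ)) (𝓘(ℝ, F).prod 𝓘(ℝ, ℝ)) ∞
      (fun p : M × ℝ => (ι p.1, p.2)) (univ ×ˢ I) :=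
    ((hι.comp contMDiff_fst).prodMk contMDiff_snd).contMDiffOn
  exact ContMDiffOn.comp (g := fun p : S × ℝ => γ p.2 p.1) hγ h1 fun p hp => ⟨mem_univ _, hp.2⟩

theorem eq_of_forall_smooth {p q : M} (h : ∀ g : M → ℝ, IsSmoothFun E g → g p = g q) : p = q := by
  by_contra hne
  obtain ⟨f, -, hf⟩ := (SmoothBumpFunction.nhds_basis_tsupport (I := 𝓘(ℝ, E)) p).mem_iff.1
    (isOpen_compl_singleton.mem_nhds hne)
  have h1 := h f f.contMDiff
  rw [f.eq_one, image_eq_zero_of_notMem_tsupport fun hq => hf hq rfl] at h1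
  exact one_ne_zero h1

/-- At `ε = 0` the error bound is `C * 0 ^ (n + 1) = 0`, and smooth functions separate points. -/
theorem PoissonRealization.IsApproximation.eq_zero {X : Type*} [TopologicalSpace X] {I : Set ℝ}
    (h0 : (0 : ℝ) ∈ I) {n : ℕ} {a a' : ℝ → X → M} (h : IsApproximation E I n a a') (y : X) :
    a 0 y = a' 0 y := by
  refine eq_of_forall_smooth (E := E) fun g hg => ?_
  obtain ⟨C, δ, hδ, hC⟩ := h g hg {y} isCompact_singleton
  have := hC 0 h0 (by simpa using hδ) y rfl
  rw [abs_zero, zero_pow n.succ_ne_zero, mul_zero] at this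
  exact sub_eq_zero.1 (abs_nonpos_iff.1 this)

theorem contMDiffOn_pairingData {κ : Type*} [Fintype κ] {P : TwoTensorField E M}
    (hP : IsPoissonTensor P) (bas : Module.Basis κ ℝ E) {Φ : M → E}
    (hΦ : ContMDiff 𝓘(ℝ, E) 𝓘(ℝ, E) ∞ Φ) {f g : M → ℝ} (hf : IsSmoothFun E f)
    (hg : IsSmoothFun E g) {I : Set ℝ} {a b : ℝ → M → M} (ha : IsSmoothFamily E E I a)
    (hb : IsSmoothFamily E E I b) :
    ContMDiffOn (𝓘(ℝ, E).prod 𝓘(ℝ, ℝ)) 𝓘(ℝ, E × ℝ × ℝ × (κ → κ → ℝ) × ℝ) ∞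
      (fun p : M × ℝ => pairingData P bas Φ f g (a p.2) (b p.2) p.1) (univ ×ˢ I) := by
  have hΦi : ∀ i, IsSmoothFun E fun x => bas.equivFun (Φ x) i := fun i =>
    ((ContinuousLinearMap.proj i).comp (bas.equivFunL : E →L[ℝ] κ → ℝ)).contDiff.contMDiff.comp hΦ
  refine (hΦ.comp_smoothFamily ha).prodMk_space ((ContMDiff.comp_smoothFamily hb hf).prodMk_space
    ((ContMDiff.comp_smoothFamily hb hg).prodMk_space (ContMDiffOn.prodMk_space ?_
      (ContMDiff.comp_smoothFamily hb (hP.smooth f g hf hg)))))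
  rw [contMDiffOn_pi_space]
  intro i
  rw [contMDiffOn_pi_space]
  exact fun j => ContMDiff.comp_smoothFamily ha (hP.smooth _ _ (hΦi i) (hΦi j))

theorem isBigO_pairingData_sub {κ : Type*} [Fintype κ] {P : TwoTensorField E M}
    (hP : IsPoissonTensor P) (bas : Module.Basis κ ℝ E) {Φ : M → E}
    (hΦ : ContMDiff 𝓘(ℝ, E) 𝓘(ℝ, E) ∞ Φ) {f g : M → ℝ} (hf : IsSmoothFun E f)
    (hg : IsSmoothFun E g) {I : Set ℝ} {n : ℕ} {a b a' b' : ℝ → M → M}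
    (ha : IsApproximation E I n a a') (hb : IsApproximation E I n b b') (y : M) :
    (fun ε => pairingData P bas Φ f g (a ε) (b ε) y - pairingData P bas Φ f g (a' ε) (b' ε) y)
      =O[𝓝[I] 0] fun ε => ε ^ (n + 1) := by
  have hΦi : ∀ i, IsSmoothFun E fun x => bas.equivFun (Φ x) i := fun i =>
    ((ContinuousLinearMap.proj i).comp (bas.equivFunL : E →L[ℝ] κ → ℝ)).contDiff.contMDiff.comp hΦ
  refine IsBigO.prod_left ?_ (IsBigO.prod_left ((hb f hf).isBigO_apply y)
    (IsBigO.prod_left ((hb g hg).isBigO_apply y) (IsBigO.prod_left ?_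
      ((hb _ (hP.smooth f g hf hg)).isBigO_apply y))))
  · refine (bas.equivFunL.isBigO_comp_rev _ _).trans (isBigO_pi.2 fun i => ?_)
    refine ((ha _ (hΦi i)).isBigO_apply y).congr_left fun ε => ?_
    have := congrFun (map_sub bas.equivFun (Φ (a ε y)) (Φ (a' ε y))) i
    exact this.symm
  · exact isBigO_pi.2 fun i => isBigO_pi.2 fun j =>
      (ha _ (hP.smooth _ _ (hΦi i) (hΦi j))).isBigO_apply y

/-- Brackets pulled back by an approximation of a Poisson map `b_ε(y) ↦ a_ε(y)` approximate the
original ones. -/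
theorem isBigO_bracket_pullbackTensor {P : TwoTensorField E M} (hP : IsPoissonTensor P)
    {I J : Set ℝ} (hI : Convex ℝ I) (hI' : I.Nontrivial) (h0 : (0 : ℝ) ∈ I) (hJI : J ⊆ I)
    (hJ : J ∈ 𝓝[I] 0) {n : ℕ} {a b a' b' : ℝ → M → M}
    (ha : IsSmoothFamily E E I a) (hb : IsSmoothFamily E E I b)
    (ha' : IsSmoothFamily E E I a') (hb' : IsSmoothFamily E E I b')
    (haa : IsApproximation E I n a a') (hbb : IsApproximation E I n b b')
    (hai : ∀ ε ∈ J, ∀ y, Function.Injective (modelDeriv (F := E) (E := E) (a ε) y))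
    (hai' : ∀ ε ∈ J, ∀ y, Function.Injective (modelDeriv (F := E) (E := E) (a' ε) y))
    (hbi' : ∀ ε ∈ J, ∀ y, Function.Injective (modelDeriv (F := E) (E := E) (b' ε) y))
    (hexact : ∀ ε ∈ J, ε ≠ 0 → ∀ (y : M) (ξ₁ ξ₂ η₁ η₂ : E →L[ℝ] ℝ),
      (∀ v, ξ₁ (modelDeriv (F := E) (E := E) (a ε) y v) =
        η₁ (modelDeriv (F := E) (E := E) (b ε) y v)) →
      (∀ v, ξ₂ (modelDeriv (F := E) (E := E) (a ε) y v) =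
        η₂ (modelDeriv (F := E) (E := E) (b ε) y v)) →
      tensorAt P (a ε y) ξ₁ ξ₂ = tensorAt P (b ε y) η₁ η₂)
    {φ : ℝ → M → M} (hφ : ∀ ε ∈ J, MDifferentiable 𝓘(ℝ, E) 𝓘(ℝ, E) (φ ε))
    (hφb : ∀ ε ∈ J, ∀ y, φ ε (b' ε y) = a' ε y)
    {f g : M → ℝ} (hf : IsSmoothFun E f) (hg : IsSmoothFun E g) (y₀ : M) :
    (fun p : M × ℝ => bracket (pullbackTensor (φ p.2) P) f g (b' p.2 p.1)
        - bracket P f g (b' p.2 p.1)) =O[𝓝 y₀ ×ˢ 𝓝[I] 0] fun p => p.2 ^ (n + 1) := by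
  have hIu : UniqueDiffOn ℝ I := uniqueDiffOn_convex hI (hI.nontrivial_iff_nonempty_interior.1 hI')
  have h0J : (0 : ℝ) ∈ J := mem_of_mem_nhdsWithin h0 hJ
  set bas := Module.finBasis ℝ E
  set x₀ := a 0 y₀
  have hx₀' : a' 0 y₀ = x₀ := (haa.eq_zero h0 y₀).symm
  have hx₀ : x₀ ∈ (chartAt E x₀).source := mem_chart_source _ _
  obtain ⟨Φ, hΦ, hΦe⟩ := exists_smooth_eventuallyEq_extChartAt hx₀
  have hNx : ∀ᶠ x in 𝓝 x₀, Function.Injective (vectorDifferential (F := E) Φ x) := by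
    filter_upwards [hΦe.eventually_nhds, (chartAt E x₀).open_source.mem_nhds hx₀] with x hx hxs
    rw [vectorDifferential_congr hx]
    exact injective_vectorDifferential_extChartAt hxs
  set ψ := extChartAt 𝓘(ℝ, E) y₀
  set R : ℝ → M → _ := fun ε => pairingData P bas Φ f g (a ε) (b ε)
  set R' : ℝ → M → _ := fun ε => pairingData P bas Φ f g (a' ε) (b' ε)
  have hRm := contMDiffOn_pairingData hP bas hΦ hf hg ha hb
  have hRm' := contMDiffOn_pairingData hP bas hΦ hf hg ha' hb'
  have hR := contDiffOn_family_inChart (h := R) hRm y₀ Subset.rfl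
  have hR' := contDiffOn_family_inChart (h := R') hRm' y₀ Subset.rfl
  have hU : IsOpen ψ.target := isOpen_extChartAt_target y₀
  have hu₀ : ψ y₀ ∈ ψ.target := mem_extChartAt_target y₀
  set X : E × ℝ → _ := fun p => (fderiv ℝ (fun u => R p.2 (ψ.symm u)) p.1, R p.2 (ψ.symm p.1))
  set X' : E × ℝ → _ := fun p => (fderiv ℝ (fun u => R' p.2 (ψ.symm u)) p.1, R' p.2 (ψ.symm p.1))
  have hXc : ContinuousOn X (ψ.target ×ˢ I) :=
    (continuousOn_fderiv_slice hIu hU hR).prodMk hR.continuousOn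
  have hlim : Tendsto X (𝓝 (ψ y₀) ×ˢ 𝓝[I] 0) (𝓝 (X (ψ y₀, 0))) := by
    have := hXc (ψ y₀, 0) ⟨hu₀, h0⟩
    rwa [ContinuousWithinAt, nhdsWithin_prod_eq, hU.nhdsWithin_eq hu₀] at this
  have hmem : ∀ᶠ p in 𝓝 (ψ y₀) ×ˢ 𝓝[I] (0 : ℝ), p ∈ ψ.target ×ˢ I :=
    prod_mem_prod (hU.mem_nhds hu₀) self_mem_nhdsWithin
  -- The hypotheses bound values only; the derivative component comes from the parametric Taylor
  -- argument applied to `R - R'`.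
  have hsub : (fun p => X p - X' p) =O[𝓝 (ψ y₀) ×ˢ 𝓝[I] 0] fun p => p.2 ^ (n + 1) := by
    have hO : ∀ u ∈ ψ.target, (fun ε => (fun p : E × ℝ => R p.2 (ψ.symm p.1) - R' p.2 (ψ.symm p.1))
        (u, ε)) =O[𝓝[I] 0] fun ε => ε ^ (n + 1) := fun u _ =>
      isBigO_pairingData_sub hP bas hΦ hf hg haa hbb (ψ.symm u)
    refine IsBigO.prod_left ?_ ?_
    · refine (fderiv_slice_isBigO hI hI' h0 hU (n + 1) (hR.sub hR') hO hu₀).congr' ?_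
        EventuallyEq.rfl
      filter_upwards [hmem] with p hp
      exact fderiv_sub (hasFDerivAt_slice hU hR hp.1 hp.2).differentiableAt
        (hasFDerivAt_slice hU hR' hp.1 hp.2).differentiableAt
    · exact (isBigO_and_fderivWithin_isBigO hI hI' h0 hU (n + 1) (hR.sub hR') hO hu₀).1
  have hlim' : Tendsto X' (𝓝 (ψ y₀) ×ˢ 𝓝[I] 0) (𝓝 (X (ψ y₀, 0))) := by
    have h1 : Tendsto (fun p : E × ℝ => p.2 ^ (n + 1)) (𝓝 (ψ y₀) ×ˢ 𝓝[I] 0) (𝓝 0) := by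
      have h2 : Tendsto (fun p : E × ℝ => p.2) (𝓝 (ψ y₀) ×ˢ 𝓝[I] 0) (𝓝 0) :=
        tendsto_snd.mono_right nhdsWithin_le_nhds
      simpa using h2.pow (n + 1)
    have h3 := hlim.sub (hsub.trans_tendsto h1)
    rw [sub_zero] at h3
    exact h3.congr fun p => sub_sub_cancel _ _
  have hsrc : ∀ᶠ y in 𝓝 y₀, y ∈ (chartAt E y₀).source := chart_source_mem_nhds E y₀
  have hfam : ∀ c : ℝ → M → M, IsSmoothFamily E E I c → c 0 y₀ = x₀ →
      ∀ᶠ p in 𝓝 y₀ ×ˢ 𝓝[I] (0 : ℝ),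
        Function.Injective (vectorDifferential (F := E) Φ (c p.2 p.1)) := by
    intro c hc hcx
    have := hc.continuousOn (y₀, 0) ⟨mem_univ _, h0⟩
    rw [ContinuousWithinAt, nhdsWithin_prod_eq, nhdsWithin_univ] at this
    have h2 : Tendsto (fun p : M × ℝ => c p.2 p.1) (𝓝 y₀ ×ˢ 𝓝[I] 0) (𝓝 x₀) := hcx ▸ this
    exact h2.eventually hNx
  have hdefect : ∀ c d : ℝ → M → M, IsSmoothFamily E E I c → IsSmoothFamily E E I d →
      (∀ ε ∈ J, ∀ y, Function.Injective (modelDeriv (F := E) (E := E) (c ε) y)) →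
      ∀ ε ∈ J, ∀ y ∈ (chartAt E y₀).source,
        Function.Injective (vectorDifferential (F := E) Φ (c ε y)) → _ := fun c d hc hd hci ε hε y hy hΦi =>
    exists_pairingDefect_eq P bas hy ((hc.contMDiff (hJI hε)).mdifferentiable (by simp) y)
      ((hd.contMDiff (hJI hε)).mdifferentiable (by simp) y) (hΦ.mdifferentiable (by simp) _)
      (hf.mdifferentiable (by simp) _) (hg.mdifferentiable (by simp) _) (by
        have h1 := contMDiffOn_pairingData hP bas hΦ hf hg hc hd
        have h2 : ContMDiffOn 𝓘(ℝ, E) (𝓘(ℝ, E).prod 𝓘(ℝ, ℝ)) ∞ (fun z : M => (z, ε)) univ :=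
          contMDiffOn_id.prodMk contMDiffOn_const
        have h3 := h1.comp h2 fun z _ => ⟨mem_univ _, hJI hε⟩
        exact (contMDiffOn_univ.1 h3).mdifferentiable (by simp) y) hΦi (hci ε hε y)
  have hsymm : ∀ y ∈ (chartAt E y₀).source, ψ.symm (ψ y) = y := fun y hy =>
    ψ.left_inv (by rwa [extChartAt_source])
  have hunit := (hdefect a b ha hb hai 0 h0J y₀ (mem_chart_source _ _) hNx.self_of_nhds).1
  -- Strict differentiability makes the defect Lipschitz near the limit point, to which both `X` and
  -- `X'` converge.
  have hstrict := ((contDiffAt_pairingDefect bas (q := X (ψ y₀, 0)) hunit).hasStrictFDerivAt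
    (by simp)).isBigO_sub
  have hψ : Tendsto (fun p : M × ℝ => (ψ p.1, p.2)) (𝓝 y₀ ×ˢ 𝓝[I] 0) (𝓝 (ψ y₀) ×ˢ 𝓝[I] 0) :=
    Tendsto.prodMap (continuousAt_extChartAt y₀) tendsto_id
  have hmain := ((hstrict.comp_tendsto (hlim.prodMk_nhds hlim')).trans hsub).comp_tendsto hψ
  -- The exact family has no defect for `ε ≠ 0` by `hexact`, and at `ε = 0` by continuity of the
  -- defect along `I \ {0}`.
  have hvan : ∀ᶠ p : M × ℝ in 𝓝 y₀ ×ˢ 𝓝[I] (0 : ℝ), pairingDefect bas (X (ψ p.1, p.2)) = 0 := by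
    obtain ⟨s, hs, t, ht, hst⟩ := eventually_prod_iff.1 ((hfam a ha rfl).and
      (prod_mem_prod hsrc hJ))
    have hne : ∀ y, s y → ∀ ε, t ε → ε ≠ 0 → pairingDefect bas (X (ψ y, ε)) = 0 := by
      intro y hy ε hε hε0
      obtain ⟨h1, h2, h3⟩ := hst hy hε
      obtain ⟨-, ξ₁, ξ₂, h4, h5, h6⟩ := hdefect a b ha hb hai ε h3 y h2 h1
      have h7 : X (ψ y, ε) = (fderiv ℝ (fun u => R ε (ψ.symm u)) (ψ y), R ε y) := by
        simp only [X]
        rw [hsymm y h2]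
      rw [h7]
      refine h6.trans (sub_eq_zero.2 ?_)
      exact hexact ε h3 hε0 y _ _ _ _ h4 h5
    refine eventually_prod_iff.2 ⟨s, hs, t, ht, fun {y} hy {ε} hε => ?_⟩
    by_cases hε0 : ε = 0
    · subst hε0
      obtain ⟨h1, h2, -⟩ := hst hy hε
      have hyt : ψ y ∈ ψ.target := ψ.map_source (by rwa [extChartAt_source])
      have hu := (hdefect a b ha hb hai 0 h0J y h2 h1).1
      have h8 : Tendsto (fun ε => pairingDefect bas (X (ψ y, ε))) (𝓝[I] 0)
          (𝓝 (pairingDefect bas (X (ψ y, 0)))) := by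
        have h9 : ContinuousWithinAt (fun ε => X (ψ y, ε)) I 0 :=
          (hXc (ψ y, 0) ⟨hyt, h0⟩).comp (by fun_prop) fun ε hε => ⟨hyt, hε⟩
        exact (contDiffAt_pairingDefect bas (q := X (ψ y, 0)) hu).continuousAt.tendsto.comp h9
      have := neBot_nhdsWithin_diff_singleton_zero hI hI' h0
      refine tendsto_nhds_unique (l := 𝓝[I \ {0}] (0 : ℝ)) (h8.mono_left (nhdsWithin_mono _ sdiff_subset))
        (tendsto_const_nhds.congr' ?_)
      filter_upwards [nhdsWithin_mono _ sdiff_subset ht, self_mem_nhdsWithin] with ε h10 h11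
      exact (hne y hy ε h10 h11.2).symm
    · exact hne y hy ε hε hε0
  refine hmain.neg_left.congr' ?_ EventuallyEq.rfl
  filter_upwards [hvan, hfam a' ha' hx₀', prod_mem_prod hsrc hJ] with p hp hp1 hp2
  obtain ⟨-, ξ₁, ξ₂, h4, h5, h6⟩ := hdefect a' b' ha' hb' hai' p.2 hp2.2 p.1 hp2.1 hp1
  have h7 : X' (ψ p.1, p.2) = (fderiv ℝ (fun u => R' p.2 (ψ.symm u)) (ψ p.1), R' p.2 p.1) := by
    simp only [X']
    rw [hsymm _ hp2.1]
  have h8 : pairingDefect bas (X' (ψ p.1, p.2)) = _ := (congrArg _ h7).trans h6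
  simp only [Function.comp_apply]
  rw [hp, zero_sub, neg_neg, h8]
  have hbd := (hb'.contMDiff (hJI hp2.2)).mdifferentiable (by simp) p.1
  have hchain : ∀ v, modelDeriv (F := E) (E := E) (a' p.2) p.1 v =
      modelDeriv (F := E) (E := E) (φ p.2) (b' p.2 p.1)
        (modelDeriv (F := E) (E := E) (b' p.2) p.1 v) := by
    intro v
    have h9 := mfderiv_comp p.1 (hφ p.2 hp2.2 (b' p.2 p.1)) hbd
    have h10 : φ p.2 ∘ b' p.2 = a' p.2 := funext (hφb p.2 hp2.2)
    rw [h10] at h9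
    exact congrArg (fun L : E →L[ℝ] E => L v) h9
  -- Every tangent vector at `b' y` comes from one at `y`, so the relations between covectors pulled
  -- back to `y` become relations through the derivative of `φ`, as `bracket_pullbackTensor_eq`
  -- requires.
  have hsurj : Function.Surjective (modelDeriv (F := E) (E := E) (b' p.2) p.1) :=
    (LinearMap.injective_iff_surjective
      (f := (modelDeriv (F := E) (E := E) (b' p.2) p.1 : E →ₗ[ℝ] E))).1 (hbi' p.2 hp2.2 p.1)
  have hφi : Function.Injective (modelDeriv (F := E) (E := E) (φ p.2) (b' p.2 p.1)) := by
    intro v w hvw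
    obtain ⟨v, rfl⟩ := hsurj v
    obtain ⟨w, rfl⟩ := hsurj w
    rw [← hchain, ← hchain] at hvw
    rw [hai' p.2 hp2.2 p.1 hvw]
  rw [bracket_pullbackTensor_eq P hφi (ξ₁ := ξ₁) (ξ₂ := ξ₂), hφb p.2 hp2.2, bracket_eq_tensorAt]
  · intro v
    obtain ⟨v, rfl⟩ := hsurj v
    rw [← hchain, h4]
  · intro v
    obtain ⟨v, rfl⟩ := hsurj v
    rw [← hchain, h5]

end Families

/-! ### Bisections and induced maps from parametrizations -/

section Bisections

open Filter

variable {E : Type*} [NormedAddCommGroup E] [NormedSpace ℝ E] [FiniteDimensional ℝ E]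
  {M : Type*} [TopologicalSpace M] [ChartedSpace E M] [IsManifold 𝓘(ℝ, E) ∞ M]
  {F : Type*} [NormedAddCommGroup F] [NormedSpace ℝ F] [FiniteDimensional ℝ F]
  {S : Type*} [TopologicalSpace S] [ChartedSpace F S] [IsManifold 𝓘(ℝ, F) ∞ S]

theorem IsCloseJet.comp {κ : Type*} {fs : SmoothBumpCovering κ 𝓘(ℝ, E) M univ} {ρ : M → ℝ}
    {γ : S → M} {ι : M → S} {x : M} (hj : IsCloseJet fs ρ γ (oneJet ι x : OneJets E M F S))
    (hγ : MDifferentiable 𝓘(ℝ, F) 𝓘(ℝ, E) γ) (hι : MDifferentiable 𝓘(ℝ, E) 𝓘(ℝ, F) ι) :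
    IsCloseJet fs ρ (γ ∘ ι) (oneJet id x : OneJets E M E M) where
  mem_support := hj.mem_support
  mem_source := hj.mem_source
  norm_sub_le := fun i hi v => by
    have hmd : MDifferentiableAt 𝓘(ℝ, F) 𝓘(ℝ, E) (extChartAt 𝓘(ℝ, E) (fs.c i) ∘ γ) (ι x) :=
      (mdifferentiableAt_extChartAt (hj.mem_source i hi)).comp _ (hγ _)
    have h1 : vectorDifferential (F := E) (extChartAt 𝓘(ℝ, E) (fs.c i) ∘ γ ∘ ι) x v =
        vectorDifferential (F := F) (extChartAt 𝓘(ℝ, E) (fs.c i) ∘ γ) (ι x)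
          (modelDeriv ι x v) := vectorDifferential_comp hmd (hι x) v
    have h2 : jetMap (oneJet (id : M → M) x : OneJets E M E M) v = v := by
      have : mfderiv 𝓘(ℝ, E) 𝓘(ℝ, E) (id : M → M) x = ContinuousLinearMap.id ℝ _ := mfderiv_id
      exact congrArg (fun L : E →L[ℝ] E => L v) this
    rw [h2]
    have h3 := hj.norm_sub_le i hi v
    change ‖vectorDifferential (F := F) (extChartAt 𝓘(ℝ, E) (fs.c i) ∘ γ) (ι x)
      (modelDeriv ι x v) - _‖ ≤ _ at h3
    rw [← h1] at h3
    exact h3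
  abs_sub_lt := hj.abs_sub_lt
  mem_connectedComponent := hj.mem_connectedComponent

theorem exists_contMDiff_rightInverse {b : M → M} (hb : Function.Bijective b)
    (hbs : ContMDiff 𝓘(ℝ, E) 𝓘(ℝ, E) ∞ b)
    (hinj : ∀ x, Function.Injective (mfderiv 𝓘(ℝ, E) 𝓘(ℝ, E) b x)) :
    ∃ c : M → M, ContMDiff 𝓘(ℝ, E) 𝓘(ℝ, E) ∞ c ∧ ∀ x, b (c x) = x := by
  obtain ⟨c, hl, hr⟩ := Function.bijective_iff_has_inverse.1 hb
  refine ⟨c, fun x => ?_, hr⟩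
  have := contMDiffAt_leftInverse hl (hbs (c x)) (hinj (c x))
  rwa [hr] at this

theorem restrictsToDiffeo_range {γ : S → M} (hγ : ContMDiff 𝓘(ℝ, F) 𝓘(ℝ, E) ∞ γ) {ι : M → S}
    (hι : ContMDiff 𝓘(ℝ, E) 𝓘(ℝ, F) ∞ ι) (hb : Function.Bijective (γ ∘ ι))
    (hinj : ∀ x, Function.Injective (mfderiv 𝓘(ℝ, E) 𝓘(ℝ, E) (γ ∘ ι) x)) :
    RestrictsToDiffeo F E γ (range ι) := by
  obtain ⟨c, hc, hbc⟩ := exists_contMDiff_rightInverse hb (hγ.comp hι) hinj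
  refine ⟨⟨mapsTo_univ _ _, ?_, fun x _ => ⟨ι (c x), mem_range_self _, hbc x⟩⟩,
    ι ∘ c, hι.comp hc, fun x => mem_range_self _, hbc⟩
  rintro _ ⟨x, rfl⟩ _ ⟨y, rfl⟩ hxy
  rw [hb.1 hxy]

theorem inducedMap_range {α β : S → M} {ι : M → S} (hβ : Function.Injective (β ∘ ι)) (y : M) :
    inducedMap α β (range ι) (β (ι y)) = α (ι y) := by
  have h : ∃ z ∈ range ι, β z = β (ι y) := ⟨ι y, mem_range_self y, rfl⟩
  obtain ⟨⟨y', hy'⟩, h2⟩ := h.choose_spec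
  rw [← hy'] at h2
  rw [inducedMap, dif_pos h, ← hy', hβ h2]

theorem mdifferentiable_inducedMap_range {α β : S → M} (hα : ContMDiff 𝓘(ℝ, F) 𝓘(ℝ, E) ∞ α)
    (hβ : ContMDiff 𝓘(ℝ, F) 𝓘(ℝ, E) ∞ β) {ι : M → S} (hι : ContMDiff 𝓘(ℝ, E) 𝓘(ℝ, F) ∞ ι)
    (hb : Function.Bijective (β ∘ ι))
    (hinj : ∀ x, Function.Injective (mfderiv 𝓘(ℝ, E) 𝓘(ℝ, E) (β ∘ ι) x)) :
    MDifferentiable 𝓘(ℝ, E) 𝓘(ℝ, E) (inducedMap α β (range ι)) := by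
  obtain ⟨c, hc, hbc⟩ := exists_contMDiff_rightInverse hb (hβ.comp hι) hinj
  have h1 : inducedMap α β (range ι) = α ∘ ι ∘ c := by
    ext x
    conv_lhs => rw [← hbc x]
    exact inducedMap_range hb.1 (c x)
  rw [h1]
  exact (hα.comp (hι.comp hc)).mdifferentiable (by simp)

end Bisections

/-! ### The theorem -/

open PoissonRealization in
theorem theorem1
    {E : Type*} [NormedAddCommGroup E] [NormedSpace ℝ E] [FiniteDimensional ℝ E]
    {M : Type*} [TopologicalSpace M] [ChartedSpace E M] [IsManifold 𝓘(ℝ, E) ∞ M]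
    [T2Space M] [SecondCountableTopology M]
    {F : Type*} [NormedAddCommGroup F] [NormedSpace ℝ F] [FiniteDimensional ℝ F]
    {S : Type*} [TopologicalSpace S] [ChartedSpace F S] [IsManifold 𝓘(ℝ, F) ∞ S]
    [T2Space S] [SecondCountableTopology S]
    (P : TwoTensorField E M) (hP : IsPoissonTensor P)
    (Ω : SymplecticForm F S)
    -- the parameter `ε` ranges over an interval `I` containing `0`, e.g. `[0, ε₁)` or `[0, ∞)`
    (I : Set ℝ) (hI : I.OrdConnected) (hI' : I.Nontrivial) (h0 : (0 : ℝ) ∈ I)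
    (n : ℕ) (αhat βhat : ℝ → S → M) (σ : M → S)
    (hR : IsApproxRealizationData Ω P I n αhat βhat σ)
    -- any compact range `J ⊆ I` of parameters that is a neighbourhood of `0` in `I`
    (J : Set ℝ) (hJ : IsCompact J) (hJI : J ⊆ I) (hJ0 : J ∈ 𝓝[I] 0) :
    ∃ W : Set (OneJets E M F S), IsOpen W ∧ JetsIn W σ ∧
      ∀ ι : M → S, IsLagrangianEmbedding (E := E) Ω ι → JetsIn W ι →
        (∀ ε ∈ J, IsBisection F E (αhat ε) (βhat ε) (range ι)) ∧
        (∀ f g : M → ℝ, IsSmoothFun E f → IsSmoothFun E g →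
          IsUniformO I (n + 1) (fun ε x =>
            bracket (pullbackTensor (inducedMap (αhat ε) (βhat ε) (range ι)) P) f g x
              - bracket P f g x)) ∧
        (∀ C : M → ℝ, IsCasimir P C →
          IsUniformO I (n + 1) (fun ε x =>
            C (inducedMap (αhat ε) (βhat ε) (range ι) x) - C x)) := by
  obtain ⟨α, β, hα, hβ, hdata, haa, hbb⟩ := hR.approximates
  have hIc : Convex ℝ I := hI.convex
  have hIu : UniqueDiffOn ℝ I :=
    uniqueDiffOn_convex hIc (hIc.nontrivial_iff_nonempty_interior.1 hI')
  have hσ : ContMDiff 𝓘(ℝ, E) 𝓘(ℝ, F) ∞ σ := (hdata 0 h0).lagrangian.embedding.contMDiff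
  have : LocallyCompactSpace M := ChartedSpace.locallyCompactSpace E M
  obtain ⟨κ, fs, -⟩ := SmoothBumpCovering.exists_isSubordinate 𝓘(ℝ, E) (M := M) isClosed_univ
    (U := fun _ => univ) fun x _ => Filter.univ_mem
  obtain ⟨ρ, hρ⟩ := exists_continuous_isCompact_le M
  -- The exact `α` is included because its composition with `ι` must be immersive in the tensor
  -- comparison. The last clause ranges over all `u`, so the open set of jets is fixed before any
  -- Casimir is given.
  set good : OneJets E M F S → ℝ → Prop := fun j ε =>
    IsCloseJet fs ρ (αhat ε) j ∧ IsCloseJet fs ρ (βhat ε) j ∧ IsCloseJet fs ρ (α ε) j ∧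
    ∀ u : S → ℝ, MDifferentiable 𝓘(ℝ, F) 𝓘(ℝ, ℝ) u →
      (∀ z v, mfderiv 𝓘(ℝ, F) 𝓘(ℝ, E) (β ε) z v = 0 → differential (E := F) u z v = 0) →
      u j.proj.2 = u (σ (β ε j.proj.2)) with hgood
  refine ⟨interior {j | ∀ ε ∈ J, good j ε}, isOpen_interior, fun x => ?_, fun ι hι hιW => ?_⟩
  · refine mem_interior_iff_mem_nhds.2 ?_
    have key : ∀ ε₀ ∈ J, ∀ᶠ q in 𝓝 ((oneJet σ x : OneJets E M F S), ε₀), q.2 ∈ J → good q.1 q.2 := by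
      intro ε₀ hε₀
      have hε₀I := hJI hε₀
      have h1 := Filter.eventually_inf_principal.1 (eventually_isCloseJet fs ρ.continuous hIu
        hR.smooth_left hσ hε₀I (hR.section_left ε₀ hε₀I) x)
      have h2 := Filter.eventually_inf_principal.1 (eventually_isCloseJet fs ρ.continuous hIu
        hR.smooth_right hσ hε₀I (hR.section_right ε₀ hε₀I) x)
      have h3 := Filter.eventually_inf_principal.1 (eventually_isCloseJet fs ρ.continuous hIu
        hα hσ hε₀I (hdata ε₀ hε₀I).section_left x)
      have h4 := Filter.eventually_inf_principal.1 (eventually_eq_section_of_fibres hIu hβ hσ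
        (fun ε hε => (hdata ε hε).section_right) x hε₀I)
      have h5 : Filter.Tendsto (fun q : OneJets E M F S × ℝ => (q.1.proj.2, q.2))
          (𝓝 ((oneJet σ x : OneJets E M F S), ε₀)) (𝓝 (σ x, ε₀)) :=
        (tendsto_jet_snd _ ε₀).prodMk_nhds continuous_snd.continuousAt
      filter_upwards [h1, h2, h3, h5.eventually h4] with q hq1 hq2 hq3 hq4 hq
      have hq' : q.2 ∈ I := hJI hq
      exact ⟨hq1 ⟨mem_univ _, hq'⟩, hq2 ⟨mem_univ _, hq'⟩, hq3 ⟨mem_univ _, hq'⟩,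
        hq4 ⟨mem_univ _, hq'⟩⟩
    -- Compactness of `J` turns neighbourhoods of the pairs (jet of `σ`, `ε₀`) into one
    -- neighbourhood of the jet that works for all `ε ∈ J`.
    filter_upwards [hJ.eventually_forall_of_forall_eventually (P := fun j ε => ε ∈ J → good j ε)
      key] with j hj ε hε using hj ε hε hε
  have hgoodι : ∀ x, ∀ ε ∈ J, good (oneJet ι x) ε := fun x => interior_subset (hιW x)
  have hιs : ContMDiff 𝓘(ℝ, E) 𝓘(ℝ, F) ∞ ι := hι.embedding.contMDiff
  have hιd : MDifferentiable 𝓘(ℝ, E) 𝓘(ℝ, F) ι := hιs.mdifferentiable (by simp)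
  have hbij : ∀ γ : S → M, ContMDiff 𝓘(ℝ, F) 𝓘(ℝ, E) ∞ γ →
      (∀ x, IsCloseJet fs ρ γ (oneJet ι x : OneJets E M F S)) → Function.Bijective (γ ∘ ι) ∧
        ∀ x, Function.Injective (mfderiv 𝓘(ℝ, E) 𝓘(ℝ, E) (γ ∘ ι) x) := fun γ hγ h =>
    bijective_of_isCloseJet fs ρ.continuous hρ (hγ.comp hιs)
      fun x => (h x).comp (hγ.mdifferentiable (by simp)) hιd
  have hsα := fun ε (hε : ε ∈ J) => hR.smooth_left.contMDiff (hJI hε)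
  have hsβ := fun ε (hε : ε ∈ J) => hR.smooth_right.contMDiff (hJI hε)
  have hbα := fun ε (hε : ε ∈ J) => hbij _ (hsα ε hε) fun x => (hgoodι x ε hε).1
  have hbβ := fun ε (hε : ε ∈ J) => hbij _ (hsβ ε hε) fun x => (hgoodι x ε hε).2.1
  have hbα' := fun ε (hε : ε ∈ J) =>
    hbij _ (hα.contMDiff (hJI hε)) fun x => (hgoodι x ε hε).2.2.1
  refine ⟨fun ε hε => ⟨restrictsToDiffeo_range (hsα ε hε) hιs (hbα ε hε).1 (hbα ε hε).2,
    restrictsToDiffeo_range (hsβ ε hε) hιs (hbβ ε hε).1 (hbβ ε hε).2⟩, fun f g hf hg => ?_,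
    fun C hC => ?_⟩
  · refine isUniformO_of_isBigO_comp hJ0 ρ.continuous hρ (b := fun ε y => βhat ε (ι y))
      (fun ε hε => (hbβ ε hε).1.2) (fun ε hε y => (hgoodι y ε hε).2.1.abs_sub_lt) fun y₀ => ?_
    refine isBigO_bracket_pullbackTensor hP hIc hI' h0 hJI hJ0
      (hα.comp_contMDiff hιs) (hβ.comp_contMDiff hιs)
      (hR.smooth_left.comp_contMDiff hιs) (hR.smooth_right.comp_contMDiff hιs)
      (fun u hu => (haa u hu).comp_continuous hιs.continuous)
      (fun u hu => (hbb u hu).comp_continuous hιs.continuous)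
      (fun ε hε => (hbα' ε hε).2) (fun ε hε => (hbα ε hε).2) (fun ε hε => (hbβ ε hε).2) ?_
      (fun ε hε => mdifferentiable_inducedMap_range (hsα ε hε) (hsβ ε hε) hιs (hbβ ε hε).1
        (hbβ ε hε).2) (fun ε hε y => inducedMap_range (hbβ ε hε).1.1 y) hf hg y₀
    intro ε hε hε0 y ξ₁ ξ₂ η₁ η₂ h1 h2
    refine lagrangian_bisection_poisson hε0 (hdata ε (hJI hε)) hι ?_ h1 h2
    -- Injectivity of `D(α_ε ∘ ι)` forces injectivity of `Dι`.
    have h3 := (hbα' ε hε).2 y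
    rw [mfderiv_comp y ((hα.contMDiff (hJI hε)).mdifferentiable (by simp) _) (hιd y)] at h3
    exact Function.Injective.of_comp h3
  · refine isUniformO_of_isBigO_comp hJ0 ρ.continuous hρ (b := fun ε y => βhat ε (ι y))
      (fun ε hε => (hbβ ε hε).1.2) (fun ε hε y => (hgoodι y ε hε).2.1.abs_sub_lt) fun y₀ => ?_
    have h1 := ((haa C hC.smooth).comp_continuous hιs.continuous).isBigO y₀
    have h2 := ((hbb C hC.smooth).comp_continuous hιs.continuous).isBigO y₀
    -- Since `C ∘ α_ε = C ∘ β_ε` on `L`, the quantity `C ∘ α̂_ε - C ∘ β̂_ε` is exactly the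
    -- difference of the two approximation errors.
    refine (h2.sub h1).congr' ?_ Filter.EventuallyEq.rfl
    filter_upwards [Filter.prod_mem_prod Filter.univ_mem hJ0] with p hp
    have hεI := hJI hp.2
    -- Constancy of `C ∘ α_ε` on the `β_ε`-fibre moves the point to the section; then `α_ε ∘ σ = id`
    -- turns the right side into `C (β_ε (ι y))`.
    have h3 : C (α p.2 (ι p.1)) = C (α p.2 (σ (β p.2 (ι p.1)))) :=
      (hgoodι p.1 p.2 hp.2).2.2.2 (C ∘ α p.2)
        ((hC.smooth.comp (hα.contMDiff hεI)).mdifferentiable (by simp))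
        (casimir_comp_differential_eq_zero (hdata p.2 hεI) hC)
    rw [(hdata p.2 hεI).section_left] at h3
    rw [inducedMap_range (hbβ p.2 hp.2).1.1, h3]
    ring
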